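/- Let $\mathcal M_{1,1}$ be the stack of elliptic curves over $\mathbf C$, and let $\mathcal M_{1,1}^{\rm an}$ be its analytification, the stack of analytic families of elliptic curves over complex manifolds. Let $\pi\colon\mathcal E\to\mathcal M_{1,1}$ be the universal elliptic curve. For $N\ge 1$ let $\mathcal E[N]$ be the sheaf on $\mathcal M_{1,1}^{\rm an}$ that assigns to a family $E\to S$ the group $E[N](S)$ of its $N$-torsion sections. For an elliptic curve $E$ over $\mathbf C$ let $E[4]^\ast$ and $E[2]^\ast$ be the sets of points of $E$ of exact order $4$ and of exact order $2$. Multiplication by $2$ induces a $2:1$ map $\varphi\colon E[4]^\ast/\langle -1\rangle\to E[2]^\ast$. Let $T(E)$ be the set of unordered partitions of $\varphi$ into a disjoint union of two $1:1$ covers, that is, the set of all $\{P,Q\}$ where $E[4]^\ast/\langle -1\rangle$ is the disjoint union of $P$ and $Q$, and $\varphi$ restricts to bijections $P\to E[2]^\ast$ and $Q\to E[2]^\ast$. The group $E[2]$ acts on $T(E)$ by translation. For a family $E\to S$ with fibers $E_s$, the locally constant families $(t_s\in T(E_s))_{s\in S}$ (those for which, locally on $S$, the parts of $t_s$ consist of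 the classes of sections of $E[4]$) are the sections of a sheaf $T$ on $\mathcal M_{1,1}^{\rm an}$ with an action of $\mathcal E[2]$. Then $T$ is an $\mathcal E[2]$-torsor, $$\mathrm H^1(\mathcal M_{1,1}^{\rm an},\,\mathcal E[2])\cong\mathbf Z/2\mathbf Z,$$ and the unique non-zero element of this group is the class of $T$. -/

import Mathlib

open CategoryTheory Opposite Topology TopologicalSpace Filter

/-! ## Analytic families of elliptic curves -/

namespace EllipticModuli

/-- A map `f` from an open subset `S` of `ℂⁿ` to a complex normed space is holomorphic at `s`:
near `s` it is given by a convergent power series. -/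
def HolomorphicAt {n : ℕ} {S : Opens (Fin n → ℂ)} {V : Type*} [NormedAddCommGroup V]
    [NormedSpace ℂ V] (f : S → V) (s : S) : Prop :=
  ∃ F : (Fin n → ℂ) → V, AnalyticAt ℂ F s ∧ ∀ᶠ u : S in 𝓝 s, f u = F u

/-- An analytic family of elliptic curves over an open subset `S` of some `ℂⁿ`, presented as
`E = (S × ℂ) / Λ`: the lattices `Λ s ⊆ ℂ` vary holomorphically with `s`, that is, they are
locally spanned by two holomorphic functions that are `ℝ`-linearly independent pointwise.
Up to isomorphism, every family of elliptic curves over a complex manifold is locally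
of this form: `Λ` is the image of the relative first homology in the relative Lie algebra, and the
latter is a line bundle, which is locally trivial. -/
structure Family where
  dim : ℕ
  base : Opens (Fin dim → ℂ)
  lattice : base → AddSubgroup ℂ
  exists_periods : ∀ s : base, ∃ ω₁ ω₂ : base → ℂ,
    HolomorphicAt ω₁ s ∧ HolomorphicAt ω₂ s ∧
      ∀ᶠ u : base in 𝓝 s, LinearIndependent ℝ ![ω₁ u, ω₂ u] ∧
        lattice u = AddSubgroup.closure {ω₁ u, ω₂ u}

/-- The elliptic curve `E_s = ℂ / Λ_s`. -/
abbrev Family.Fiber (X : Family) (s : X.base) : Type := ℂ ⧸ X.lattice s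

/-- Multiplication by a nonzero complex number, as an automorphism of the group `ℂ`. -/
def unitMul (c : ℂˣ) : ℂ ≃+ ℂ := Multiplicative.toAdd (AddAut.mulLeft c)

@[simp] lemma unitMul_apply (c : ℂˣ) (z : ℂ) : unitMul c z = c * z := rfl

/-- A morphism from `E / S` to `E' / S'`: a holomorphic map `f : S → S'` together with an
isomorphism of families of elliptic curves from `f^* E'` to `E`. The latter is
multiplication by a nowhere vanishing holomorphic function `c` with `c s • Λ'_{f s} = Λ_s`. -/
@[ext]
structure Family.Hom (X Y : Family) where
  toFun : X.base → Y.base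
  factor : X.base → ℂˣ
  holomorphic_toFun : ∀ s, HolomorphicAt (fun u => (toFun u : Fin Y.dim → ℂ)) s
  holomorphic_factor : ∀ s, HolomorphicAt (fun u => (factor u : ℂ)) s
  map_lattice : ∀ s, (Y.lattice (toFun s)).map (unitMul (factor s) : ℂ →+ ℂ) = X.lattice s

/-! ### Facts on holomorphic maps -/

lemma HolomorphicAt.continuousAt {n : ℕ} {S : Opens (Fin n → ℂ)} {V : Type*}
    [NormedAddCommGroup V] [NormedSpace ℂ V] {f : S → V} {s : S} (hf : HolomorphicAt f s) :
    ContinuousAt f s := by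
  obtain ⟨F, hF, h⟩ := hf
  have : ContinuousAt (fun u : S => F u) s :=
    ContinuousAt.comp (f := fun u : S => (u : Fin n → ℂ)) hF.continuousAt
      continuous_subtype_val.continuousAt
  exact this.congr (h.mono fun _ hu => hu.symm)

lemma Family.Hom.continuous {X Y : Family} (g : X.Hom Y) : Continuous g.toFun :=
  continuous_induced_rng.2 <| continuous_iff_continuousAt.2 fun s =>
    (g.holomorphic_toFun s).continuousAt

lemma HolomorphicAt.comp_hom {X Y : Family} (g : X.Hom Y) {V : Type*}
    [NormedAddCommGroup V] [NormedSpace ℂ V] {f : Y.base → V} {s : X.base}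
    (hf : HolomorphicAt f (g.toFun s)) : HolomorphicAt (fun u => f (g.toFun u)) s := by
  obtain ⟨F, hF, h⟩ := hf
  obtain ⟨G, hG, h'⟩ := g.holomorphic_toFun s
  have hs : ((g.toFun s : Y.base) : Fin Y.dim → ℂ) = G s := h'.self_of_nhds
  refine ⟨F ∘ G, AnalyticAt.comp (hs ▸ hF) hG, ?_⟩
  filter_upwards [h', g.continuous.continuousAt.eventually h] with u hu hu'
  rw [hu', hu]; rfl

lemma HolomorphicAt.mul {n : ℕ} {S : Opens (Fin n → ℂ)} {f g : S → ℂ} {s : S}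
    (hf : HolomorphicAt f s) (hg : HolomorphicAt g s) :
    HolomorphicAt (fun u => f u * g u) s := by
  obtain ⟨F, hF, h⟩ := hf
  obtain ⟨G, hG, h'⟩ := hg
  refine ⟨fun u => F u * G u, hF.mul hG, ?_⟩
  filter_upwards [h, h'] with u hu hu'
  rw [hu, hu']

lemma HolomorphicAt.add {n : ℕ} {S : Opens (Fin n → ℂ)} {f g : S → ℂ} {s : S}
    (hf : HolomorphicAt f s) (hg : HolomorphicAt g s) :
    HolomorphicAt (fun u => f u + g u) s := by
  obtain ⟨F, hF, h⟩ := hf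
  obtain ⟨G, hG, h'⟩ := hg
  refine ⟨fun u => F u + G u, hF.add hG, ?_⟩
  filter_upwards [h, h'] with u hu hu'
  rw [hu, hu']

lemma HolomorphicAt.neg {n : ℕ} {S : Opens (Fin n → ℂ)} {f : S → ℂ} {s : S}
    (hf : HolomorphicAt f s) : HolomorphicAt (fun u => -f u) s := by
  obtain ⟨F, hF, h⟩ := hf
  refine ⟨fun u => -F u, hF.neg, ?_⟩
  filter_upwards [h] with u hu
  rw [hu]

lemma holomorphicAt_const {n : ℕ} {S : Opens (Fin n → ℂ)} {V : Type*}
    [NormedAddCommGroup V] [NormedSpace ℂ V] (v : V) (s : S) :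
    HolomorphicAt (fun _ : S => v) s :=
  ⟨fun _ => v, analyticAt_const, Eventually.of_forall fun _ => rfl⟩

lemma holomorphicAt_val {n : ℕ} {S : Opens (Fin n → ℂ)} (s : S) :
    HolomorphicAt (fun u : S => (u : Fin n → ℂ)) s :=
  ⟨fun u => u, analyticAt_id, Eventually.of_forall fun _ => rfl⟩

lemma continuous_inclusion {n : ℕ} {S U : Opens (Fin n → ℂ)} (h : U ≤ S) :
    Continuous (fun u : U => (⟨u, h u.2⟩ : S)) := by fun_prop

lemma HolomorphicAt.restrict {n : ℕ} {S U : Opens (Fin n → ℂ)} (h : U ≤ S) {V : Type*}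
    [NormedAddCommGroup V] [NormedSpace ℂ V] {f : S → V} {s : U}
    (hf : HolomorphicAt f (⟨s, h s.2⟩ : S)) :
    HolomorphicAt (fun u : U => f ⟨u, h u.2⟩) s := by
  obtain ⟨F, hF, h'⟩ := hf
  exact ⟨F, hF, (continuous_inclusion h).continuousAt.eventually h'⟩

lemma eventually_of_restrict {n : ℕ} {S U : Opens (Fin n → ℂ)} (h : U ≤ S) (s : U)
    {p : S → Prop} (hp : ∀ᶠ u : U in 𝓝 s, p ⟨u, h u.2⟩) :
    ∀ᶠ u : S in 𝓝 ⟨s, h s.2⟩, p u := by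
  have ho : IsOpenEmbedding (fun u : U => (⟨u, h u.2⟩ : S)) :=
    IsOpenEmbedding.of_comp _ S.2.isOpenEmbedding_subtypeVal U.2.isOpenEmbedding_subtypeVal
  exact (ho.map_nhds_eq s) ▸ (Filter.eventually_map.2 hp)

/-! ### The category of families -/

lemma unitMul_one : (unitMul 1 : ℂ →+ ℂ) = AddMonoidHom.id ℂ := by
  ext z; simp

instance : Category Family where
  Hom := Family.Hom
  id X :=
    { toFun := id
      factor := fun _ => 1
      holomorphic_toFun := holomorphicAt_val
      holomorphic_factor := holomorphicAt_const _
      map_lattice := fun s => by rw [unitMul_one]; exact AddSubgroup.map_id _ }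
  comp {X Y Z} g h :=
    { toFun := fun s => h.toFun (g.toFun s)
      factor := fun s => g.factor s * h.factor (g.toFun s)
      holomorphic_toFun := fun s => HolomorphicAt.comp_hom g (h.holomorphic_toFun _)
      holomorphic_factor := fun s => by
        simpa using (g.holomorphic_factor s).mul
          (HolomorphicAt.comp_hom g (h.holomorphic_factor _))
      map_lattice := fun s => by
        rw [← g.map_lattice s, ← h.map_lattice (g.toFun s), AddSubgroup.map_map]
        congr 1
        ext z
        simp [mul_assoc] }
  id_comp g := Family.Hom.ext rfl (funext fun s => one_mul _)
  comp_id g := Family.Hom.ext rfl (funext fun s => mul_one _)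
  assoc g h k := Family.Hom.ext rfl (funext fun s => mul_assoc _ _ _)

@[ext] lemma Family.hom_ext {X Y : Family} {g h : X ⟶ Y} (h₁ : g.toFun = h.toFun)
    (h₂ : g.factor = h.factor) : g = h := Family.Hom.ext h₁ h₂

@[simp] lemma Family.id_toFun (X : Family) (s : X.base) : (𝟙 X : X ⟶ X).toFun s = s := rfl
@[simp] lemma Family.id_factor (X : Family) (s : X.base) : (𝟙 X : X ⟶ X).factor s = 1 := rfl
@[simp] lemma Family.comp_toFun {X Y Z : Family} (g : X ⟶ Y) (h : Y ⟶ Z) (s : X.base) :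
    (g ≫ h).toFun s = h.toFun (g.toFun s) := rfl
@[simp] lemma Family.comp_factor {X Y Z : Family} (g : X ⟶ Y) (h : Y ⟶ Z) (s : X.base) :
    (g ≫ h).factor s = g.factor s * h.factor (g.toFun s) := rfl

/-- The restriction of a family to an open subset of the base. -/
def Family.restrict (X : Family) (U : Opens (Fin X.dim → ℂ)) (h : U ≤ X.base) : Family where
  dim := X.dim
  base := U
  lattice u := X.lattice ⟨u, h u.2⟩
  exists_periods u := by
    obtain ⟨ω₁, ω₂, h₁, h₂, h₃⟩ := X.exists_periods ⟨u, h u.2⟩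
    exact ⟨fun u => ω₁ ⟨u, h u.2⟩, fun u => ω₂ ⟨u, h u.2⟩, h₁.restrict h, h₂.restrict h,
      (continuous_inclusion h).continuousAt.eventually h₃⟩

/-- The inclusion of the restriction of a family to an open subset of the base. -/
def Family.incl (X : Family) (U : Opens (Fin X.dim → ℂ)) (h : U ≤ X.base) :
    X.restrict U h ⟶ X where
  toFun := fun u : U => ⟨u, h u.2⟩
  factor _ := 1
  holomorphic_toFun := holomorphicAt_val
  holomorphic_factor := holomorphicAt_const _
  map_lattice s := by rw [unitMul_one]; exact AddSubgroup.map_id _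

/-- The preimage of an open subset under a morphism of families. -/
def Family.preimage {X Y : Family} (g : X ⟶ Y) (U : Opens (Fin Y.dim → ℂ)) :
    Opens (Fin X.dim → ℂ) where
  carrier := {x | ∃ h : x ∈ X.base, (g.toFun ⟨x, h⟩ : Fin Y.dim → ℂ) ∈ U}
  is_open' := by
    have : IsOpen {s : X.base | (g.toFun s : Fin Y.dim → ℂ) ∈ U} :=
      U.2.preimage (continuous_subtype_val.comp (Family.Hom.continuous g))
    convert X.base.2.isOpenMap_subtype_val _ this using 1
    ext x
    simp

lemma Family.preimage_le {X Y : Family} (g : X ⟶ Y) (U : Opens (Fin Y.dim → ℂ)) :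
    Family.preimage g U ≤ X.base := fun _ hx => hx.1

/-- The restriction of a morphism of families to the preimage of an open subset. -/
def Family.restrictHom {X Y : Family} (g : X ⟶ Y) (U : Opens (Fin Y.dim → ℂ))
    (h : U ≤ Y.base) : X.restrict (Family.preimage g U) (Family.preimage_le g U) ⟶
      Y.restrict U h where
  toFun := fun x : Family.preimage g U => (⟨g.toFun ⟨x, x.2.1⟩, x.2.2⟩ : U)
  factor := fun x : Family.preimage g U => g.factor ⟨x, x.2.1⟩
  holomorphic_toFun := fun x : Family.preimage g U =>
    HolomorphicAt.restrict (Family.preimage_le g U) (g.holomorphic_toFun ⟨x, x.2.1⟩)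
  holomorphic_factor := fun x : Family.preimage g U =>
    HolomorphicAt.restrict (Family.preimage_le g U) (g.holomorphic_factor ⟨x, x.2.1⟩)
  map_lattice := fun x : Family.preimage g U => g.map_lattice ⟨x, x.2.1⟩

lemma Family.restrictHom_comp_incl {X Y : Family} (g : X ⟶ Y) (U : Opens (Fin Y.dim → ℂ))
    (h : U ≤ Y.base) : Family.restrictHom g U h ≫ Y.incl U h =
      X.incl (Family.preimage g U) (Family.preimage_le g U) ≫ g :=
  Family.hom_ext rfl (funext fun s => mul_comm (g.factor ⟨s.1, s.2.1⟩) 1)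

/-! ## The site -/

/-- The topology of open coverings: a sieve on `E / S` is covering if every point of `S` has
an open neighbourhood `U` such that the inclusion of `E|_U` belongs to the sieve.

Sheaves on this site are the sheaves on the analytic stack `M_{1,1}^an`: to give such a sheaf is
to give, compatibly with pullback, a sheaf on `S` for each analytic family of elliptic curves
over a complex manifold `S`. -/
def moduliTopology : GrothendieckTopology Family where
  sieves X := {R | ∀ s : X.base, ∃ (U : Opens (Fin X.dim → ℂ)) (h : U ≤ X.base),
    (s : Fin X.dim → ℂ) ∈ U ∧ R (X.incl U h)}
  top_mem' X s := ⟨X.base, le_rfl, s.2, trivial⟩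
  pullback_stable' X Y R g hR y := by
    obtain ⟨U, h, hU, hR⟩ := hR (g.toFun y)
    refine ⟨Family.preimage g U, Family.preimage_le g U, ⟨y.2, hU⟩, ?_⟩
    change R (Y.incl _ _ ≫ g)
    rw [← Family.restrictHom_comp_incl g U h]
    exact R.downward_closed hR _
  transitive' X R hR R' h' s := by
    obtain ⟨U, h, hU, hRU⟩ := hR s
    obtain ⟨W, hW, hsW, hR'⟩ := h' hRU (⟨s, hU⟩ : U)
    refine ⟨W, hW.trans h, hsW, ?_⟩
    have : X.incl W (hW.trans h) = (X.restrict U h).incl W hW ≫ X.incl U h :=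
      Family.hom_ext rfl (funext fun s => (mul_one (1 : ℂˣ)).symm)
    rw [this]
    exact hR'

/-! ## The universal elliptic curve and its torsion -/

/-- The isomorphism on fibers induced by a morphism of families. -/
def Family.fiberEquiv {X Y : Family} (g : X ⟶ Y) (s : X.base) :
    Y.Fiber (g.toFun s) ≃+ X.Fiber s :=
  QuotientAddGroup.congr _ _ (unitMul (g.factor s)) (g.map_lattice s)

@[simp] lemma Family.fiberEquiv_mk {X Y : Family} (g : X ⟶ Y) (s : X.base) (z : ℂ) :
    Family.fiberEquiv g s (z : Y.Fiber (g.toFun s)) =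
      ((g.factor s * z : ℂ) : X.Fiber s) := rfl

/-- A section `σ` of `E = (S × ℂ) / Λ → S` is holomorphic at `s` if it lifts, near `s`, to a
holomorphic function with values in `ℂ`. -/
def HolomorphicSectionAt {X : Family} (σ : ∀ s, X.Fiber s) (s : X.base) : Prop :=
  ∃ z : X.base → ℂ, HolomorphicAt z s ∧ ∀ᶠ u in 𝓝 s, σ u = (z u : X.Fiber u)

/-- The group `E(S)` of holomorphic sections of `E → S`. -/
def curveSections (X : Family) : AddSubgroup (∀ s, X.Fiber s) where
  carrier := {σ | ∀ s, HolomorphicSectionAt σ s}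
  zero_mem' s := ⟨fun _ => 0, holomorphicAt_const 0 s, Eventually.of_forall fun _ => rfl⟩
  add_mem' {σ τ} hσ hτ s := by
    obtain ⟨z, hz, h⟩ := hσ s
    obtain ⟨w, hw, h'⟩ := hτ s
    refine ⟨fun u => z u + w u, hz.add hw, ?_⟩
    filter_upwards [h, h'] with u hu hu'
    rw [Pi.add_apply, hu, hu']; rfl
  neg_mem' {σ} hσ s := by
    obtain ⟨z, hz, h⟩ := hσ s
    refine ⟨fun u => -z u, hz.neg, ?_⟩
    filter_upwards [h] with u hu
    rw [Pi.neg_apply, hu]; rfl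

/-- The group `E[N](S)` of `N`-torsion sections of `E → S`. -/
def torsionSections (N : ℕ) (X : Family) : AddSubgroup (∀ s, X.Fiber s) where
  carrier := {σ | σ ∈ curveSections X ∧ N • σ = 0}
  zero_mem' := ⟨zero_mem _, nsmul_zero N⟩
  add_mem' hσ hτ := ⟨add_mem hσ.1 hτ.1, (nsmul_add _ _ N).trans (by rw [hσ.2, hτ.2, add_zero])⟩
  neg_mem' hσ := ⟨neg_mem hσ.1, (neg_nsmul _ N).trans (by rw [hσ.2, neg_zero])⟩

/-- Pullback of (not necessarily holomorphic) sections along a morphism of families. -/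
def pullSection {X Y : Family} (g : X ⟶ Y) : (∀ s, Y.Fiber s) →+ (∀ s, X.Fiber s) where
  toFun σ s := Family.fiberEquiv g s (σ (g.toFun s))
  map_zero' := funext fun _ => map_zero _
  map_add' _ _ := funext fun _ => map_add _ _ _

lemma HolomorphicSectionAt.pull {X Y : Family} (g : X ⟶ Y) {σ : ∀ s, Y.Fiber s} {s : X.base}
    (hσ : HolomorphicSectionAt σ (g.toFun s)) : HolomorphicSectionAt (pullSection g σ) s := by
  obtain ⟨z, hz, h⟩ := hσ
  refine ⟨fun u => g.factor u * z (g.toFun u),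
    (g.holomorphic_factor s).mul (HolomorphicAt.comp_hom g hz), ?_⟩
  filter_upwards [(Family.Hom.continuous g).continuousAt.eventually h] with u hu
  change Family.fiberEquiv g u (σ (g.toFun u)) = _
  rw [hu, Family.fiberEquiv_mk]

lemma pullSection_mem {N : ℕ} {X Y : Family} (g : X ⟶ Y) {σ : ∀ s, Y.Fiber s}
    (hσ : σ ∈ torsionSections N Y) : pullSection g σ ∈ torsionSections N X :=
  ⟨fun s => (hσ.1 (g.toFun s)).pull g, by rw [← map_nsmul, hσ.2, map_zero]⟩

lemma Family.fiberEquiv_id (X : Family) (s : X.base) (x : X.Fiber s) :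
    Family.fiberEquiv (𝟙 X) s x = x := by
  obtain ⟨z, rfl⟩ := QuotientAddGroup.mk_surjective x
  exact congrArg _ (one_mul z)

lemma Family.fiberEquiv_comp {X Y Z : Family} (g : X ⟶ Y) (h : Y ⟶ Z) (s : X.base)
    (x : Z.Fiber (h.toFun (g.toFun s))) :
    Family.fiberEquiv (g ≫ h) s x =
      Family.fiberEquiv g s (Family.fiberEquiv h (g.toFun s) x) := by
  obtain ⟨z, rfl⟩ := QuotientAddGroup.mk_surjective x
  exact congrArg _ (mul_assoc _ _ z)

lemma pullSection_id (X : Family) (σ : ∀ s, X.Fiber s) : pullSection (𝟙 X) σ = σ :=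
  funext fun s => Family.fiberEquiv_id X s (σ s)

lemma pullSection_comp {X Y Z : Family} (g : X ⟶ Y) (h : Y ⟶ Z) (σ : ∀ s, Z.Fiber s) :
    pullSection (g ≫ h) σ = pullSection g (pullSection h σ) :=
  funext fun s => Family.fiberEquiv_comp g h s (σ _)

lemma pullSection_incl (X : Family) (U : Opens (Fin X.dim → ℂ)) (h : U ≤ X.base)
    (σ : ∀ s, X.Fiber s) (u : U) : pullSection (X.incl U h) σ u = σ ⟨u, h u.2⟩ := by
  obtain ⟨z, hz⟩ := QuotientAddGroup.mk_surjective (σ ⟨u, h u.2⟩)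
  change Family.fiberEquiv (X.incl U h) u (σ ((X.incl U h).toFun u)) = _
  change _ = σ ((X.incl U h).toFun u) at hz
  rw [← hz]
  exact (congrArg _ (one_mul z)).trans hz

/-- The presheaf `E / S ↦ E[N](S)`. -/
def torsionPresheaf (N : ℕ) : Familyᵒᵖ ⥤ AddCommGrpCat.{0} where
  obj X := AddCommGrpCat.of (torsionSections N X.unop)
  map g := AddCommGrpCat.ofHom
    (((pullSection g.unop).comp (torsionSections N _).subtype).codRestrict _
      fun σ => pullSection_mem g.unop σ.2)
  map_id X := by
    ext σ : 2
    exact Subtype.ext (pullSection_id X.unop σ.1)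
  map_comp g h := by
    ext σ : 2
    exact Subtype.ext (pullSection_comp h.unop g.unop σ.1)

lemma HolomorphicSectionAt.of_restrict {X : Family} {U : Opens (Fin X.dim → ℂ)}
    (h : U ≤ X.base) {σ : ∀ s, X.Fiber s} {s : U}
    (hσ : HolomorphicSectionAt (X := X.restrict U h) (fun u : U => σ ⟨u, h u.2⟩) s) :
    HolomorphicSectionAt σ ⟨s, h s.2⟩ := by
  obtain ⟨z, ⟨(F : (Fin X.dim → ℂ) → ℂ), hF, hz⟩, hσ⟩ := hσ
  refine ⟨fun u => F u, ⟨F, hF, Eventually.of_forall fun _ => rfl⟩, ?_⟩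
  apply eventually_of_restrict h s (p := fun u : X.base => σ u = (F u : X.Fiber u))
  filter_upwards [hz, hσ] with u hu hu'
  exact hu'.trans (congrArg _ hu)

theorem torsionPresheaf_isSheaf (N : ℕ) :
    Presheaf.IsSheaf moduliTopology (torsionPresheaf N) := by
  rw [Presheaf.isSheaf_iff_isSheaf_forget _ _ (forget AddCommGrpCat.{0}),
    isSheaf_iff_isSheaf_of_type]
  intro X R hR x hx
  choose U hU hsU hRU using hR
  have hx' : ∀ ⦃Y : Family⦄ (g : Y ⟶ X) (hg : R g) (y : Y.base),
      (x g hg).1 y = Family.fiberEquiv g y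
        ((x _ (hRU (g.toFun y))).1 (⟨g.toFun y, hsU _⟩ : U (g.toFun y))) := by
    intro Y g hg y
    have h1 := congrArg Subtype.val
      (hx (Y.incl (Family.preimage g (U (g.toFun y))) (Family.preimage_le g _))
        (Family.restrictHom g (U (g.toFun y)) (hU _)) hg (hRU (g.toFun y))
        (Family.restrictHom_comp_incl g _ _).symm)
    change pullSection (Y.incl _ (Family.preimage_le g _)) (x g hg).1 =
      pullSection (Family.restrictHom g _ (hU _)) (x _ (hRU (g.toFun y))).1 at h1
    rw [← pullSection_incl Y _ (Family.preimage_le g (U (g.toFun y))) (x g hg).1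
      (⟨y.1, y.2, hsU (g.toFun y)⟩ : Family.preimage g (U (g.toFun y))), h1]
    rfl
  let σ : ∀ s, X.Fiber s := fun s => (x _ (hRU s)).1 (⟨s, hsU s⟩ : U s)
  have key : ∀ ⦃Y : Family⦄ (g : Y ⟶ X) (hg : R g), pullSection g σ = (x g hg).1 :=
    fun Y g hg => funext fun y => (hx' g hg y).symm
  have hσ : σ ∈ torsionSections N X := by
    refine ⟨fun s => ?_, funext fun s => ?_⟩
    · have h1 := (x _ (hRU s)).2.1 (⟨s, hsU s⟩ : U s)
      rw [← key] at h1
      refine HolomorphicSectionAt.of_restrict (hU s) (s := (⟨s, hsU s⟩ : U s)) ?_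
      have e : (fun u : U s => σ ⟨u, hU s u.2⟩) = pullSection (X.incl (U s) (hU s)) σ :=
        funext fun u => (pullSection_incl X _ (hU s) σ u).symm
      exact (congrArg (fun τ => HolomorphicSectionAt (X := X.restrict (U s) (hU s)) τ
        (⟨s, hsU s⟩ : U s)) e).mpr h1
    · exact congrFun (x _ (hRU s)).2.2 (⟨s, hsU s⟩ : U s)
  refine ⟨⟨σ, hσ⟩, fun Y g hg => Subtype.ext (key g hg), fun τ hτ => Subtype.ext ?_⟩
  funext s
  have := congrFun (congrArg Subtype.val (hτ _ (hRU s))) (⟨s, hsU s⟩ : U s)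
  exact (pullSection_incl X _ (hU s) τ.1 (⟨s, hsU s⟩ : U s)).symm.trans this

/-- The sheaf `𝓔[N]` of `N`-torsion points of the universal elliptic curve. -/
def torsionSheaf (N : ℕ) : Sheaf moduliTopology AddCommGrpCat.{0} :=
  ⟨torsionPresheaf N, torsionPresheaf_isSheaf N⟩
/-! ## Torsors and their classes in sheaf cohomology -/

section Torsors

variable {C : Type} [SmallCategory C] {J : GrothendieckTopology C}

/-- A presheaf of sets with an action of a presheaf `A` of abelian groups. -/
structure PresheafWithAction (A : Cᵒᵖ ⥤ AddCommGrpCat.{0}) where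
  carrier : Cᵒᵖ ⥤ Type
  act : ∀ X, A.obj X → carrier.obj X → carrier.obj X
  zero_act : ∀ X t, act X 0 t = t
  add_act : ∀ X a b t, act X (a + b) t = act X a (act X b t)
  map_act : ∀ {X Y} (f : X ⟶ Y) a t,
    carrier.map f (act X a t) = act Y (A.map f a) (carrier.map f t)

/-- `T` is an `A`-torsor: a sheaf with a simply transitive action of `A` that locally has
sections. -/
structure PresheafWithAction.IsTorsor {A : Sheaf J AddCommGrpCat.{0}}
    (T : PresheafWithAction A.obj) : Prop where
  isSheaf : Presheaf.IsSheaf J T.carrier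
  existsUnique_act : ∀ X (t t' : T.carrier.obj X), ∃! a : A.obj.obj X, T.act X a t = t'
  locally_nonempty : ∀ X : C, ∃ R ∈ J X, ∀ ⦃Y : C⦄ (f : Y ⟶ X), R f →
    Nonempty (T.carrier.obj (op Y))

variable (J) in
/-- The constant sheaf `ℤ`; by definition `H^n(A)` is `Ext^n(ℤ, A)`. -/
noncomputable abbrev integerSheaf : Sheaf J AddCommGrpCat.{0} :=
  (constantSheaf J AddCommGrpCat.{0}).obj (AddCommGrpCat.of (ULift.{0} ℤ))

variable (J) in
/-- The section `1` of the constant sheaf `ℤ`. -/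
noncomputable def oneSection (X : Cᵒᵖ) : (integerSheaf J).obj.obj X :=
  (toSheafify J ((Functor.const Cᵒᵖ).obj (AddCommGrpCat.of (ULift.{0} ℤ)))).app X
    (ULift.up (1 : ℤ))

/-- `c ∈ H¹(A)` is the class of the `A`-torsor `T`: it is the class of an extension
`0 → A → B → ℤ → 0` (that is, the image of `1` under the connecting homomorphism
`H⁰(ℤ) → H¹(A)`) such that `T` is isomorphic, as a sheaf with `A`-action, to the fiber of
`B → ℤ` over `1`. -/
def PresheafWithAction.HasClass {A : Sheaf J AddCommGrpCat.{0}}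
    (T : PresheafWithAction A.obj) (c : A.H 1) : Prop :=
  ∃ (B : Sheaf J AddCommGrpCat.{0}) (i : A ⟶ B) (p : B ⟶ integerSheaf J) (w : i ≫ p = 0)
    (h : (ShortComplex.mk i p w).ShortExact) (θ : T.carrier ⟶ B.obj ⋙ forget AddCommGrpCat.{0}),
    h.extClass = c ∧
    (∀ X (a : A.obj.obj X) (t : T.carrier.obj X),
      (θ.app X (T.act X a t) : B.obj.obj X) = i.hom.app X a + (θ.app X t : B.obj.obj X)) ∧
    ∀ X, Set.BijOn (θ.app X) Set.univ {b : B.obj.obj X | p.hom.app X b = oneSection J X}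

end Torsors

/-! ## Partitions of the doubling map -/

section Partitions

variable {A B D : Type} [AddCommGroup A] [AddCommGroup B] [AddCommGroup D]

/-- The elements of exact order `n`. -/
abbrev ExactOrder (A : Type) [AddCommGroup A] (n : ℕ) : Type := {x : A // addOrderOf x = n}

/-- Isomorphisms preserve exact orders. -/
def ExactOrder.map (e : A ≃+ B) {n : ℕ} (x : ExactOrder A n) : ExactOrder B n :=
  ⟨e x, (addOrderOf_injective (e : A →+ B) e.injective x.1).trans x.2⟩

lemma addOrderOf_eq_four_iff {x : A} : addOrderOf x = 4 ↔ 4 • x = 0 ∧ 2 • x ≠ 0 := by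
  constructor
  · intro h
    refine ⟨h ▸ addOrderOf_nsmul_eq_zero x, fun h2 => ?_⟩
    have := addOrderOf_dvd_of_nsmul_eq_zero h2
    rw [h] at this
    exact absurd this (by decide)
  · rintro ⟨h4, h2⟩
    exact addOrderOf_eq_prime_pow (p := 2) (n := 1) (by simpa using h2) (by simpa using h4)

/-- The relation `x ∼ ±x` on elements of exact order four. -/
def signSetoid (A : Type) [AddCommGroup A] : Setoid (ExactOrder A 4) where
  r x y := (x : A) = y ∨ (x : A) = -y
  iseqv :=
    { refl := fun _ => Or.inl rfl
      symm := by
        rintro x y (h | h)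
        · exact Or.inl h.symm
        · exact Or.inr (by rw [h, neg_neg])
      trans := by
        rintro x y z (h | h) (h' | h')
        · exact Or.inl (h.trans h')
        · exact Or.inr (h.trans h')
        · exact Or.inr (by rw [h, h'])
        · exact Or.inl (by rw [h, h', neg_neg]) }

/-- The set `M* / ⟨-1⟩`, for `M = A[4]`. -/
def SignClass (A : Type) [AddCommGroup A] : Type := Quotient (signSetoid A)

/-- The class of an element of exact order four in `M* / ⟨-1⟩`. -/
def SignClass.mk (x : ExactOrder A 4) : SignClass A := Quotient.mk (signSetoid A) x

/-- The doubling map `φ : M* / ⟨-1⟩ → M[2]*`. -/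
def doubling : SignClass A → ExactOrder A 2 :=
  Quotient.lift
    (fun x : ExactOrder A 4 => (⟨2 • x.1, by
      have h := addOrderOf_eq_four_iff.1 x.2
      refine addOrderOf_eq_prime ?_ h.2
      rw [smul_smul]; exact h.1⟩ : ExactOrder A 2))
    (by
      rintro x y (h | h)
      · exact Subtype.ext (by simp only [h])
      · apply Subtype.ext
        have h4 := (addOrderOf_eq_four_iff.1 y.2).1
        simp only [h, smul_neg]
        rw [neg_eq_iff_add_eq_zero, ← add_smul]
        exact h4)

/-- `t = {P, Q}` is an unordered partition of `φ : M* / ⟨-1⟩ → M[2]*` into two covers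
`P → M[2]*` and `Q → M[2]*` of degree one. -/
def IsDoublingPartition (t : Set (Set (SignClass A))) : Prop :=
  ∃ P Q : Set (SignClass A), t = {P, Q} ∧ Disjoint P Q ∧ P ∪ Q = Set.univ ∧
    Set.BijOn doubling P Set.univ ∧ Set.BijOn doubling Q Set.univ

/-- The set of partitions of the doubling map. -/
def DoublingPartition (A : Type) [AddCommGroup A] : Type :=
  {t : Set (Set (SignClass A)) // IsDoublingPartition t}

lemma IsDoublingPartition.image {f : SignClass A → SignClass B} (hf : Function.Bijective f)
    {g : ExactOrder A 2 → ExactOrder B 2} (hg : Function.Bijective g)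
    (hfg : ∀ x, doubling (f x) = g (doubling x)) {t : Set (Set (SignClass A))}
    (ht : IsDoublingPartition t) : IsDoublingPartition ((f '' ·) '' t) := by
  have key : ∀ P : Set (SignClass A), Set.BijOn doubling P Set.univ →
      Set.BijOn doubling (f '' P) Set.univ := by
    intro P hP
    refine ⟨fun _ _ => trivial, ?_, ?_⟩
    · rintro _ ⟨x, hx, rfl⟩ _ ⟨y, hy, rfl⟩ h
      rw [hfg, hfg] at h
      rw [hP.injOn hx hy (hg.1 h)]
    · intro b _
      obtain ⟨a, rfl⟩ := hg.2 b
      obtain ⟨x, hx, rfl⟩ := hP.surjOn (Set.mem_univ a)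
      exact ⟨f x, ⟨x, hx, rfl⟩, hfg x⟩
  obtain ⟨P, Q, rfl, hd, hu, hP, hQ⟩ := ht
  refine ⟨f '' P, f '' Q, Set.image_pair _ _ _, (Set.disjoint_image_iff hf.1).2 hd, ?_,
    key P hP, key Q hQ⟩
  rw [← Set.image_union, hu, Set.image_univ, hf.2.range_eq]

/-- Functoriality of `M* / ⟨-1⟩`. -/
def SignClass.map (e : A ≃+ B) : SignClass A → SignClass B :=
  Quotient.lift (fun x => SignClass.mk (ExactOrder.map e x)) (by
    rintro x y (h | h)
    · exact Quotient.sound (Or.inl (congrArg e h))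
    · exact Quotient.sound (Or.inr ((congrArg e h).trans (map_neg e _))))

lemma SignClass.map_id (x : SignClass A) : SignClass.map (AddEquiv.refl A) x = x := by
  induction x using Quotient.ind; rfl

lemma SignClass.map_map (e : A ≃+ B) (e' : B ≃+ D) (x : SignClass A) :
    SignClass.map e' (SignClass.map e x) = SignClass.map (e.trans e') x := by
  induction x using Quotient.ind; rfl

lemma SignClass.map_bijective (e : A ≃+ B) : Function.Bijective (SignClass.map e) :=
  Function.bijective_iff_has_inverse.2 ⟨SignClass.map e.symm,
    fun x => by rw [SignClass.map_map, AddEquiv.self_trans_symm, SignClass.map_id],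
    fun x => by rw [SignClass.map_map, AddEquiv.symm_trans_self, SignClass.map_id]⟩

lemma ExactOrder.map_bijective (e : A ≃+ B) {n : ℕ} :
    Function.Bijective (ExactOrder.map e : ExactOrder A n → ExactOrder B n) :=
  Function.bijective_iff_has_inverse.2 ⟨ExactOrder.map e.symm,
    fun x => Subtype.ext (e.symm_apply_apply x.1), fun x => Subtype.ext (e.apply_symm_apply x.1)⟩

/-- Functoriality of the set of partitions of the doubling map. -/
def DoublingPartition.map (e : A ≃+ B) (t : DoublingPartition A) : DoublingPartition B :=
  ⟨(SignClass.map e '' ·) '' t.1,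
    t.2.image (SignClass.map_bijective e) (ExactOrder.map_bijective e) (by
      intro x
      induction x using Quotient.ind
      exact Subtype.ext (map_nsmul e _ _).symm)⟩

/-- Translation by a two-torsion element `a`, on elements of exact order four. -/
def ExactOrder.translate (a : A) (ha : 2 • a = 0) (x : ExactOrder A 4) : ExactOrder A 4 :=
  ⟨a + x, by
    have h := addOrderOf_eq_four_iff.1 x.2
    have ha4 : 4 • a = 0 := by
      rw [show 4 = 2 * 2 from rfl, mul_smul, ha, smul_zero]
    refine addOrderOf_eq_four_iff.2 ⟨?_, ?_⟩
    · rw [smul_add, ha4, h.1, add_zero]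
    · rw [smul_add, ha, zero_add]
      exact h.2⟩

/-- Translation by a two-torsion element `a`, on `M* / ⟨-1⟩`. -/
def SignClass.translate (a : A) (ha : 2 • a = 0) : SignClass A → SignClass A :=
  Quotient.lift (fun x => SignClass.mk (ExactOrder.translate a ha x)) (by
    rintro x y (h | h)
    · exact Quotient.sound (Or.inl (congrArg (a + ·) h))
    · refine Quotient.sound (Or.inr ?_)
      have : a = -a := by rw [eq_neg_iff_add_eq_zero, ← two_nsmul, ha]
      change a + (x : A) = -(a + y)
      rw [h, neg_add, ← this])

lemma SignClass.translate_translate (a b : A) (ha : 2 • a = 0) (hb : 2 • b = 0)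
    (hab : 2 • (a + b) = 0) (x : SignClass A) :
    SignClass.translate a ha (SignClass.translate b hb x) = SignClass.translate (a + b) hab x := by
  induction x using Quotient.ind
  exact congrArg SignClass.mk (Subtype.ext (add_assoc _ _ _).symm)

lemma SignClass.translate_zero (h : 2 • (0 : A) = 0) (x : SignClass A) :
    SignClass.translate 0 h x = x := by
  induction x using Quotient.ind
  exact congrArg SignClass.mk (Subtype.ext (zero_add _))

lemma SignClass.translate_bijective (a : A) (ha : 2 • a = 0) :
    Function.Bijective (SignClass.translate a ha) := by
  have h0 : a + a = 0 := by rw [← two_nsmul, ha]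
  have inv : ∀ x, SignClass.translate a ha (SignClass.translate a ha x) = x := by
    intro x
    induction x using Quotient.ind
    exact congrArg SignClass.mk (Subtype.ext (by
      change a + (a + _) = _
      rw [← add_assoc, h0, zero_add]))
  exact Function.bijective_iff_has_inverse.2 ⟨_, inv, inv⟩

/-- The action of `M[2]` on the set of partitions of the doubling map. -/
def DoublingPartition.translate (a : A) (ha : 2 • a = 0) (t : DoublingPartition A) :
    DoublingPartition A :=
  ⟨(SignClass.translate a ha '' ·) '' t.1,
    t.2.image (SignClass.translate_bijective a ha) Function.bijective_id (by
      intro x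
      induction x using Quotient.ind
      apply Subtype.ext
      change 2 • (a + _) = 2 • _
      rw [smul_add, ha, zero_add])⟩

end Partitions

/-! ## The canonical torsor -/

/-- A family `t u` of partitions of the doubling maps of the curves `E_u` is locally constant at
`s` if, near `s`, one of its two parts is given by the classes of holomorphic sections of `E`
of exact order four. -/
def LocallyConstantAt {X : Family} (t : ∀ u, DoublingPartition (X.Fiber u)) (s : X.base) : Prop :=
  ∃ p : Fin 3 → ∀ u, ExactOrder (X.Fiber u) 4,
    (∀ i, HolomorphicSectionAt (fun u => (p i u : X.Fiber u)) s) ∧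
      ∀ᶠ u in 𝓝 s, Set.range (fun i => SignClass.mk (p i u)) ∈ (t u).1

/-- The sections over `S` of the torsor `T(E / S)`. -/
def TorsorSections (X : Family) : Type :=
  {t : ∀ s, DoublingPartition (X.Fiber s) // ∀ s, LocallyConstantAt t s}

lemma TorsorSections.ext {X : Family} {t t' : TorsorSections X}
    (h : ∀ s, (t.1 s).1 = (t'.1 s).1) : t = t' :=
  Subtype.ext (funext fun s => Subtype.ext (h s))

/-- Pullback of sections of the torsor. -/
def TorsorSections.pull {X Y : Family} (g : X ⟶ Y) (t : TorsorSections Y) : TorsorSections X :=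
  ⟨fun s => (t.1 (g.toFun s)).map (Family.fiberEquiv g s), fun s => by
    obtain ⟨p, hp, h⟩ := t.2 (g.toFun s)
    refine ⟨fun i u => ExactOrder.map (Family.fiberEquiv g u) (p i (g.toFun u)),
      fun i => (hp i).pull g, ?_⟩
    filter_upwards [(Family.Hom.continuous g).continuousAt.eventually h] with u hu
    refine ⟨_, hu, ?_⟩
    exact (Set.range_comp _ _).symm⟩

lemma torsion_apply {N : ℕ} {X : Family} (σ : torsionSections N X) (s : X.base) :
    N • σ.1 s = 0 := congrFun σ.2.2 s

/-- The action of `E[2](S)` on the sections of the torsor. -/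
def TorsorSections.act {X : Family} (σ : torsionSections 2 X) (t : TorsorSections X) :
    TorsorSections X :=
  ⟨fun s => (t.1 s).translate (σ.1 s) (torsion_apply σ s), fun s => by
    obtain ⟨p, hp, h⟩ := t.2 s
    refine ⟨fun i u => ExactOrder.translate (σ.1 u) (torsion_apply σ u) (p i u), fun i => ?_, ?_⟩
    · obtain ⟨z, hz, h1⟩ := σ.2.1 s
      obtain ⟨w, hw, h2⟩ := hp i
      refine ⟨fun u => z u + w u, hz.add hw, ?_⟩
      filter_upwards [h1, h2] with u hu hu'
      exact congrArg₂ (· + ·) hu hu'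
    · filter_upwards [h] with u hu
      exact ⟨_, hu, (Set.range_comp _ _).symm⟩⟩

lemma image_image_eq {α β γ : Type} {f : α → β} {g : β → γ} {h : α → γ}
    (H : ∀ x, g (f x) = h x) (t : Set (Set α)) :
    (g '' ·) '' ((f '' ·) '' t) = (h '' ·) '' t := by
  simp only [Set.image_image, H]

lemma image_image_eq_self {α : Type} {f : α → α} (H : ∀ x, f x = x) (t : Set (Set α)) :
    (f '' ·) '' t = t := by
  simp only [H, Set.image_id']

/-- The canonical `𝓔[2]`-torsor `T`: over `E / S` its sections are the locally constant families
of partitions of the doubling maps `E_s[4]* / ⟨-1⟩ → E_s[2]*` into two covers of degree one, and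
`E[2]` acts by translation. -/
def canonicalTorsor : PresheafWithAction (torsionSheaf 2).obj where
  carrier :=
    { obj := fun X => TorsorSections X.unop
      map := fun g => ↾(TorsorSections.pull g.unop)
      map_id := fun X => by
        refine ConcreteCategory.hom_ext _ _ fun (t : TorsorSections _) => ?_
        refine TorsorSections.ext fun s => image_image_eq_self (fun x => ?_) (t.1 s).1
        induction x using Quotient.ind with | _ x => ?_
        exact congrArg SignClass.mk (Subtype.ext (Family.fiberEquiv_id X.unop s x.1))
      map_comp := fun g h => by
        refine ConcreteCategory.hom_ext _ _ fun (t : TorsorSections _) => ?_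
        refine TorsorSections.ext fun s => (image_image_eq (fun x => ?_) (t.1 _).1).symm
        induction x using Quotient.ind with | _ x => ?_
        exact congrArg SignClass.mk
          (Subtype.ext (Family.fiberEquiv_comp h.unop g.unop s x.1).symm) }
  act _ σ t := TorsorSections.act σ t
  zero_act X t := TorsorSections.ext fun s =>
    image_image_eq_self (SignClass.translate_zero _) _
  add_act X σ τ t := TorsorSections.ext fun s =>
    (image_image_eq (SignClass.translate_translate _ _ _ _ _) _).symm
  map_act {X Y} g σ t := by
    refine TorsorSections.ext fun s => ?_
    refine (image_image_eq (h := fun x => SignClass.map (Family.fiberEquiv g.unop s)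
      (SignClass.translate _ (torsion_apply σ _) x)) (fun x => rfl) _).trans
      (image_image_eq (fun x => ?_) _).symm
    induction x using Quotient.ind with | _ x => ?_
    exact congrArg SignClass.mk (Subtype.ext (map_add _ _ _).symm)

end EllipticModuli

namespace EllipticModuli

/-! ## Sections of sheaves on a site -/

section Site

variable {C : Type} [SmallCategory C] {J : GrothendieckTopology C}

/-! The family ℂ / (ℤ + ℤτ) over the upper half-plane presents the stack as a quotient by SL₂(ℤ):
every family is locally a pullback of it (`exists_local_hom_upper`), and two maps to it differ
locally by an element of SL₂(ℤ) (`upper_hom_locally_modular`). The upper half-plane is simply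
connected and 𝓔[2] is constant on it with fiber (ℤ/2)², so every 𝓔[2]-torsor has a section there
(`exists_upper_section`). Moving this section by SL₂(ℤ) yields a cocycle, and the cocycle determines
the torsor (`exists_equivariant_of_cocycle_eq`).

The cocycle is found from S and R = ST, which generate SL₂(ℤ) and satisfy S² = R³. Since 1 - R is
invertible on half-periods, the section can be chosen R-invariant. If S then translates it by v, the
relation gives Sv + v = 0, so v is 0 or (1, 1) (`exists_normal_section`). Hence there are at most
two torsors up to isomorphism, and v = 0 gives the trivial one.

The torsor T of partitions is not trivial (`canonicalTorsor_no_section`). Indeed τ ↦ τ + 1 fixes 1/4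
and moves τ/4 to (1 + τ)/4 and then to (2 + τ)/4; an invariant partition would put all or none of
these into the part of 1/4, but τ/4 and τ/4 + 1/2 have the same double and lie in different parts.
So every torsor without a global section is isomorphic to T.

That T is a torsor rests on a count (`DoublingPartition.exists_translate`): translation by a ≠ 0 in
E[2] fixes the two classes over a and exchanges the two classes over each other point of order two.
The eight ways in which one half can agree or disagree with another over three points become four
when parts are unordered, one for each element of E[2].

For the passage to cohomology, a class in H¹(A) is an extension of ℤ by A, and its torsor is the
fiber over 1. Every class arises in this way (`exists_extension`), a global section of the torsor
splits the extension (`extClass_eq_zero_of_section`), and every torsor has exactly one class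
(`exists_hasClass`, `hasClass_unique`). So T has a class, it is nonzero, and it equals every other
nonzero class. -/

lemma sheaf_separated {F : Cᵒᵖ ⥤ Type} (hF : Presheaf.IsSheaf J F) {X : C} {R : Sieve X}
    (hR : R ∈ J X) {a b : F.obj (op X)}
    (h : ∀ ⦃Y : C⦄ (f : Y ⟶ X), R f → F.map f.op a = F.map f.op b) : a = b :=
  ((isSheaf_iff_isSheaf_of_type _ _).1 hF R hR).isSeparatedFor.ext h

lemma sheaf_glue {F : Cᵒᵖ ⥤ Type} (hF : Presheaf.IsSheaf J F) {X : C} {R : Sieve X}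
    (hR : R ∈ J X) (x : ∀ ⦃Y : C⦄ (f : Y ⟶ X), R f → F.obj (op Y))
    (hx : ∀ ⦃Y Z : C⦄ (f : Y ⟶ X) (hf : R f) (g : Z ⟶ Y),
      F.map g.op (x f hf) = x (g ≫ f) (R.downward_closed hf g)) :
    ∃ a : F.obj (op X), ∀ ⦃Y : C⦄ (f : Y ⟶ X) (hf : R f), F.map f.op a = x f hf := by
  have hc : Presieve.FamilyOfElements.Compatible (P := F) (R := R.arrows) x :=
    Presieve.compatible_iff_sieveCompatible x |>.2 fun _ _ f g hf => (hx f hf g).symm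
  obtain ⟨a, ha, -⟩ := (isSheaf_iff_isSheaf_of_type _ _).1 hF R hR x hc
  exact ⟨a, ha⟩

lemma isSheaf_forget (A : Sheaf J AddCommGrpCat.{0}) :
    Presheaf.IsSheaf J (A.obj ⋙ forget AddCommGrpCat.{0}) :=
  (Presheaf.isSheaf_iff_isSheaf_forget _ _ (forget AddCommGrpCat.{0})).1 A.property

lemma group_separated (A : Sheaf J AddCommGrpCat.{0}) {X : C} {R : Sieve X}
    (hR : R ∈ J X) {a b : A.obj.obj (op X)}
    (h : ∀ ⦃Y : C⦄ (f : Y ⟶ X), R f → A.obj.map f.op a = A.obj.map f.op b) : a = b :=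
  sheaf_separated (isSheaf_forget A) hR h

lemma group_glue (A : Sheaf J AddCommGrpCat.{0}) {X : C} {R : Sieve X}
    (hR : R ∈ J X) (x : ∀ ⦃Y : C⦄ (f : Y ⟶ X), R f → A.obj.obj (op Y))
    (hx : ∀ ⦃Y Z : C⦄ (f : Y ⟶ X) (hf : R f) (g : Z ⟶ Y),
      A.obj.map g.op (x f hf) = x (g ≫ f) (R.downward_closed hf g)) :
    ∃ a : A.obj.obj (op X), ∀ ⦃Y : C⦄ (f : Y ⟶ X) (hf : R f), A.obj.map f.op a = x f hf :=
  sheaf_glue (isSheaf_forget A) hR x hx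

@[simp] lemma presheaf_map_id {A : Cᵒᵖ ⥤ AddCommGrpCat.{0}} {X : Cᵒᵖ} (a : A.obj X) :
    A.map (𝟙 X) a = a := by simp

lemma presheaf_map_comp {A : Cᵒᵖ ⥤ AddCommGrpCat.{0}} {X Y Z : C} (f : Y ⟶ X) (g : Z ⟶ Y)
    (a : A.obj (op X)) : A.map (g ≫ f).op a = A.map g.op (A.map f.op a) := by simp

lemma types_map_comp {F : Cᵒᵖ ⥤ Type} {X Y Z : C} (f : Y ⟶ X) (g : Z ⟶ Y)
    (a : F.obj (op X)) : F.map (g ≫ f).op a = F.map g.op (F.map f.op a) := by simp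

lemma types_map_id {F : Cᵒᵖ ⥤ Type} {X : C} (a : F.obj (op X)) : F.map (𝟙 X).op a = a := by simp

lemma hom_naturality {A B : Sheaf J AddCommGrpCat.{0}} (f : A ⟶ B) {X Y : C} (g : Y ⟶ X)
    (a : A.obj.obj (op X)) :
    f.hom.app (op Y) (A.obj.map g.op a) = B.obj.map g.op (f.hom.app (op X) a) :=
  NatTrans.naturality_apply f.hom g.op a

lemma hom_comp_app {A B D : Sheaf J AddCommGrpCat.{0}} (f : A ⟶ B) (g : B ⟶ D) (X : Cᵒᵖ)
    (a : A.obj.obj X) : (f ≫ g).hom.app X a = g.hom.app X (f.hom.app X a) := rfl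

/-! ### Homomorphisms from the constant sheaf `ℤ` -/

lemma map_oneSection {X Y : C} (f : Y ⟶ X) :
    (integerSheaf J).obj.map f.op (oneSection J (op X)) = oneSection J (op Y) :=
  (NatTrans.naturality_apply (toSheafify J ((Functor.const Cᵒᵖ).obj
    (AddCommGrpCat.of (ULift.{0} ℤ)))) f.op (ULift.up (1 : ℤ))).symm

/-- By the universal property of sheafification it suffices to compare the maps on the constant
presheaf ℤ, and there they are determined by the image of 1. -/
lemma integerSheaf_hom_ext {B : Sheaf J AddCommGrpCat.{0}} {f g : integerSheaf J ⟶ B}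
    (h : ∀ X : C, f.hom.app (op X) (oneSection J (op X)) =
      g.hom.app (op X) (oneSection J (op X))) : f = g := by
  apply Sheaf.hom_ext
  refine sheafify_hom_ext J (P := (Functor.const Cᵒᵖ).obj (AddCommGrpCat.of (ULift.{0} ℤ)))
    f.hom g.hom B.property ?_
  ext X n
  obtain ⟨X⟩ := X
  obtain ⟨n⟩ := n
  have hn : (ULift.up n : ULift.{0} ℤ) = n • ULift.up (1 : ℤ) := by
    ext; simp
  rw [hn, map_zsmul, map_zsmul]
  exact congrArg (n • ·) (h X)

/-- The assignment n ↦ n b is a map on the constant presheaf and extends to the sheafification. With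
`integerSheaf_hom_ext`, this identifies Hom(ℤ, B) with the global sections of `B`. -/
lemma exists_integerSheaf_hom {B : Sheaf J AddCommGrpCat.{0}} (b : ∀ X : C, B.obj.obj (op X))
    (hb : ∀ ⦃X Y : C⦄ (f : Y ⟶ X), B.obj.map f.op (b X) = b Y) :
    ∃ s : integerSheaf J ⟶ B, ∀ X : C, s.hom.app (op X) (oneSection J (op X)) = b X := by
  let η : (Functor.const Cᵒᵖ).obj (AddCommGrpCat.of (ULift.{0} ℤ)) ⟶ B.obj :=
    { app := fun X => AddCommGrpCat.ofHom
        ((zmultiplesHom _ (b X.unop)).comp (AddEquiv.ulift (α := ℤ)).toAddMonoidHom)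
      naturality := fun X Y f => by
        ext n
        change n.down • b Y.unop = B.obj.map f (n.down • b X.unop)
        rw [map_zsmul]
        exact congrArg _ (hb f.unop).symm }
  refine ⟨⟨sheafifyLift J η B.property⟩, fun X => ?_⟩
  have := congrArg (fun φ => φ.app (op X) (ULift.up (1 : ℤ)))
    (toSheafify_sheafifyLift J η B.property)
  refine Eq.trans this ?_
  change (1 : ℤ) • b X = b X
  simp

/-! ### Short exact sequences of sheaves -/

lemma shortExact_injective {S : ShortComplex (Sheaf J AddCommGrpCat.{0})} (hS : S.ShortExact)
    (X : Cᵒᵖ) : Function.Injective (S.f.hom.app X) := by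
  have := hS.mono_f
  have : Mono ((sheafToPresheaf J AddCommGrpCat.{0} ⋙ (evaluation _ _).obj X).map S.f) :=
    inferInstance
  exact (AddCommGrpCat.mono_iff_injective _).1 this

/-- Kernels of sheaves are computed on sections, so evaluation at an object is left exact.
Surjectivity survives only locally, as in `epi_locally_surjective`. -/
lemma shortExact_exact {S : ShortComplex (Sheaf J AddCommGrpCat.{0})} (hS : S.ShortExact)
    {X : Cᵒᵖ} {b : S.X₂.obj.obj X} (hb : S.g.hom.app X b = 0) :
    ∃ a, S.f.hom.app X a = b := by
  have := hS.mono_f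
  let F := sheafToPresheaf J AddCommGrpCat.{0} ⋙ (evaluation _ _).obj X
  have h : (S.map F).Exact := hS.exact.map_of_mono_of_preservesKernel F inferInstance inferInstance
  exact (ShortComplex.ab_exact_iff _).1 h b hb

lemma epi_locally_surjective {A B : Sheaf J AddCommGrpCat.{0}} (p : A ⟶ B) [Epi p] {X : C}
    (b : B.obj.obj (op X)) : ∃ R ∈ J X, ∀ ⦃Y : C⦄ (f : Y ⟶ X), R f →
      ∃ a, p.hom.app (op Y) a = B.obj.map f.op b := by
  have : Sheaf.IsLocallySurjective p := (Sheaf.isLocallySurjective_iff_epi' _ p).2 inferInstance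
  exact ⟨_, Presheaf.imageSieve_mem J p.hom (U := op X) b, fun Y f hf => hf⟩

/-- Base change of an epimorphism in an abelian category is an epimorphism with the same kernel.
This is how a map to the quotient is turned into an extension of its source. -/
lemma exists_pullback_shortExact {S : ShortComplex (Sheaf J AddCommGrpCat.{0})}
    (hS : S.ShortExact) {Z : Sheaf J AddCommGrpCat.{0}} (q : Z ⟶ S.X₃) :
    ∃ (B : Sheaf J AddCommGrpCat.{0}) (i : S.X₁ ⟶ B) (p : B ⟶ Z) (r : B ⟶ S.X₂)
      (w : i ≫ p = 0), (ShortComplex.mk i p w).ShortExact ∧ i ≫ r = S.f ∧ IsPullback r p S.g q := by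
  have h := IsPullback.of_hasPullback S.g q
  have := hS.mono_f
  have := hS.epi_g
  let i : S.X₁ ⟶ Limits.pullback S.g q := Limits.pullback.lift S.f 0 (by simp)
  have hi1 : i ≫ Limits.pullback.fst S.g q = S.f := Limits.pullback.lift_fst _ _ _
  have hi2 : i ≫ Limits.pullback.snd S.g q = 0 := Limits.pullback.lift_snd _ _ _
  refine ⟨_, i, Limits.pullback.snd S.g q, Limits.pullback.fst S.g q, hi2, ?_, hi1, h⟩
  have : Mono i := by
    have : Mono (i ≫ Limits.pullback.fst S.g q) := by rw [hi1]; infer_instance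
    exact mono_of_mono i (Limits.pullback.fst S.g q)
  refine { exact := ?_, mono_f := this, epi_g := by dsimp; infer_instance }
  refine ShortComplex.exact_of_f_is_kernel _ (Limits.KernelFork.IsLimit.ofι' _ _ ?_)
  intro W k hk
  have hk' : (k ≫ Limits.pullback.fst S.g q) ≫ S.g = 0 := by
    rw [Category.assoc, Limits.pullback.condition, ← Category.assoc]
    erw [hk]
    simp
  refine ⟨hS.exact.lift _ hk', ?_⟩
  apply Limits.pullback.hom_ext
  · rw [Category.assoc, hi1]; exact hS.exact.lift_f _ hk'
  · rw [Category.assoc, hi2]; simpa using! hk.symm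

lemma isPullback_existsUnique {B A Z Q : Sheaf J AddCommGrpCat.{0}} {r : B ⟶ A} {p : B ⟶ Z}
    {g : A ⟶ Q} {q : Z ⟶ Q} (h : IsPullback r p g q) {X : Cᵒᵖ} (a : A.obj.obj X)
    (z : Z.obj.obj X) (e : g.hom.app X a = q.hom.app X z) :
    ∃! b : B.obj.obj X, r.hom.app X b = a ∧ p.hom.app X b = z := by
  have h' := h.map (sheafToPresheaf J AddCommGrpCat.{0} ⋙ (evaluation _ _).obj X ⋙ forget _)
  obtain ⟨b, hb⟩ := Limits.Types.exists_of_isPullback h' a z e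
  exact ⟨b, hb, fun b' hb' => Limits.Types.ext_of_isPullback h' (hb'.1.trans hb.1.symm) (hb'.2.trans hb.2.symm)⟩

end Site


/-! ## Torsors and extensions -/

section Torsors

variable {C : Type} [SmallCategory C] {J : GrothendieckTopology C}
  {A : Sheaf J AddCommGrpCat.{0}}

namespace PresheafWithAction

lemma IsTorsor.act_injective {T : PresheafWithAction A.obj} (hT : T.IsTorsor) {X : Cᵒᵖ}
    {a b : A.obj.obj X} {t : T.carrier.obj X} (h : T.act X a t = T.act X b t) : a = b :=
  (hT.existsUnique_act X t _).unique h rfl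

/-- An invariant map from a torsor to a sheaf is given by a global section of the sheaf. -/
lemma IsTorsor.descend {T : PresheafWithAction A.obj} (hT : T.IsTorsor) {F : Cᵒᵖ ⥤ Type}
    (hF : Presheaf.IsSheaf J F) (φ : T.carrier ⟶ F)
    (hφ : ∀ X a t, φ.app X (T.act X a t) = φ.app X t) :
    ∃ u : ∀ X : C, F.obj (op X), (∀ ⦃X Y : C⦄ (f : Y ⟶ X), F.map f.op (u X) = u Y) ∧
      ∀ X t, φ.app (op X) t = u X := by
  have hconst : ∀ X (t t' : T.carrier.obj X), φ.app X t = φ.app X t' := by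
    intro X t t'
    obtain ⟨a, ha, -⟩ := hT.existsUnique_act X t t'
    rw [← ha, hφ]
  -- `T` may have no section over `X`, so the value is glued from arbitrary local sections; by
  -- `hconst` their choice does not matter.
  have hex : ∀ X : C, ∃ u : F.obj (op X), ∀ (Y : C) (f : Y ⟶ X) (t : T.carrier.obj (op Y)),
      F.map f.op u = φ.app (op Y) t := by
    intro X
    obtain ⟨R, hR, hne⟩ := hT.locally_nonempty X
    obtain ⟨u, hu⟩ := sheaf_glue hF hR (fun Y f hf => φ.app (op Y) (hne f hf).some) (by
      intro Y Z f hf g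
      rw [← NatTrans.naturality_apply]
      exact hconst _ _ _)
    refine ⟨u, fun Y f t => sheaf_separated hF (J.pullback_stable f hR) fun Z g hg => ?_⟩
    rw [← types_map_comp, hu _ hg, ← NatTrans.naturality_apply]
    exact hconst _ _ _
  choose u hu using hex
  refine ⟨u, fun X Y f => ?_, fun X t => ?_⟩
  · obtain ⟨R, hR, hne⟩ := hT.locally_nonempty Y
    refine sheaf_separated hF hR fun Z g hg => ?_
    rw [← types_map_comp, hu _ _ _ (hne g hg).some, hu _ _ _ (hne g hg).some]
  · rw [← hu X X (𝟙 X) t]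
    simp

/-- A torsor whose class vanishes has a global section. -/
lemma HasClass.exists_section_of_eq_zero {T : PresheafWithAction A.obj}
    (h : T.HasClass (0 : A.H 1)) : ∃ t : ∀ X : C, T.carrier.obj (op X),
      ∀ ⦃X Y : C⦄ (f : Y ⟶ X), T.carrier.map f.op (t X) = t Y := by
  obtain ⟨B, i, p, w, hS, θ, hc, -, hbij⟩ := h
  -- The class of the extension is the obstruction to lifting the identity of ℤ through `p`. It
  -- vanishes, so there is a splitting, and its value at 1 lies in the fiber over 1, which is `T`.
  obtain ⟨x, hx⟩ := Abelian.Ext.covariant_sequence_exact₃ _ hS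
    (Abelian.Ext.mk₀ (𝟙 (integerSheaf J))) (n₁ := 1) rfl (by
      rw [Abelian.Ext.mk₀_id_comp]; exact hc)
  obtain ⟨s, rfl⟩ := (Abelian.Ext.mk₀_bijective _ _).2 x
  dsimp only at hx
  rw [Abelian.Ext.mk₀_comp_mk₀] at hx
  have hs : s ≫ p = 𝟙 _ := (Abelian.Ext.mk₀_bijective _ _).1 hx
  have hs1 : ∀ X : C, p.hom.app (op X) (s.hom.app (op X) (oneSection J (op X))) =
      oneSection J (op X) := by
    intro X
    rw [← hom_comp_app, hs]; rfl
  choose t _ ht using fun X : C => (hbij (op X)).surjOn (hs1 X)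
  refine ⟨t, fun X Y f => (hbij (op Y)).injOn trivial trivial ?_⟩
  rw [NatTrans.naturality_apply, ht, ht]
  refine (hom_naturality s f _).symm.trans ?_
  rw [map_oneSection]

/-- The class of a torsor is unique. -/
lemma IsTorsor.hasClass_unique {T : PresheafWithAction A.obj} (hT : T.IsTorsor) {c c' : A.H 1}
    (h : T.HasClass c) (h' : T.HasClass c') : c = c' := by
  obtain ⟨B, i, p, w, hS, θ, rfl, hact, hbij⟩ := h
  obtain ⟨B', i', p', w', hS', θ', rfl, hact', hbij'⟩ := h'
  let I := Injective.under A
  let j : A ⟶ I := Injective.ι A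
  let SI := ShortComplex.mk j (Limits.cokernel.π j) (Limits.cokernel.condition j)
  have hI : SI.ShortExact :=
    { exact := ShortComplex.exact_cokernel j
      mono_f := inferInstanceAs (Mono j)
      epi_g := inferInstanceAs (Epi (Limits.cokernel.π j)) }
  -- As `I` is injective, each extension maps to the fixed sequence 0 → A → I → I/A → 0 by the
  -- identity on `A`. Its class is therefore the image of the induced map `g` from ℤ to I/A under
  -- the connecting homomorphism.
  have key : ∀ (B : Sheaf J AddCommGrpCat.{0}) (i : A ⟶ B) (p : B ⟶ integerSheaf J)
      (w : i ≫ p = 0) (hS : (ShortComplex.mk i p w).ShortExact),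
      ∃ (f : B ⟶ I) (g : integerSheaf J ⟶ SI.X₃), i ≫ f = j ∧ f ≫ SI.g = p ≫ g ∧
        hS.extClass = (Abelian.Ext.mk₀ g).comp hI.extClass (zero_add 1) := by
    intro B i p w hS
    have := hS.mono_f
    have := hS.epi_g
    have hm : Mono i := hS.mono_f
    let f : B ⟶ I := Injective.factorThru j i
    have hf : i ≫ f = j := Injective.comp_factorThru j i
    have hf0 : (ShortComplex.mk i p w).f ≫ (f ≫ SI.g) = 0 := by
      change i ≫ f ≫ _ = 0
      rw [← Category.assoc, hf]
      exact SI.zero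
    let g : integerSheaf J ⟶ SI.X₃ := hS.exact.desc (f ≫ SI.g) hf0
    have hg : p ≫ g = f ≫ SI.g := hS.exact.g_desc _ hf0
    refine ⟨f, g, hf, hg.symm, ?_⟩
    have := ShortComplex.ShortExact.extClass_naturality hS hI
      { τ₁ := 𝟙 A, τ₂ := f, τ₃ := g, comm₁₂ := by simpa using! hf.symm, comm₂₃ := hg.symm }
    refine Eq.trans ?_ this
    exact (Abelian.Ext.comp_mk₀_id _).symm
  obtain ⟨f, g, hf, hg, hc⟩ := key B i p w hS
  obtain ⟨f', g', hf', hg', hc'⟩ := key B' i' p' w' hS'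
  -- The two maps from `T` to `I` change by the same amount under translation by `A`. Their
  -- difference is invariant, hence comes from a global section of `I`, that is, from a map ℤ → I;
  -- it lifts `g - g'`, so `g` and `g'` have the same connecting image.
  let φ : T.carrier ⟶ I.obj ⋙ forget AddCommGrpCat.{0} :=
    { app := fun X => ↾(fun t => (f.hom.app X (θ.app X t) - f'.hom.app X (θ'.app X t) :
        I.obj.obj X))
      naturality := fun X Y k => by
        ext t
        change f.hom.app Y (θ.app Y (T.carrier.map k t)) -
          f'.hom.app Y (θ'.app Y (T.carrier.map k t)) =
            I.obj.map k (f.hom.app X (θ.app X t) - f'.hom.app X (θ'.app X t))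
        rw [NatTrans.naturality_apply, NatTrans.naturality_apply, map_sub]
        exact congrArg₂ _ (hom_naturality f k.unop _) (hom_naturality f' k.unop _) }
  obtain ⟨u, hu, huφ⟩ := hT.descend (isSheaf_forget I) φ (by
    intro X a t
    change f.hom.app X (θ.app X (T.act X a t)) - f'.hom.app X (θ'.app X (T.act X a t)) =
      f.hom.app X (θ.app X t) - f'.hom.app X (θ'.app X t)
    rw [hact, hact', map_add, map_add, ← hom_comp_app, ← hom_comp_app, hf, hf']
    abel)
  obtain ⟨s, hs⟩ := exists_integerSheaf_hom (B := I) u hu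
  have hsg : s ≫ SI.g = g - g' := by
    refine integerSheaf_hom_ext fun X => ?_
    obtain ⟨R, hR, hne⟩ := hT.locally_nonempty X
    refine group_separated _ hR fun Y k hk => ?_
    rw [← hom_naturality, ← hom_naturality, map_oneSection, hom_comp_app, hs,
      ← huφ Y (hne k hk).some]
    change SI.g.hom.app _ (f.hom.app _ _ - f'.hom.app _ _) = g.hom.app _ _ - g'.hom.app _ _
    rw [map_sub, ← hom_comp_app, ← hom_comp_app, hg, hg', hom_comp_app, hom_comp_app]
    exact congrArg₂ _ (congrArg _ ((hbij (op Y)).mapsTo trivial))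
      (congrArg _ ((hbij' (op Y)).mapsTo trivial))
  have hgs : g = s ≫ SI.g + g' := by rw [hsg]; abel
  rw [hc, hc', hgs, Abelian.Ext.mk₀_add, Abelian.Ext.add_comp, ← Abelian.Ext.mk₀_comp_mk₀,
    Abelian.Ext.comp_assoc _ _ _ (zero_add 0) (zero_add 1) (by rfl), hI.comp_extClass,
    Abelian.Ext.comp_zero, zero_add]

/-- Every class in `H¹` is the class of an extension of `ℤ`. -/
lemma exists_extension (c : A.H 1) :
    ∃ (B : Sheaf J AddCommGrpCat.{0}) (i : A ⟶ B) (p : B ⟶ integerSheaf J) (w : i ≫ p = 0)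
      (h : (ShortComplex.mk i p w).ShortExact), h.extClass = c := by
  let I := Injective.under A
  let j : A ⟶ I := Injective.ι A
  let SI := ShortComplex.mk j (Limits.cokernel.π j) (Limits.cokernel.condition j)
  have hI : SI.ShortExact :=
    { exact := ShortComplex.exact_cokernel j
      mono_f := inferInstanceAs (Mono j)
      epi_g := inferInstanceAs (Epi (Limits.cokernel.π j)) }
  have hinj : Injective SI.X₂ := inferInstanceAs (Injective (Injective.under A))
  -- Since the first cohomology of `I` vanishes, `c` is the connecting image of some q : ℤ → I/A,
  -- and the pullback of the sequence along `q` has class `c`.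
  obtain ⟨x, hx⟩ := Abelian.Ext.covariant_sequence_exact₁ _ hI c
    (Abelian.Ext.eq_zero_of_injective _) (n₀ := 0) rfl
  obtain ⟨q, rfl⟩ := (Abelian.Ext.mk₀_bijective _ _).2 x
  obtain ⟨B, i, p, r, w, hS, hir, hpb⟩ := exists_pullback_shortExact hI q
  refine ⟨B, i, p, w, hS, ?_⟩
  have := ShortComplex.ShortExact.extClass_naturality hS hI
    { τ₁ := 𝟙 A, τ₂ := r, τ₃ := q, comm₁₂ := by simpa using! hir.symm, comm₂₃ := hpb.w }
  rw [← hx]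
  refine Eq.trans ?_ this
  exact (Abelian.Ext.comp_mk₀_id _).symm

/-- The torsor of an extension of `ℤ`: the fiber over `1`. -/
noncomputable def ofExtension {B : Sheaf J AddCommGrpCat.{0}} {i : A ⟶ B}
    {p : B ⟶ integerSheaf J} (w : i ≫ p = 0) : PresheafWithAction A.obj where
  carrier :=
    { obj := fun X => {b : B.obj.obj X // p.hom.app X b = oneSection J X}
      map := fun {X Y} f => ↾(fun b => ⟨B.obj.map f b.1, by
        rw [← f.op_unop]
        refine (hom_naturality p f.unop b.1).trans ?_
        rw [show p.hom.app (op X.unop) b.1 = _ from b.2]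
        exact map_oneSection f.unop⟩)
      map_id := fun X => by
        refine ConcreteCategory.hom_ext _ _ fun b => Subtype.ext ?_
        exact presheaf_map_id (A := B.obj) b.1
      map_comp := fun f g => by
        refine ConcreteCategory.hom_ext _ _ fun b => Subtype.ext ?_
        exact presheaf_map_comp (A := B.obj) f.unop g.unop b.1 }
  act X a b := ⟨i.hom.app X a + b.1, by
    rw [map_add, b.2, ← hom_comp_app, w]
    exact zero_add _⟩
  zero_act X b := Subtype.ext (by
    change i.hom.app X 0 + b.1 = b.1
    rw [map_zero, zero_add])
  add_act X a a' b := Subtype.ext (by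
    change i.hom.app X (a + a') + b.1 = i.hom.app X a + (i.hom.app X a' + b.1)
    rw [map_add, add_assoc])
  map_act {X Y} f a b := Subtype.ext (by
    change B.obj.map f (i.hom.app X a + b.1) = i.hom.app Y (A.obj.map f a) + B.obj.map f b.1
    rw [map_add]
    exact congrArg (· + B.obj.map f b.1) (hom_naturality i f.unop a).symm)

lemma ofExtension_isTorsor {B : Sheaf J AddCommGrpCat.{0}} {i : A ⟶ B}
    {p : B ⟶ integerSheaf J} (w : i ≫ p = 0) (h : (ShortComplex.mk i p w).ShortExact) :
    (ofExtension w).IsTorsor where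
  isSheaf := by
    rw [isSheaf_iff_isSheaf_of_type]
    intro X R hR x hx
    have hx' := (Presieve.compatible_iff_sieveCompatible x).1 hx
    obtain ⟨b, hb⟩ := group_glue B hR (fun Y f hf => (x f hf).1)
      (fun Y Z f hf g => (congrArg Subtype.val (hx' f g hf)).symm)
    refine ⟨⟨b, ?_⟩, fun Y f hf => Subtype.ext (hb f hf), fun b' hb' => Subtype.ext ?_⟩
    · refine group_separated _ hR fun Y f hf => ?_
      rw [← hom_naturality, hb f hf, map_oneSection]
      exact (x f hf).2
    · refine group_separated _ hR fun Y f hf => ?_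
      rw [hb f hf]
      exact congrArg Subtype.val (hb' f hf)
  existsUnique_act X b b' := by
    obtain ⟨a, ha⟩ := shortExact_exact h (X := X) (b := b'.1 - b.1) (by
      change p.hom.app X _ = 0
      rw [map_sub, b.2, b'.2, sub_self])
    refine ⟨a, Subtype.ext (eq_sub_iff_add_eq.1 ha), fun a' ha' => shortExact_injective h X ?_⟩
    rw [ha, eq_sub_iff_add_eq]
    exact congrArg Subtype.val ha'
  locally_nonempty X := by
    have : Epi p := h.epi_g
    obtain ⟨R, hR, hs⟩ := epi_locally_surjective p (oneSection J (op X))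
    refine ⟨R, hR, fun Y f hf => ?_⟩
    obtain ⟨b, hb⟩ := hs f hf
    exact ⟨⟨b, hb.trans (map_oneSection f)⟩⟩

/-- If the torsor of an extension has a global section, the extension splits. -/
lemma extClass_eq_zero_of_section {B : Sheaf J AddCommGrpCat.{0}} {i : A ⟶ B}
    {p : B ⟶ integerSheaf J} (w : i ≫ p = 0) (h : (ShortComplex.mk i p w).ShortExact)
    (t : ∀ X : C, (ofExtension w).carrier.obj (op X))
    (ht : ∀ ⦃X Y : C⦄ (f : Y ⟶ X), (ofExtension w).carrier.map f.op (t X) = t Y) :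
    h.extClass = 0 := by
  obtain ⟨s, hs⟩ := exists_integerSheaf_hom (B := B) (fun X => (t X).1)
    (fun X Y f => congrArg Subtype.val (ht f))
  have hsp : s ≫ p = 𝟙 _ := integerSheaf_hom_ext fun X => by
    rw [hom_comp_app, hs]
    exact (t X).2
  have := h.comp_extClass
  calc h.extClass = (Abelian.Ext.mk₀ (𝟙 (integerSheaf J))).comp h.extClass (zero_add 1) :=
        (Abelian.Ext.mk₀_id_comp _).symm
    _ = (Abelian.Ext.mk₀ s).comp ((Abelian.Ext.mk₀ p).comp h.extClass (zero_add 1))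
        (zero_add 1) := by
        rw [← hsp, ← Abelian.Ext.mk₀_comp_mk₀,
          Abelian.Ext.comp_assoc _ _ _ (zero_add 0) (zero_add 1) (by rfl)]
    _ = 0 := by
        rw [show (Abelian.Ext.mk₀ p).comp h.extClass (zero_add 1) = 0 from h.comp_extClass,
          Abelian.Ext.comp_zero]

/-- An equivariant map of torsors is bijective. -/
lemma bijective_of_equivariant {T P : PresheafWithAction A.obj} (hT : T.IsTorsor)
    (hP : P.IsTorsor) (θ : T.carrier ⟶ P.carrier)
    (hθ : ∀ X a t, θ.app X (T.act X a t) = P.act X a (θ.app X t)) (X : C) :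
    Function.Bijective (θ.app (op X)) := by
  have hinj : ∀ X, Function.Injective (θ.app X) := by
    intro X t t' e
    obtain ⟨a, ha, -⟩ := hT.existsUnique_act X t t'
    rw [← ha, hθ] at e
    have : a = 0 := hP.act_injective (e.symm.trans (P.zero_act _ _).symm)
    rw [← ha, this, T.zero_act]
  refine ⟨hinj _, fun b => ?_⟩
  obtain ⟨R, hR, hne⟩ := hT.locally_nonempty X
  -- Where `T` has a section, a translate of it maps to the given one. These preimages glue because
  -- the map is injective.
  have hloc : ∀ ⦃Y : C⦄ (f : Y ⟶ X), R f →
      ∃ t, θ.app (op Y) t = P.carrier.map f.op b := by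
    intro Y f hf
    obtain ⟨a, ha, -⟩ := hP.existsUnique_act _ (θ.app (op Y) (hne f hf).some)
      (P.carrier.map f.op b)
    exact ⟨_, (hθ _ a _).trans ha⟩
  choose t ht using hloc
  obtain ⟨t₀, ht₀⟩ := sheaf_glue hT.isSheaf hR t (fun Y Z f hf g => hinj _ (by
    rw [NatTrans.naturality_apply, ht, ht, types_map_comp]))
  refine ⟨t₀, sheaf_separated hP.isSheaf hR fun Y f hf => ?_⟩
  rw [← NatTrans.naturality_apply, ht₀ f hf, ht]

/-- A torsor that maps to the torsor of an extension has the class of the extension. -/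
lemma hasClass_of_equivariant {T : PresheafWithAction A.obj} (hT : T.IsTorsor)
    {B : Sheaf J AddCommGrpCat.{0}} {i : A ⟶ B}
    {p : B ⟶ integerSheaf J} (w : i ≫ p = 0) (h : (ShortComplex.mk i p w).ShortExact)
    (θ : T.carrier ⟶ (ofExtension w).carrier)
    (hθ : ∀ X a t, θ.app X (T.act X a t) = (ofExtension w).act X a (θ.app X t)) :
    T.HasClass h.extClass := by
  refine ⟨B, i, p, w, h, { app := fun X => ↾(fun t => (θ.app X t).1), naturality := ?_ }, rfl,
    fun X a t => congrArg Subtype.val (hθ X a t), fun X => ?_⟩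
  · intro X Y f
    ext t
    exact congrArg Subtype.val (NatTrans.naturality_apply θ f t)
  · have hb := bijective_of_equivariant hT (ofExtension_isTorsor w h) θ hθ X.unop
    refine ⟨fun t _ => (θ.app X t).2, fun t _ t' _ e => hb.1 (Subtype.ext e), fun b hb' => ?_⟩
    obtain ⟨t, ht⟩ := hb.2 ⟨b, hb'⟩
    exact ⟨t, trivial, congrArg Subtype.val ht⟩

end PresheafWithAction

end Torsors


section Torsors

variable {C : Type} [SmallCategory C] {J : GrothendieckTopology C}
  {A : Sheaf J AddCommGrpCat.{0}}

namespace PresheafWithAction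

/-! ### Every torsor has a class -/

/-- The group of natural maps from `T` to `A` over an object `X`. -/
def mapGroup (T : PresheafWithAction A.obj) (X : C) :
    AddSubgroup (∀ (Y : C) (_ : Y ⟶ X), T.carrier.obj (op Y) → A.obj.obj (op Y)) where
  carrier := {β | ∀ ⦃Y Z : C⦄ (f : Y ⟶ X) (g : Z ⟶ Y) (t : T.carrier.obj (op Y)),
    β Z (g ≫ f) (T.carrier.map g.op t) = A.obj.map g.op (β Y f t)}
  zero_mem' Y Z f g t := (map_zero _).symm
  add_mem' {β γ} hβ hγ Y Z f g t := by
    change β Z (g ≫ f) _ + γ Z (g ≫ f) _ = A.obj.map g.op (β Y f t + γ Y f t)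
    rw [hβ, hγ, map_add]
  neg_mem' {β} hβ Y Z f g t := by
    change -β Z (g ≫ f) _ = A.obj.map g.op (-β Y f t)
    rw [hβ, map_neg]

/-- The presheaf of natural maps from `T` to `A`. -/
def mapPresheaf (T : PresheafWithAction A.obj) : Cᵒᵖ ⥤ AddCommGrpCat.{0} where
  obj X := AddCommGrpCat.of (mapGroup T X.unop)
  map {X X'} k := AddCommGrpCat.ofHom
    { toFun := fun β => ⟨fun Y f t => β.1 Y (f ≫ k.unop) t, fun Y Z f g t => by
        have := β.2 (f ≫ k.unop) g t
        rwa [← Category.assoc] at this⟩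
      map_zero' := rfl
      map_add' := fun _ _ => rfl }
  map_id X := by
    ext β : 2
    refine Subtype.ext (funext fun Y => funext fun f => funext fun t => ?_)
    exact congrArg (fun g => β.1 Y g t) (Category.comp_id f)
  map_comp k l := by
    ext β : 2
    refine Subtype.ext (funext fun Y => funext fun f => funext fun t => ?_)
    exact congrArg (fun g => β.1 Y g t) (Category.assoc f l.unop k.unop).symm

/-- The value of the glued map at `t` is itself glued, in the sheaf `A`, from the values of the
local maps at the restrictions of `t`. -/
lemma mapPresheaf_isSheaf (T : PresheafWithAction A.obj) :
    Presheaf.IsSheaf J (mapPresheaf T) := by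
  rw [Presheaf.isSheaf_iff_isSheaf_forget _ _ (forget AddCommGrpCat.{0}),
    isSheaf_iff_isSheaf_of_type]
  intro X R hR x hx
  have hx' : ∀ ⦃Y Z : C⦄ (f : Y ⟶ X) (g : Z ⟶ Y) (hf : R f) (W : C) (h : W ⟶ Z)
      (t : T.carrier.obj (op W)), (x (g ≫ f) (R.downward_closed hf g)).1 W h t =
        (x f hf).1 W (h ≫ g) t := fun Y Z f g hf W h t =>
    congrFun (congrFun (congrFun (congrArg Subtype.val
      ((Presieve.compatible_iff_sieveCompatible x).1 hx f g hf)) W) h) t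
  have hxc : ∀ {Z W : C} {k k' : Z ⟶ X} (hk : R k) (hk' : R k') (_ : k = k') (h : W ⟶ Z)
      (t : T.carrier.obj (op W)), (x k hk).1 W h t = (x k' hk').1 W h t := by
    rintro Z W k _ hk hk' rfl h t; rfl
  have hgl : ∀ (Y : C) (f : Y ⟶ X) (t : T.carrier.obj (op Y)), ∃ a : A.obj.obj (op Y),
      ∀ ⦃Z : C⦄ (g : Z ⟶ Y) (hg : R (g ≫ f)),
        A.obj.map g.op a = (x (g ≫ f) hg).1 Z (𝟙 Z) (T.carrier.map g.op t) := by
    intro Y f t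
    refine group_glue A (J.pullback_stable f hR)
      (fun Z g hg => (x (g ≫ f) hg).1 Z (𝟙 Z) (T.carrier.map g.op t)) ?_
    intro Z W g hg h
    have e := (x (g ≫ f) hg).2 (𝟙 Z) h (T.carrier.map g.op t)
    have e' := hx' (g ≫ f) h hg W (𝟙 W) (T.carrier.map (h ≫ g).op t)
    rw [← e, types_map_comp]
    simp only [Category.comp_id, Category.id_comp, types_map_comp] at e' ⊢
    exact e'.symm.trans (hxc _ _ (Category.assoc h g f).symm _ _)
  choose b hb using hgl
  have hbx : ∀ ⦃Y : C⦄ (f : Y ⟶ X) (hf : R f) (Z : C) (g : Z ⟶ Y) (t : T.carrier.obj (op Z)),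
      b Z (g ≫ f) t = (x f hf).1 Z g t := by
    intro Y f hf Z g t
    have h1 := hb Z (g ≫ f) t (𝟙 Z) (by
      rw [Category.id_comp]; exact R.downward_closed hf g)
    have h2 := hx' f g hf Z (𝟙 Z) t
    rw [Category.id_comp] at h2
    rw [← h2]
    rw [types_map_id, op_id, presheaf_map_id] at h1
    rw [h1]
    exact hxc _ _ (Category.id_comp (g ≫ f)) _ _
  have hbmem : b ∈ mapGroup T X := by
    intro Y Z f g t
    refine group_separated A (J.pullback_stable (g ≫ f) hR) fun W h hh => ?_
    rw [hb Z (g ≫ f) _ h hh, ← presheaf_map_comp, hb Y f t (h ≫ g) (by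
      rw [Category.assoc]; exact hh), types_map_comp]
    exact hxc _ _ (Category.assoc h g f).symm _ _
  refine ⟨⟨b, hbmem⟩, fun Y f hf => Subtype.ext ?_, fun b' hb' => Subtype.ext ?_⟩
  · funext Z g t
    exact hbx f hf Z g t
  · funext Y f t
    refine group_separated A (J.pullback_stable f hR) fun Z g hg => ?_
    rw [hb Y f t g hg]
    have h1 := congrFun (congrFun (congrFun (congrArg Subtype.val (hb' (g ≫ f) hg)) Z) (𝟙 Z))
      (T.carrier.map g.op t)
    rw [← h1]
    refine (b'.2 f g t).symm.trans ?_
    exact congrArg (fun k => b'.1 Z k (T.carrier.map g.op t)) (Category.id_comp (g ≫ f)).symm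

/-- The sheaf of natural maps from `T` to `A`. -/
def mapSheaf (T : PresheafWithAction A.obj) : Sheaf J AddCommGrpCat.{0} :=
  ⟨mapPresheaf T, mapPresheaf_isSheaf T⟩

/-- The inclusion of the constant maps. -/
def constMap (T : PresheafWithAction A.obj) : A ⟶ mapSheaf T where
  hom :=
    { app := fun X => AddCommGrpCat.ofHom
        { toFun := fun a => ⟨fun Y f _ => A.obj.map f.op a, fun Y Z f g t =>
            presheaf_map_comp f g a⟩
          map_zero' := Subtype.ext (funext fun Y => funext fun f => funext fun t => map_zero _)
          map_add' := fun a b =>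
            Subtype.ext (funext fun Y => funext fun f => funext fun t => map_add _ a b) }
      naturality := fun X Y k => by
        ext a : 2
        exact Subtype.ext (funext fun Z => funext fun f => funext fun t =>
          (presheaf_map_comp k.unop f a).symm) }

/-- Every torsor has a class. -/
theorem IsTorsor.exists_hasClass {T : PresheafWithAction A.obj} (hT : T.IsTorsor) :
    ∃ c : A.H 1, T.HasClass c := by
  have hinj : ∀ X, Function.Injective ((constMap T).hom.app X) := by
    intro X a a' e
    obtain ⟨R, hR, hne⟩ := hT.locally_nonempty X.unop
    refine group_separated A (X := X.unop) hR fun Y f hf => ?_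
    exact congrFun (congrFun (congrFun (congrArg Subtype.val e) Y) f) (hne f hf).some
  have hmono : Mono (constMap T) := Sheaf.mono_of_injective _ hinj
  let S := ShortComplex.mk (constMap T) (Limits.cokernel.π (constMap T))
    (Limits.cokernel.condition _)
  have hS : S.ShortExact :=
    { exact := ShortComplex.exact_cokernel _
      mono_f := hmono
      epi_g := inferInstanceAs (Epi (Limits.cokernel.π (constMap T))) }
  choose δ hδ hδu using fun X => hT.existsUnique_act X
  have hδ_act : ∀ X a t t', δ X t (T.act X a t') = a + δ X t t' := by
    intro X a t t'
    refine (hδu X _ _ _ ?_).symm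
    beta_reduce
    rw [T.add_act, hδ]
  have hδ_map : ∀ {X Y : C} (f : Y ⟶ X) t t', δ _ (T.carrier.map f.op t)
      (T.carrier.map f.op t') = A.obj.map f.op (δ _ t t') := by
    intro X Y f t t'
    refine (hδu _ _ _ _ ?_).symm
    beta_reduce
    rw [← T.map_act, hδ]
  -- A section t₀ is sent to the map t ↦ t₀ - t. Translating t₀ by `a` adds the constant map `a`, so
  -- modulo constant maps the image does not depend on t₀ and gives a global section of the
  -- quotient. Pulling the extension of the quotient by `A` back along this section produces an
  -- extension of ℤ with torsor `T`.
  let θ : T.carrier ⟶ (mapSheaf T).obj ⋙ forget AddCommGrpCat.{0} :=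
    { app := fun X => ↾(fun t₀ => (⟨fun Y f t => δ _ t (T.carrier.map f.op t₀), fun Y Z f g t => by
        beta_reduce
        rw [types_map_comp, hδ_map]⟩ : mapGroup T X.unop))
      naturality := fun X X' k => by
        refine ConcreteCategory.hom_ext _ _ fun t₀ => Subtype.ext ?_
        funext Y f t
        change δ _ t (T.carrier.map f.op (T.carrier.map k t₀)) =
          δ _ t (T.carrier.map (f ≫ k.unop).op t₀)
        rw [types_map_comp]; rfl }
  have hθ_act : ∀ X a t, (θ.app X (T.act X a t) : (mapSheaf T).obj.obj X) =
      (constMap T).hom.app X a + (θ.app X t : (mapSheaf T).obj.obj X) := by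
    intro X a t₀
    refine Subtype.ext (funext fun Y => funext fun f => funext fun t => ?_)
    change δ _ t (T.carrier.map f.op (T.act X a t₀)) =
      A.obj.map f.op a + δ _ t (T.carrier.map f.op t₀)
    rw [T.map_act, hδ_act]
  have hθ_inj : ∀ X, Function.Injective (θ.app X) := by
    intro X t t' e
    have h1 : δ _ t (T.carrier.map (𝟙 X.unop).op t) = δ _ t (T.carrier.map (𝟙 X.unop).op t') :=
      congrFun (congrFun (congrFun (congrArg Subtype.val e) X.unop) (𝟙 _)) t
    simp only [types_map_id] at h1
    have h2 := hδ X t t'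
    have h3 := hδ X t t
    change δ (op X.unop) t t = δ (op X.unop) t t' at h1
    exact h3.symm.trans ((congrArg (fun a => T.act X a t) h1).trans h2)
  let φ : T.carrier ⟶ S.X₃.obj ⋙ forget AddCommGrpCat.{0} :=
    θ ≫ Functor.whiskerRight S.g.hom (forget AddCommGrpCat.{0})
  have hφ : ∀ X t, φ.app X t = S.g.hom.app X (θ.app X t) := fun X t => rfl
  have hz : ∀ X a, S.g.hom.app X ((constMap T).hom.app X a) = 0 := by
    intro X a
    rw [← hom_comp_app, show constMap T ≫ S.g = 0 from S.zero]; rfl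
  obtain ⟨u, hu, huφ⟩ := hT.descend (isSheaf_forget S.X₃) φ (fun X a t => by
    rw [hφ, hφ, hθ_act, map_add, hz, zero_add])
  obtain ⟨q, hq⟩ := exists_integerSheaf_hom (B := S.X₃) u hu
  obtain ⟨B, i, p, r, w, hB, hir, hpb⟩ := exists_pullback_shortExact hS q
  have hex : ∀ X t, ∃ b : (ofExtension w).carrier.obj X, r.hom.app X b.1 = θ.app X t := by
    intro X t
    obtain ⟨b, ⟨h1, h2⟩, -⟩ := isPullback_existsUnique hpb (θ.app X t) (oneSection J X) (by
      rw [← hφ]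
      exact (huφ X.unop t).trans (hq X.unop).symm)
    exact ⟨⟨b, h2⟩, h1⟩
  choose ψ hψ using hex
  have hext : ∀ X (b b' : (ofExtension w).carrier.obj X),
      r.hom.app X b.1 = r.hom.app X b'.1 → b = b' := by
    intro X b b' e
    refine Subtype.ext ((isPullback_existsUnique hpb (r.hom.app X b'.1) (oneSection J X) ?_).unique
      ⟨e, b.2⟩ ⟨rfl, b'.2⟩)
    rw [← hom_comp_app, hpb.w, hom_comp_app, b'.2]
  refine ⟨_, hasClass_of_equivariant hT w hB
    { app := fun X => ↾(ψ X), naturality := fun X Y f => ?_ } fun X a t => ?_⟩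
  · refine ConcreteCategory.hom_ext _ _ fun t => hext _ _ _ ?_
    change r.hom.app Y (ψ Y _).1 = r.hom.app Y (B.obj.map f (ψ X t).1)
    rw [hψ]
    refine Eq.trans ?_ (hom_naturality r f.unop _).symm
    rw [hψ]
    exact NatTrans.naturality_apply θ f t
  · refine hext _ _ _ ?_
    change r.hom.app X (ψ X _).1 = r.hom.app X (i.hom.app X a + (ψ X t).1)
    rw [hψ, hθ_act, map_add, hψ, ← hom_comp_app, hir]

/-! ### Comparison of torsors via a local generator of the site -/

/-- Two torsors which have sections over a locally universal object `X₀` with the same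
cocycle are isomorphic. -/
theorem exists_equivariant_of_cocycle_eq {T P : PresheafWithAction A.obj} (hT : T.IsTorsor)
    (hP : P.IsTorsor) {X₀ : C} (M : Set (X₀ ⟶ X₀))
    (hcov : ∀ X : C, ∃ R ∈ J X, ∀ ⦃Y : C⦄ (f : Y ⟶ X), R f → Nonempty (Y ⟶ X₀))
    (hM : ∀ (X : C) (g g' : X ⟶ X₀), ∃ R ∈ J X, ∀ ⦃Y : C⦄ (f : Y ⟶ X), R f →
      ∃ γ ∈ M, f ≫ g' = f ≫ g ≫ γ)
    (t₀ : T.carrier.obj (op X₀)) (p₀ : P.carrier.obj (op X₀))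
    (hcoc : ∀ γ ∈ M, ∀ a, T.carrier.map γ.op t₀ = T.act _ a t₀ →
      P.carrier.map γ.op p₀ = P.act _ a p₀) :
    ∃ θ : T.carrier ⟶ P.carrier,
      ∀ X a t, θ.app X (T.act X a t) = P.act X a (θ.app X t) := by
  -- The map must send a + g*t₀ to a + g*p₀, and this has to be independent of the presentation.
  -- Locally g' is g followed by some γ in `M`. If γ*t₀ = b + t₀, equality of two presentations
  -- forces a = a' + g*b, and the same `b` computes γ*p₀.
  have hwd : ∀ (X : C) (g g' : X ⟶ X₀) (a a' : A.obj.obj (op X)),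
      T.act _ a (T.carrier.map g.op t₀) = T.act _ a' (T.carrier.map g'.op t₀) →
      P.act _ a (P.carrier.map g.op p₀) = P.act _ a' (P.carrier.map g'.op p₀) := by
    intro X g g' a a' e
    obtain ⟨R, hR, hγ⟩ := hM X g g'
    refine sheaf_separated hP.isSheaf hR fun Y f hf => ?_
    obtain ⟨γ, hγM, hγe⟩ := hγ f hf
    obtain ⟨b, hb, -⟩ := hT.existsUnique_act _ t₀ (T.carrier.map γ.op t₀)
    have hb' := hcoc γ hγM b hb.symm
    have e' := congrArg (T.carrier.map f.op) e
    rw [T.map_act, T.map_act, ← types_map_comp g' f, hγe, types_map_comp, types_map_comp,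
      ← hb, T.map_act, T.map_act, ← T.add_act] at e'
    have e'' := hT.act_injective (T := T) e'
    rw [P.map_act, P.map_act, ← types_map_comp g' f, hγe, types_map_comp, types_map_comp,
      hb', P.map_act, P.map_act, ← P.add_act, ← e'']
  -- The value at `t` is glued from chosen local presentations, but is characterised through all
  -- presentations of all restrictions of `t`. This makes naturality and equivariance formal.
  have hex : ∀ (X : C) (t : T.carrier.obj (op X)), ∃ x : P.carrier.obj (op X),
      ∀ (Y : C) (f : Y ⟶ X) (g : Y ⟶ X₀) (a : A.obj.obj (op Y)),
        T.carrier.map f.op t = T.act _ a (T.carrier.map g.op t₀) →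
          P.carrier.map f.op x = P.act _ a (P.carrier.map g.op p₀) := by
    intro X t
    obtain ⟨R, hR, hne⟩ := hcov X
    choose α hα using fun (Y : C) (f : Y ⟶ X) (hf : R f) =>
      (hT.existsUnique_act _ (T.carrier.map (hne f hf).some.op t₀) (T.carrier.map f.op t)).exists
    obtain ⟨x, hx⟩ := sheaf_glue hP.isSheaf hR
      (fun Y f hf => P.act _ (α Y f hf) (P.carrier.map (hne f hf).some.op p₀)) (by
        intro Y Z f hf g
        rw [P.map_act, ← types_map_comp]
        refine hwd Z _ _ _ _ ?_
        rw [hα, types_map_comp, ← T.map_act, hα, types_map_comp])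
    refine ⟨x, fun Y f g a e => sheaf_separated hP.isSheaf (J.pullback_stable f hR)
      fun Z h hh => ?_⟩
    rw [← types_map_comp, hx _ hh, P.map_act, ← types_map_comp]
    refine hwd Z _ _ _ _ ((hα Z (h ≫ f) hh).trans ?_)
    rw [types_map_comp, e, T.map_act, types_map_comp]
  have huniq : ∀ (X : C) (t : T.carrier.obj (op X)) (x x' : P.carrier.obj (op X)),
      (∀ (Y : C) (f : Y ⟶ X) (g : Y ⟶ X₀) (a : A.obj.obj (op Y)),
        T.carrier.map f.op t = T.act _ a (T.carrier.map g.op t₀) →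
          P.carrier.map f.op x = P.carrier.map f.op x') → x = x' := by
    intro X t x x' h
    obtain ⟨R, hR, hne⟩ := hcov X
    refine sheaf_separated hP.isSheaf hR fun Y f hf => ?_
    obtain ⟨a, ha, -⟩ := hT.existsUnique_act _ (T.carrier.map (hne f hf).some.op t₀)
      (T.carrier.map f.op t)
    exact h Y f _ a ha.symm
  choose θ hθ using hex
  refine ⟨{ app := fun X => ↾(θ X.unop), naturality := fun X Y k => ?_ }, fun X a t => ?_⟩
  · refine ConcreteCategory.hom_ext _ _ fun t => ?_
    change θ Y.unop (T.carrier.map k t) = P.carrier.map k (θ X.unop t)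
    refine huniq _ (T.carrier.map k t) _ _ fun Z f g a e => ?_
    rw [hθ _ _ Z f g a e]
    have h2 := hθ X.unop t Z (f ≫ k.unop) g a (by rw [types_map_comp]; exact e)
    rw [← h2, types_map_comp]; rfl
  · change θ X.unop (T.act X a t) = P.act X a (θ X.unop t)
    refine huniq _ (T.act X a t) _ _ fun Z f g b e => ?_
    rw [hθ _ _ Z f g b e]
    have e2 : T.carrier.map f.op t = T.act _ (A.obj.map f.op (-a) + b)
        (T.carrier.map g.op t₀) := by
      rw [T.add_act, ← e, T.map_act (X := op X.unop), ← T.add_act, ← map_add, neg_add_cancel,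
        map_zero, T.zero_act]
    have h2 := hθ X.unop t Z f g _ e2
    rw [P.map_act (X := op X.unop), h2, ← P.add_act, ← add_assoc, ← map_add, add_neg_cancel,
      map_zero, zero_add]

end PresheafWithAction

end Torsors


/-! ## Local structure of families -/

/-! ### Real coordinates with respect to two periods -/

/-- The imaginary part is the determinant of the two vectors in ℝ², the oriented area of the period
parallelogram. Its sign later serves to orient a pair of periods. -/
lemma linearIndependent_pair_iff_im {ω₁ ω₂ : ℂ} :
    LinearIndependent ℝ ![ω₁, ω₂] ↔ (starRingEnd ℂ ω₁ * ω₂).im ≠ 0 := by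
  rw [LinearIndependent.pair_iff]
  simp only [Complex.mul_im, Complex.conj_re, Complex.conj_im, Complex.ext_iff, Complex.add_re,
    Complex.real_smul, Complex.mul_re, Complex.ofReal_re, Complex.ofReal_im, Complex.add_im,
    Complex.zero_re, Complex.zero_im]
  constructor
  · intro h h0
    have h1 := h ω₂.re (-ω₁.re) ⟨by ring, by linarith⟩
    have h2 := h ω₂.im (-ω₁.im) ⟨by linarith, by ring⟩
    have := h 1 0 ⟨by linarith [h1.2], by linarith [h2.2]⟩
    exact one_ne_zero this.1
  · rintro h x y ⟨h1, h2⟩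
    constructor
    · have : x * (ω₁.re * ω₂.im + -ω₁.im * ω₂.re) = 0 := by linear_combination ω₂.im * h1 - ω₂.re * h2
      exact (mul_eq_zero.1 this).resolve_right h
    · have : y * (ω₁.re * ω₂.im + -ω₁.im * ω₂.re) = 0 := by linear_combination ω₁.re * h2 - ω₁.im * h1
      exact (mul_eq_zero.1 this).resolve_right h

/-- The first real coordinate of `z` with respect to `ω₁, ω₂`; the second one is obtained by
exchanging the two periods. -/
noncomputable def periodCoord (ω₁ ω₂ z : ℂ) : ℝ :=
  (starRingEnd ℂ z * ω₂).im / (starRingEnd ℂ ω₁ * ω₂).im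

lemma periodCoord_combination {ω₁ ω₂ : ℂ} (h : LinearIndependent ℝ ![ω₁, ω₂]) (x y : ℝ) :
    periodCoord ω₁ ω₂ (x * ω₁ + y * ω₂) = x := by
  rw [linearIndependent_pair_iff_im] at h
  rw [periodCoord, div_eq_iff h]
  simp only [Complex.mul_im, Complex.conj_re, Complex.conj_im, Complex.add_re,
    Complex.mul_re, Complex.ofReal_re, Complex.ofReal_im, Complex.add_im]
  ring

lemma linearIndependent_pair_swap {ω₁ ω₂ : ℂ} (h : LinearIndependent ℝ ![ω₁, ω₂]) :
    LinearIndependent ℝ ![ω₂, ω₁] := by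
  rw [LinearIndependent.pair_iff] at h ⊢
  intro x y e
  exact (h y x (by rw [add_comm]; exact e)).symm

lemma mem_closure_periods {ω₁ ω₂ z : ℂ} :
    z ∈ AddSubgroup.closure ({ω₁, ω₂} : Set ℂ) ↔ ∃ m n : ℤ, z = m * ω₁ + n * ω₂ := by
  rw [AddSubgroup.mem_closure_pair]
  simp only [zsmul_eq_mul, eq_comm]

/-- A continuous function with values in the lattices spanned by two periods has locally constant
integral coordinates. -/
lemma eventually_eq_int_combination {Y : Type*} [TopologicalSpace Y] {s : Y} {ω₁ ω₂ z : Y → ℂ}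
    (h₁ : ContinuousAt ω₁ s) (h₂ : ContinuousAt ω₂ s) (hz : ContinuousAt z s)
    (hi : ∀ᶠ u in 𝓝 s, LinearIndependent ℝ ![ω₁ u, ω₂ u])
    (hmem : ∀ᶠ u in 𝓝 s, z u ∈ AddSubgroup.closure ({ω₁ u, ω₂ u} : Set ℂ)) :
    ∃ m n : ℤ, ∀ᶠ u in 𝓝 s, z u = m * ω₁ u + n * ω₂ u := by
  have key : ∀ {ω₁ ω₂ : Y → ℂ}, ContinuousAt ω₁ s → ContinuousAt ω₂ s →
      (∀ᶠ u in 𝓝 s, LinearIndependent ℝ ![ω₁ u, ω₂ u]) →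
      (∀ᶠ u in 𝓝 s, ∃ m n : ℤ, z u = m * ω₁ u + n * ω₂ u) →
      ∃ m : ℤ, ∀ᶠ u in 𝓝 s, ∀ m' n : ℤ, z u = m' * ω₁ u + n * ω₂ u → m' = m := by
    intro ω₁ ω₂ h₁ h₂ hi hmem
    obtain ⟨m, n, hmn⟩ := hmem.self_of_nhds
    have hc : ContinuousAt (fun u => periodCoord (ω₁ u) (ω₂ u) (z u)) s := by
      refine ContinuousAt.div ?_ ?_ (linearIndependent_pair_iff_im.1 hi.self_of_nhds)
      · exact Complex.continuous_im.continuousAt.comp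
          ((Complex.continuous_conj.continuousAt.comp hz).mul h₂)
      · exact Complex.continuous_im.continuousAt.comp
          ((Complex.continuous_conj.continuousAt.comp h₁).mul h₂)
    have hcs : periodCoord (ω₁ s) (ω₂ s) (z s) = m := by
      rw [hmn]; exact_mod_cast periodCoord_combination hi.self_of_nhds m n
    refine ⟨m, ?_⟩
    -- The coordinate is continuous and takes integral values, so it equals `m` as soon as it is at
    -- distance less than one from `m`.
    have hb := hc.eventually (Metric.ball_mem_nhds _ one_pos)
    beta_reduce at hb
    rw [hcs] at hb
    filter_upwards [hb, hi] with u hu hiu m' n' e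
    have hm' : periodCoord (ω₁ u) (ω₂ u) (z u) = m' := by
      rw [e]; exact_mod_cast periodCoord_combination hiu m' n'
    change dist _ _ < 1 at hu
    rw [hm', Real.dist_eq] at hu
    have : |m' - m| < 1 := by exact_mod_cast hu
    have := Int.abs_lt_one_iff.1 this
    omega
  simp only [mem_closure_periods] at hmem
  obtain ⟨m, hm⟩ := key h₁ h₂ hi hmem
  obtain ⟨n, hn⟩ := key h₂ h₁ (hi.mono fun _ => linearIndependent_pair_swap)
    (hmem.mono fun u ⟨m, n, e⟩ => ⟨n, m, by rw [e, add_comm]⟩)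
  refine ⟨m, n, ?_⟩
  filter_upwards [hm, hn, hmem] with u hmu hnu ⟨m', n', e⟩
  rw [← hmu m' n' e, ← hnu n' m' (by rw [e, add_comm])]
  exact e

/-- The real linear automorphism of `ℂ` that maps one pair of periods to another one. -/
lemma exists_periods_equiv {ω₁ ω₂ η₁ η₂ : ℂ} (h : LinearIndependent ℝ ![ω₁, ω₂])
    (h' : LinearIndependent ℝ ![η₁, η₂]) :
    ∃ ψ : ℂ ≃ₗ[ℝ] ℂ, ψ ω₁ = η₁ ∧ ψ ω₂ = η₂ := by
  let b := basisOfLinearIndependentOfCardEqFinrank h (by simp)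
  let b' := basisOfLinearIndependentOfCardEqFinrank h' (by simp)
  have hb : ⇑b = ![ω₁, ω₂] := coe_basisOfLinearIndependentOfCardEqFinrank h (by simp)
  have hb' : ⇑b' = ![η₁, η₂] := coe_basisOfLinearIndependentOfCardEqFinrank h' (by simp)
  refine ⟨b.equiv b' (Equiv.refl _), ?_, ?_⟩
  · have := b.equiv_apply 0 b' (Equiv.refl _)
    rw [hb, hb'] at this
    exact this
  · have := b.equiv_apply 1 b' (Equiv.refl _)
    rw [hb, hb'] at this
    exact this

/-- The ℝ-linear map that matches the periods is in general not holomorphic, but it is an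
isomorphism of the quotient groups that keeps real coordinates. This is all that matters for
torsion. -/
lemma exists_fiber_equiv {Λ Λ' : AddSubgroup ℂ} {ω₁ ω₂ η₁ η₂ : ℂ}
    (h : LinearIndependent ℝ ![ω₁, ω₂]) (h' : LinearIndependent ℝ ![η₁, η₂])
    (e : Λ = AddSubgroup.closure {ω₁, ω₂}) (e' : Λ' = AddSubgroup.closure {η₁, η₂}) :
    ∃ ψ : (ℂ ⧸ Λ) ≃+ (ℂ ⧸ Λ'), ∀ x y : ℝ,
      ψ ((x * ω₁ + y * ω₂ : ℂ) : ℂ ⧸ Λ) = ((x * η₁ + y * η₂ : ℂ) : ℂ ⧸ Λ') := by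
  obtain ⟨ψ, h1, h2⟩ := exists_periods_equiv h h'
  refine ⟨QuotientAddGroup.congr Λ Λ' ψ.toAddEquiv ?_, fun x y => ?_⟩
  · rw [e, e']
    refine (AddMonoidHom.map_closure _ _).trans ?_
    rw [Set.image_pair]
    exact congrArg₂ (fun a b : ℂ => AddSubgroup.closure {a, b}) h1 h2
  · refine congrArg (fun z : ℂ => (z : ℂ ⧸ Λ')) (?_ : ψ (x * ω₁ + y * ω₂) = _)
    rw [← Complex.real_smul, ← Complex.real_smul, map_add, map_smul, map_smul, h1, h2,
      Complex.real_smul, Complex.real_smul]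

lemma exists_real_combination {ω₁ ω₂ : ℂ} (h : LinearIndependent ℝ ![ω₁, ω₂]) (z : ℂ) :
    ∃ x y : ℝ, z = x * ω₁ + y * ω₂ := by
  have h' := linearIndependent_pair_iff_im.1 h
  refine ⟨periodCoord ω₁ ω₂ z, (starRingEnd ℂ ω₁ * z).im / (starRingEnd ℂ ω₁ * ω₂).im, ?_⟩
  rw [periodCoord]
  simp only [Complex.mul_im, Complex.conj_re, Complex.conj_im] at h' ⊢
  apply Complex.ext
  · simp only [Complex.add_re, Complex.mul_re, Complex.ofReal_re, Complex.ofReal_im, zero_mul,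
      sub_zero]
    rw [div_mul_eq_mul_div, div_mul_eq_mul_div, ← add_div, eq_div_iff h']
    ring
  · simp only [Complex.add_im, Complex.mul_im, Complex.ofReal_re, Complex.ofReal_im, zero_mul,
      add_zero]
    rw [div_mul_eq_mul_div, div_mul_eq_mul_div, ← add_div, eq_div_iff h']
    ring

/-! ### Local triviality of the torsion -/

lemma HolomorphicAt.eventually {n : ℕ} {S : Opens (Fin n → ℂ)} {V : Type*}
    [NormedAddCommGroup V] [NormedSpace ℂ V] [CompleteSpace V] {f : S → V} {s : S}
    (hf : HolomorphicAt f s) : ∀ᶠ u in 𝓝 s, HolomorphicAt f u := by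
  obtain ⟨F, hF, h⟩ := hf
  filter_upwards [continuous_subtype_val.continuousAt.eventually hF.eventually_analyticAt,
    h.eventually_nhds] with u hu hu'
  exact ⟨F, hu, hu'⟩

lemma HolomorphicSectionAt.eventually {X : Family} {σ : ∀ s, X.Fiber s} {s : X.base}
    (hσ : HolomorphicSectionAt σ s) : ∀ᶠ u in 𝓝 s, HolomorphicSectionAt σ u := by
  obtain ⟨z, hz, h⟩ := hσ
  filter_upwards [hz.eventually, h.eventually_nhds] with u hu hu'
  exact ⟨z, hu, hu'⟩

lemma LocallyConstantAt.eventually {X : Family} {t : ∀ u, DoublingPartition (X.Fiber u)}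
    {s : X.base} (ht : LocallyConstantAt t s) : ∀ᶠ u in 𝓝 s, LocallyConstantAt t u := by
  obtain ⟨p, hp, h⟩ := ht
  filter_upwards [h.eventually_nhds, eventually_all.2 fun i => (hp i).eventually] with u hu hu'
  exact ⟨p, hu', hu⟩

/-- Near each point, there are isomorphisms of the fibers with the fiber at the point with respect
to which the torsion sections are the locally constant ones. -/
structure IsTrivialization {X : Family} (s : X.base) (e : ∀ u, X.Fiber u ≃+ X.Fiber s) :
    Prop where
  eventually_eq {N : ℕ} (hN : N ≠ 0) {σ : ∀ u, X.Fiber u} (hσN : ∀ᶠ u in 𝓝 s, N • σ u = 0)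
    (hσ : HolomorphicSectionAt σ s) : ∀ᶠ u in 𝓝 s, e u (σ u) = σ s
  holomorphicSectionAt {σ : ∀ u, X.Fiber u} {x : X.Fiber s}
    (h : ∀ᶠ u in 𝓝 s, e u (σ u) = x) : HolomorphicSectionAt σ s

/-- The fibers are identified by their real coordinates with respect to local periods. Torsion
sections have constant rational coordinates, and conversely constant real coordinates define
holomorphic sections because the periods are holomorphic. -/
lemma exists_trivialization {X : Family} (s : X.base) :
    ∃ e : ∀ u, X.Fiber u ≃+ X.Fiber s, IsTrivialization s e := by
  classical
  obtain ⟨ω₁, ω₂, h₁, h₂, h₃⟩ := X.exists_periods s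
  have hs := h₃.self_of_nhds
  have hall : ∀ u, ∃ ψ : X.Fiber u ≃+ X.Fiber s,
      (LinearIndependent ℝ ![ω₁ u, ω₂ u] ∧
        X.lattice u = AddSubgroup.closure {ω₁ u, ω₂ u}) → ∀ x y : ℝ,
        ψ ((x * ω₁ u + y * ω₂ u : ℂ) : X.Fiber u) = ((x * ω₁ s + y * ω₂ s : ℂ) : X.Fiber s) := by
    intro u
    by_cases hu : LinearIndependent ℝ ![ω₁ u, ω₂ u] ∧
        X.lattice u = AddSubgroup.closure {ω₁ u, ω₂ u}
    · obtain ⟨ψ, hψ⟩ := exists_fiber_equiv hu.1 hs.1 hu.2 hs.2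
      exact ⟨ψ, fun _ => hψ⟩
    · obtain ⟨η₁, η₂, -, -, h'⟩ := X.exists_periods u
      obtain ⟨ψ, -⟩ := exists_fiber_equiv h'.self_of_nhds.1 hs.1 h'.self_of_nhds.2 hs.2
      exact ⟨ψ, fun h => absurd h hu⟩
  choose e he using hall
  refine ⟨e, ⟨?_, ?_⟩⟩
  · intro N hN σ hσN ⟨z, hz, hσz⟩
    -- The function `N z` takes values in the lattices, so its integral coordinates are locally
    -- constant; dividing by `N` gives constant coordinates of `z`.
    obtain ⟨m, n, hmn⟩ := eventually_eq_int_combination (z := fun u => (N : ℂ) * z u)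
      h₁.continuousAt h₂.continuousAt
      (continuousAt_const.mul hz.continuousAt) (h₃.mono fun _ h => h.1) (by
        filter_upwards [h₃, hσN, hσz] with u hu hu' hu''
        rw [← hu.2]
        rw [hu'', ← QuotientAddGroup.mk_nsmul, QuotientAddGroup.eq_zero_iff] at hu'
        simpa using hu')
    have hN' : (N : ℂ) ≠ 0 := by exact_mod_cast hN
    have hz' : ∀ᶠ u in 𝓝 s, z u = ((m / N : ℝ) : ℂ) * ω₁ u + ((n / N : ℝ) : ℂ) * ω₂ u := by
      filter_upwards [hmn] with u hu
      push_cast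
      field_simp
      rw [mul_comm]
      exact hu
    filter_upwards [hz', h₃, hσz] with u hu hu' hu''
    rw [hu'', hu, he u hu', hσz.self_of_nhds, hz'.self_of_nhds]
  · intro σ x h
    obtain ⟨z, rfl⟩ := QuotientAddGroup.mk_surjective x
    obtain ⟨x, y, rfl⟩ := exists_real_combination hs.1 z
    refine ⟨fun u => (x : ℂ) * ω₁ u + (y : ℂ) * ω₂ u,
      ((holomorphicAt_const _ s).mul h₁).add ((holomorphicAt_const _ s).mul h₂), ?_⟩
    filter_upwards [h, h₃] with u hu hu'
    apply (e u).injective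
    rw [hu, he u hu']


/-! ## Translations act simply transitively on partitions of the doubling map -/

section Partitions

variable {A B : Type} [AddCommGroup A] [AddCommGroup B]

/-- The group of two-torsion points is a Klein four-group, and `A` is divisible by two. -/
structure FullTwoTorsion (A : Type) [AddCommGroup A] : Prop where
  exists_basis : ∃ a b : A, 2 • a = 0 ∧ 2 • b = 0 ∧ a ≠ 0 ∧ b ≠ 0 ∧ a ≠ b ∧
    ∀ x : A, 2 • x = 0 → x = 0 ∨ x = a ∨ x = b ∨ x = a + b
  divisible (x : A) : ∃ y : A, 2 • y = x

lemma add_self_eq_zero_of_two_nsmul {a : A} (h : 2 • a = 0) : a + a = 0 := by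
  rw [← two_nsmul, h]

/-- Any two of the three nonzero elements form a basis, so the basis may be adapted to `b`. -/
lemma FullTwoTorsion.exists_complement (h : FullTwoTorsion A) {b : A} (hb : 2 • b = 0)
    (hb0 : b ≠ 0) : ∃ c : A, 2 • c = 0 ∧ c ≠ 0 ∧ c ≠ b ∧
      ∀ x : A, 2 • x = 0 → x = 0 ∨ x = b ∨ x = c ∨ x = b + c := by
  obtain ⟨a, c, ha, hc, ha0, hc0, hac, hall⟩ := h.exists_basis
  have ha' := add_self_eq_zero_of_two_nsmul ha
  have hc' := add_self_eq_zero_of_two_nsmul hc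
  rcases hall b hb with rfl | rfl | rfl | rfl
  · exact absurd rfl hb0
  · exact ⟨c, hc, hc0, hac.symm, hall⟩
  · refine ⟨a, ha, ha0, hac, fun x hx => ?_⟩
    rcases hall x hx with h | h | h | h
    · exact Or.inl h
    · exact Or.inr (Or.inr (Or.inl h))
    · exact Or.inr (Or.inl h)
    · exact Or.inr (Or.inr (Or.inr (h.trans (add_comm _ _))))
  · refine ⟨a, ha, ha0, fun e => hc0 (left_eq_add.1 e), fun x hx => ?_⟩
    rcases hall x hx with h | h | h | h
    · exact Or.inl h
    · exact Or.inr (Or.inr (Or.inl h))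
    · refine Or.inr (Or.inr (Or.inr ?_))
      rw [h, add_comm a c, add_assoc, ha', add_zero]
    · exact Or.inr (Or.inl h)

lemma SignClass.mk_eq_iff {x y : ExactOrder A 4} :
    SignClass.mk x = SignClass.mk y ↔ (x : A) = y ∨ (x : A) = -y := Quotient.eq (r := signSetoid A)

lemma exactOrder_two_iff {x : A} : addOrderOf x = 2 ↔ 2 • x = 0 ∧ x ≠ 0 := by
  rw [addOrderOf_eq_prime_iff]

lemma ExactOrder.two_nsmul_eq_zero (b : ExactOrder A 2) : 2 • (b : A) = 0 :=
  (exactOrder_two_iff.1 b.2).1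

lemma ExactOrder.ne_zero_of_two (b : ExactOrder A 2) : (b : A) ≠ 0 := (exactOrder_two_iff.1 b.2).2

lemma doubling_translate (a : A) (ha : 2 • a = 0) (x : SignClass A) :
    doubling (SignClass.translate a ha x) = doubling x := by
  induction x using Quotient.ind
  apply Subtype.ext
  change 2 • (a + _) = 2 • _
  rw [smul_add, ha, zero_add]

lemma SignClass.translate_self (a : A) (ha : 2 • a = 0) (x : SignClass A) :
    SignClass.translate a ha (SignClass.translate a ha x) = x := by
  have h0 := add_self_eq_zero_of_two_nsmul ha
  induction x using Quotient.ind
  exact congrArg SignClass.mk (Subtype.ext (by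
    change a + (a + _) = _
    rw [← add_assoc, h0, zero_add]))

lemma SignClass.exists_translate {x y : SignClass A} (h : doubling x = doubling y) :
    ∃ (a : A) (ha : 2 • a = 0), y = SignClass.translate a ha x := by
  induction x using Quotient.ind with | _ x => ?_
  induction y using Quotient.ind with | _ y => ?_
  have h' : 2 • (x : A) = 2 • (y : A) := congrArg Subtype.val h
  refine ⟨y - x, by rw [smul_sub, h', sub_self], ?_⟩
  exact congrArg SignClass.mk (Subtype.ext (sub_add_cancel _ _).symm)

/-- The class of x is {x, -x}, and a + x = -x means a = -2x, which is 2x since 4x = 0. -/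
lemma SignClass.translate_eq_self_iff {a : A} (ha : 2 • a = 0) {x : SignClass A} :
    SignClass.translate a ha x = x ↔ a = 0 ∨ a = doubling x := by
  induction x using Quotient.ind with | _ x => ?_
  refine (SignClass.mk_eq_iff (x := ExactOrder.translate a ha x) (y := x)).trans ?_
  refine or_congr add_eq_right ?_
  change a + (x : A) = -x ↔ a = 2 • (x : A)
  have h4 := (addOrderOf_eq_four_iff.1 x.2).1
  generalize (x : A) = y at h4 ⊢
  have h4' : y + y = -(y + y) := by
    rw [eq_neg_iff_add_eq_zero, ← two_nsmul, ← two_nsmul, smul_smul]; exact h4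
  rw [two_nsmul, h4', neg_add, ← sub_eq_add_neg, eq_sub_iff_add_eq]

lemma doubling_surjective (h : FullTwoTorsion A) (b : ExactOrder A 2) :
    ∃ x : SignClass A, doubling x = b := by
  obtain ⟨y, hy⟩ := h.divisible b
  refine ⟨SignClass.mk ⟨y, addOrderOf_eq_four_iff.2 ⟨?_, ?_⟩⟩, Subtype.ext hy⟩
  · rw [show 4 = 2 * 2 from rfl, mul_smul, hy, b.two_nsmul_eq_zero]
  · rw [hy]; exact b.ne_zero_of_two

/-- The fibers of the doubling map have at most two elements. -/
lemma eq_of_doubling_eq (h : FullTwoTorsion A) {x y z : SignClass A}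
    (hxy : doubling x = doubling y) (hxz : doubling x = doubling z) (hy : y ≠ x) (hz : z ≠ x) :
    y = z := by
  obtain ⟨a, ha, rfl⟩ := SignClass.exists_translate hxy
  obtain ⟨b, hb, rfl⟩ := SignClass.exists_translate hxz
  rw [Ne, SignClass.translate_eq_self_iff, not_or] at hy hz
  -- Both `y` and `z` are translates of `x` by points other than 0 and 2x. The only such points are
  -- c and 2x + c, and they have the same effect since translation by 2x fixes the class `x`.
  obtain ⟨c, hc, -, -, hall⟩ := h.exists_complement (doubling x).two_nsmul_eq_zero
    (doubling x).ne_zero_of_two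
  have hd := SignClass.translate_eq_self_iff (doubling x).two_nsmul_eq_zero (x := x)
  have hd' := hd.2 (Or.inr rfl)
  have hcc := SignClass.translate_translate c (doubling x : A) hc
    (doubling x).two_nsmul_eq_zero (by rw [smul_add, hc, (doubling x).two_nsmul_eq_zero, add_zero]) x
  rw [hd'] at hcc
  have key : ∀ a, ∀ ha : 2 • a = 0, ¬a = 0 → ¬a = (doubling x : A) →
      SignClass.translate a ha x = SignClass.translate c hc x := by
    intro a ha h0 h1
    rcases hall a ha with h | h | h | h
    · exact absurd h h0
    · exact absurd h h1
    · subst h; rfl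
    · rw [hcc]
      subst h
      congr 1
      exact add_comm _ _
  rw [key a ha hy.1 hy.2, key b hb hz.1 hz.2]

/-- A set of sign classes that contains exactly one element of each fiber of the doubling map. -/
def IsHalf (P : Set (SignClass A)) : Prop := Set.BijOn doubling P Set.univ

/-- Each fiber of the doubling map has exactly two elements, so the complement of a half is again a
half. -/
lemma isDoublingPartition_iff (h : FullTwoTorsion A) {t : Set (Set (SignClass A))} :
    IsDoublingPartition t ↔ ∃ P, IsHalf P ∧ t = {P, Pᶜ} := by
  constructor
  · rintro ⟨P, Q, rfl, hd, hu, hP, -⟩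
    refine ⟨P, hP, ?_⟩
    rw [(IsCompl.of_eq (disjoint_iff.1 hd) hu).compl_eq]
  · rintro ⟨P, hP, rfl⟩
    refine ⟨P, Pᶜ, rfl, disjoint_compl_right, Set.union_compl_self P, hP, ?_⟩
    refine ⟨fun _ _ => trivial, fun x hx y hy e => ?_, fun b _ => ?_⟩
    · obtain ⟨z, hz, hzx⟩ := hP.surjOn (Set.mem_univ (doubling x))
      exact eq_of_doubling_eq h hzx (hzx.trans e) (fun e => hx (e ▸ hz)) (fun e => hy (e ▸ hz))
    · obtain ⟨z, hz, rfl⟩ := hP.surjOn (Set.mem_univ b)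
      obtain ⟨c, hc, hc0, hcb, -⟩ := h.exists_complement (doubling z).two_nsmul_eq_zero
        (doubling z).ne_zero_of_two
      refine ⟨SignClass.translate c hc z, fun hm => ?_, doubling_translate c hc z⟩
      have := hP.injOn hm hz (doubling_translate c hc z)
      rcases (SignClass.translate_eq_self_iff hc).1 this with h | h
      · exact hc0 h
      · exact hcb h

lemma IsDoublingPartition.isHalf {t : Set (Set (SignClass A))} (ht : IsDoublingPartition t)
    {P : Set (SignClass A)} (hP : P ∈ t) : IsHalf P ∧ t = {P, Pᶜ} := by
  obtain ⟨P₁, P₂, rfl, hd, hu, h1, h2⟩ := ht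
  have hc : P₁ᶜ = P₂ := (IsCompl.of_eq (disjoint_iff.1 hd) hu).compl_eq
  rcases hP with rfl | hP
  · exact ⟨h1, by rw [hc]⟩
  · obtain rfl : P = P₂ := hP
    refine ⟨h2, ?_⟩
    rw [← hc, compl_compl, Set.pair_comm]

lemma DoublingPartition.exists_mem (t : DoublingPartition A) : ∃ P, P ∈ t.1 := by
  obtain ⟨P, Q, h, -⟩ := t.2
  exact ⟨P, by rw [h]; exact Or.inl rfl⟩

/-- Two partitions of the doubling map with a common part are equal. -/
lemma DoublingPartition.ext_of_mem {t t' : DoublingPartition A} {P : Set (SignClass A)}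
    (h : P ∈ t.1) (h' : P ∈ t'.1) : t = t' :=
  Subtype.ext ((t.2.isHalf h).2.trans (t'.2.isHalf h').2.symm)

lemma DoublingPartition.nonempty (h : FullTwoTorsion A) : Nonempty (DoublingPartition A) := by
  choose q hq using doubling_surjective h
  refine ⟨⟨_, (isDoublingPartition_iff h).2 ⟨Set.range q, ⟨fun _ _ => trivial, ?_, ?_⟩, rfl⟩⟩⟩
  · rintro _ ⟨b, rfl⟩ _ ⟨b', rfl⟩ e
    rw [hq, hq] at e
    rw [e]
  · intro b _
    exact ⟨q b, ⟨b, rfl⟩, hq b⟩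

lemma IsHalf.mem_translate_iff {P : Set (SignClass A)} {a : A} (ha : 2 • a = 0)
    {x : SignClass A} :
    x ∈ SignClass.translate a ha '' P ↔ SignClass.translate a ha x ∈ P := by
  constructor
  · rintro ⟨y, hy, rfl⟩
    rwa [SignClass.translate_self]
  · intro hx
    exact ⟨_, hx, SignClass.translate_self a ha x⟩

/-- Doubling is injective on each of the two parts, so distinct classes over one point are separated
by the partition. -/
lemma IsDoublingPartition.mem_iff_notMem {t : Set (Set (SignClass A))}
    (ht : IsDoublingPartition t) {P : Set (SignClass A)} (hP : P ∈ t) {x y : SignClass A}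
    (hxy : doubling x = doubling y) (hne : x ≠ y) : x ∈ P ↔ y ∉ P := by
  obtain ⟨P₁, P₂, rfl, hd, hu, h1, h2⟩ := ht
  have hc : P₁ᶜ = P₂ := (IsCompl.of_eq (disjoint_iff.1 hd) hu).compl_eq
  subst hc
  have key : x ∈ P₁ ↔ y ∉ P₁ :=
    ⟨fun hx hy => hne (h1.injOn hx hy hxy),
      fun hy => by_contra fun hx => hne (h2.injOn hx hy hxy)⟩
  rcases hP with rfl | hP
  · exact key
  · obtain rfl : P = P₁ᶜ := hP
    exact not_congr key

/-- A translate of a half of a partition agrees with it exactly over zero and the translating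
point. -/
lemma IsDoublingPartition.mem_translate_iff {t : Set (Set (SignClass A))}
    (ht : IsDoublingPartition t) {P : Set (SignClass A)} (hP : P ∈ t) {a : A} (ha : 2 • a = 0)
    {x : SignClass A} :
    x ∈ SignClass.translate a ha '' P ↔ ((a = 0 ∨ a = doubling x) ↔ x ∈ P) := by
  rw [IsHalf.mem_translate_iff]
  by_cases h : a = 0 ∨ a = doubling x
  · rw [(SignClass.translate_eq_self_iff ha).2 h]
    simp [h]
  · have hne : SignClass.translate a ha x ≠ x := fun e =>
      h ((SignClass.translate_eq_self_iff ha).1 e)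
    rw [ht.mem_iff_notMem hP (doubling_translate a ha x) hne]
    simp [h]

/-- For a ≠ 0, translation by `a` keeps a half `P` over `a` and reverses it over another point of
order two. The translate is then neither the complement of `P` nor `P` itself. -/
lemma DoublingPartition.translate_eq_self (h : FullTwoTorsion A) {t : DoublingPartition A} {a : A}
    {ha : 2 • a = 0} (e : t.translate a ha = t) : a = 0 := by
  by_contra h0
  obtain ⟨P, hP⟩ := t.exists_mem
  have hP' : SignClass.translate a ha '' P ∈ t.1 := by
    rw [← e]; exact ⟨P, hP, rfl⟩
  obtain ⟨x, hx⟩ := doubling_surjective h ⟨a, exactOrder_two_iff.2 ⟨ha, h0⟩⟩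
  obtain ⟨c, hc, hc0, hca, -⟩ := h.exists_complement ha h0
  obtain ⟨y, hy⟩ := doubling_surjective h ⟨c, exactOrder_two_iff.2 ⟨hc, hc0⟩⟩
  have hx' := t.2.mem_translate_iff hP ha (x := x)
  have hy' := t.2.mem_translate_iff hP ha (x := y)
  rw [hx] at hx'
  rw [hy] at hy'
  simp only [h0, false_or, true_iff, hca.symm, false_iff] at hx' hy'
  rw [(t.2.isHalf hP).2] at hP'
  rcases hP' with e' | e'
  · rw [e'] at hy'
    exact iff_not_self hy'
  · rw [show _ = _ from e'] at hx'
    exact iff_not_self hx'.symm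

lemma DoublingPartition.translate_translate (a b : A) (ha : 2 • a = 0) (hb : 2 • b = 0)
    (hab : 2 • (a + b) = 0) (t : DoublingPartition A) :
    (t.translate b hb).translate a ha = t.translate (a + b) hab :=
  Subtype.ext (image_image_eq (SignClass.translate_translate a b ha hb hab) _)

lemma DoublingPartition.translate_injective (h : FullTwoTorsion A) {t : DoublingPartition A}
    {a b : A} {ha : 2 • a = 0} {hb : 2 • b = 0} (e : t.translate a ha = t.translate b hb) :
    a = b := by
  have hba : 2 • (b + a) = 0 := by rw [smul_add, ha, hb, add_zero]
  have hb' := add_self_eq_zero_of_two_nsmul hb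
  have hbb : 2 • (b + b) = 0 := by rw [hb', smul_zero]
  have h1 := DoublingPartition.translate_translate b a hb ha hba t
  have h2 := DoublingPartition.translate_translate b b hb hb hbb t
  rw [e, h2] at h1
  have h3 : t.translate (b + b) hbb = t := by
    apply Subtype.ext
    refine image_image_eq_self (fun x => ?_) _
    rw [← SignClass.translate_translate b b hb hb hbb, SignClass.translate_self]
  rw [h3] at h1
  have := DoublingPartition.translate_eq_self h h1.symm
  rw [← hb'] at this
  exact add_left_cancel this

/-- Over each of the three points of order two, `P'` agrees with `P` or is opposite to it. A
translate of `P` by a ≠ 0 agrees with `P` over `a` and is opposite over the two other points. As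
`P'` may be replaced by its complement, the eight patterns reduce to the four translates. -/
lemma DoublingPartition.exists_translate (h : FullTwoTorsion A) (t t' : DoublingPartition A) :
    ∃ (a : A) (ha : 2 • a = 0), t.translate a ha = t' := by
  obtain ⟨P, hP⟩ := t.exists_mem
  obtain ⟨P', hP'⟩ := t'.exists_mem
  suffices hs : ∃ (a : A) (ha : 2 • a = 0), SignClass.translate a ha '' P = P' ∨
      SignClass.translate a ha '' P = P'ᶜ by
    obtain ⟨a, ha, e⟩ := hs
    refine ⟨a, ha, DoublingPartition.ext_of_mem (P := SignClass.translate a ha '' P)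
      ⟨P, hP, rfl⟩ ?_⟩
    rw [(t'.2.isHalf hP').2]
    exact e
  have agree : ∀ b : A, (∀ x, (doubling x : A) = b → (x ∈ P' ↔ x ∈ P)) ∨
      (∀ x, (doubling x : A) = b → (x ∈ P' ↔ x ∉ P)) := by
    intro b
    by_contra hcon
    push Not at hcon
    obtain ⟨⟨x, hx, hx'⟩, ⟨y, hy, hy'⟩⟩ := hcon
    have hxy : doubling x = doubling y := Subtype.ext (hx.trans hy.symm)
    by_cases e : x = y
    · subst e; tauto
    · have h1 := t.2.mem_iff_notMem hP hxy e
      have h2 := t'.2.mem_iff_notMem hP' hxy e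
      tauto
  obtain ⟨a, b, ha, hb, ha0, hb0, hab, hall⟩ := h.exists_basis
  have hab2 : 2 • (a + b) = 0 := by rw [smul_add, ha, hb, add_zero]
  have hab0 : a + b ≠ 0 := fun e => hab (by
    rw [← add_left_cancel_iff (a := a), e, add_self_eq_zero_of_two_nsmul ha])
  have haab : a ≠ a + b := fun e => hb0 (left_eq_add.1 e)
  have hbab : b ≠ a + b := fun e => ha0 (right_eq_add.1 e)
  have hcase : ∀ x : SignClass A, (doubling x : A) = a ∨ (doubling x : A) = b ∨
      (doubling x : A) = a + b := fun x =>
    (hall _ (doubling x).two_nsmul_eq_zero).resolve_left (doubling x).ne_zero_of_two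
  have key : ∀ (v : A) (hv : 2 • v = 0),
      ((∀ x, x ∈ P' ↔ ((v = 0 ∨ v = doubling x) ↔ x ∈ P)) ∨
        (∀ x, x ∈ P' ↔ ¬((v = 0 ∨ v = doubling x) ↔ x ∈ P))) →
      ∃ (a : A) (ha : 2 • a = 0), SignClass.translate a ha '' P = P' ∨
        SignClass.translate a ha '' P = P'ᶜ := by
    intro v hv hor
    refine ⟨v, hv, hor.imp (fun H => ?_) (fun H => ?_)⟩
    · ext x
      rw [t.2.mem_translate_iff hP hv, H]
    · ext x
      rw [t.2.mem_translate_iff hP hv, Set.mem_compl_iff, H, not_not]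
  -- The translating point is 0 for a uniform pattern and otherwise the point whose behaviour
  -- differs from that of the two others. The complement of `P'` is needed when `P'` is opposite to
  -- `P` over that point, or everywhere.
  rcases agree a with h1 | h1 <;> rcases agree b with h2 | h2 <;>
    rcases agree (a + b) with h3 | h3
  · refine key 0 (smul_zero 2) (Or.inl fun x => ?_)
    rcases hcase x with e | e | e
    · simp [h1 x e]
    · simp [h2 x e]
    · simp [h3 x e]
  · refine key (a + b) hab2 (Or.inr fun x => ?_)
    rcases hcase x with e | e | e
    · simp [h1 x e, e, hab0, hb0]
    · simp [h2 x e, e, hab0, ha0]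
    · simp [h3 x e, e, hab0]
  · refine key b hb (Or.inr fun x => ?_)
    rcases hcase x with e | e | e
    · simp [h1 x e, e, hb0, hab.symm]
    · simp [h2 x e, e, hb0]
    · simp [h3 x e, e, hb0, ha0]
  · refine key a ha (Or.inl fun x => ?_)
    rcases hcase x with e | e | e
    · simp [h1 x e, e, ha0]
    · simp [h2 x e, e, ha0, hab]
    · simp [h3 x e, e, hb0, ha0]
  · refine key a ha (Or.inr fun x => ?_)
    rcases hcase x with e | e | e
    · simp [h1 x e, e, ha0]
    · simp [h2 x e, e, ha0, hab]
    · simp [h3 x e, e, hb0, ha0]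
  · refine key b hb (Or.inl fun x => ?_)
    rcases hcase x with e | e | e
    · simp [h1 x e, e, hb0, hab.symm]
    · simp [h2 x e, e, hb0]
    · simp [h3 x e, e, hb0, ha0]
  · refine key (a + b) hab2 (Or.inl fun x => ?_)
    rcases hcase x with e | e | e
    · simp [h1 x e, e, hab0, hb0]
    · simp [h2 x e, e, hab0, ha0]
    · simp [h3 x e, e, hab0]
  · refine key 0 (smul_zero 2) (Or.inr fun x => ?_)
    rcases hcase x with e | e | e
    · simp [h1 x e]
    · simp [h2 x e]
    · simp [h3 x e]

/-- A half of a partition has three elements. -/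
lemma IsHalf.exists_range (h : FullTwoTorsion A) {P : Set (SignClass A)} (hP : IsHalf P) :
    ∃ q : Fin 3 → ExactOrder A 4, Set.range (fun i => SignClass.mk (q i)) = P := by
  obtain ⟨a, b, ha, hb, ha0, hb0, hab, hall⟩ := h.exists_basis
  have hab2 : 2 • (a + b) = 0 := by rw [smul_add, ha, hb, add_zero]
  have hab0 : a + b ≠ 0 := fun e => hab (by
    rw [← add_left_cancel_iff (a := a), e, add_self_eq_zero_of_two_nsmul ha])
  let r : Fin 3 → ExactOrder A 2 := ![⟨a, exactOrder_two_iff.2 ⟨ha, ha0⟩⟩,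
    ⟨b, exactOrder_two_iff.2 ⟨hb, hb0⟩⟩, ⟨a + b, exactOrder_two_iff.2 ⟨hab2, hab0⟩⟩]
  have hr : ∀ c : ExactOrder A 2, ∃ i, r i = c := by
    intro c
    rcases (hall _ c.two_nsmul_eq_zero).resolve_left c.ne_zero_of_two with e | e | e
    · exact ⟨0, Subtype.ext e.symm⟩
    · exact ⟨1, Subtype.ext e.symm⟩
    · exact ⟨2, Subtype.ext e.symm⟩
  choose x hxP hx using fun i => hP.surjOn (Set.mem_univ (r i))
  choose q hq using fun i => Quotient.exists_rep (x i)
  have hq' : ∀ i, SignClass.mk (q i) = x i := hq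
  refine ⟨q, Set.ext fun y => ⟨?_, fun hy => ?_⟩⟩
  · rintro ⟨i, rfl⟩
    change SignClass.mk (q i) ∈ P
    rw [hq']; exact hxP i
  · obtain ⟨i, hi⟩ := hr (doubling y)
    refine ⟨i, ?_⟩
    change SignClass.mk (q i) = y
    rw [hq']
    exact hP.injOn (hxP i) hy ((hx i).trans hi)

lemma DoublingPartition.map_translate (e : A ≃+ B) (t : DoublingPartition A) {a : A}
    (ha : 2 • a = 0) (ha' : 2 • e a = 0) :
    (t.translate a ha).map e = (t.map e).translate (e a) ha' := by
  apply Subtype.ext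
  refine (image_image_eq (h := fun x => SignClass.map e (SignClass.translate a ha x))
    (fun x => rfl) _).trans (image_image_eq (fun x => ?_) _).symm
  induction x using Quotient.ind with | _ x => ?_
  exact congrArg SignClass.mk (Subtype.ext (map_add e a x.1).symm)

end Partitions

/-! ### Two-torsion of complex tori -/

/-- In real coordinates the quotient is (ℝ/ℤ)². If z is a half of a lattice point, the parities of
the two integral coordinates of 2z decide which of the four half-periods it represents. -/
lemma fullTwoTorsion_of_periods {Λ : AddSubgroup ℂ} {ω₁ ω₂ : ℂ}
    (h : LinearIndependent ℝ ![ω₁, ω₂]) (e : Λ = AddSubgroup.closure {ω₁, ω₂}) :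
    FullTwoTorsion (ℂ ⧸ Λ) := by
  have hmem : ∀ z, z ∈ Λ ↔ ∃ m n : ℤ, z = m * ω₁ + n * ω₂ := fun z => by
    rw [e, mem_closure_periods]
  have hint : ∀ x y : ℝ, (x * ω₁ + y * ω₂ : ℂ) ∈ Λ → (∃ m : ℤ, x = m) ∧ ∃ n : ℤ, y = n := by
    intro x y hxy
    obtain ⟨m, n, hmn⟩ := (hmem _).1 hxy
    refine ⟨⟨m, ?_⟩, ⟨n, ?_⟩⟩
    · rw [← periodCoord_combination h x y, hmn]
      exact_mod_cast periodCoord_combination h m n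
    · rw [← periodCoord_combination (linearIndependent_pair_swap h) y x, add_comm, hmn, add_comm]
      exact_mod_cast periodCoord_combination (linearIndependent_pair_swap h) n m
  have half : ∀ n : ℤ, (1 / 2 : ℝ) ≠ n := by
    intro n hn
    have : (1 : ℝ) = 2 * n := by linarith
    have : (1 : ℤ) = 2 * n := by exact_mod_cast this
    omega
  refine ⟨⟨((1 / 2 * ω₁ : ℂ) : ℂ ⧸ Λ), ((1 / 2 * ω₂ : ℂ) : ℂ ⧸ Λ), ?_, ?_, ?_, ?_, ?_, ?_⟩, ?_⟩
  · rw [← QuotientAddGroup.mk_nsmul, QuotientAddGroup.eq_zero_iff, hmem]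
    exact ⟨1, 0, by push_cast; ring⟩
  · rw [← QuotientAddGroup.mk_nsmul, QuotientAddGroup.eq_zero_iff, hmem]
    exact ⟨0, 1, by push_cast; ring⟩
  · rw [Ne, QuotientAddGroup.eq_zero_iff]
    intro hz
    obtain ⟨⟨m, hm⟩, -⟩ := hint (1 / 2) 0 (by push_cast; simpa using hz)
    exact half m hm
  · rw [Ne, QuotientAddGroup.eq_zero_iff]
    intro hz
    obtain ⟨-, ⟨m, hm⟩⟩ := hint 0 (1 / 2) (by push_cast; simpa using hz)
    exact half m hm
  · rw [Ne, QuotientAddGroup.eq]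
    intro hz
    obtain ⟨-, ⟨m, hm⟩⟩ := hint (-(1 / 2)) (1 / 2) (by push_cast; simpa using hz)
    exact half m hm
  · intro x hx
    obtain ⟨z, rfl⟩ := QuotientAddGroup.mk_surjective x
    rw [← QuotientAddGroup.mk_nsmul, QuotientAddGroup.eq_zero_iff, hmem] at hx
    obtain ⟨m, n, hmn⟩ := hx
    have hz : z = m / 2 * ω₁ + n / 2 * ω₂ := by
      rw [two_nsmul] at hmn
      linear_combination hmn / 2
    have hgen : ∀ (w : ℂ) (k l : ℤ), z - w = k * ω₁ + l * ω₂ → (z : ℂ ⧸ Λ) = (w : ℂ ⧸ Λ) := by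
      intro w k l hkl
      rw [eq_comm, QuotientAddGroup.eq, hmem]
      exact ⟨k, l, by rw [← hkl]; ring⟩
    obtain ⟨k, hk | hk⟩ := Int.even_or_odd' m <;> obtain ⟨l, hl | hl⟩ := Int.even_or_odd' n <;>
      subst hk <;> subst hl <;> push_cast at hz
    · exact Or.inl (hgen 0 k l (by rw [hz]; ring))
    · exact Or.inr (Or.inr (Or.inl (hgen _ k l (by rw [hz]; ring))))
    · exact Or.inr (Or.inl (hgen _ k l (by rw [hz]; ring)))
    · exact Or.inr (Or.inr (Or.inr (hgen (1 / 2 * ω₁ + 1 / 2 * ω₂) k l (by rw [hz]; ring))))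
  · intro x
    obtain ⟨z, rfl⟩ := QuotientAddGroup.mk_surjective x
    refine ⟨((z / 2 : ℂ) : ℂ ⧸ Λ), ?_⟩
    rw [← QuotientAddGroup.mk_nsmul]
    congr 1
    rw [two_nsmul]; ring

lemma Family.fullTwoTorsion (X : Family) (s : X.base) : FullTwoTorsion (X.Fiber s) := by
  obtain ⟨ω₁, ω₂, -, -, h⟩ := X.exists_periods s
  exact fullTwoTorsion_of_periods h.self_of_nhds.1 h.self_of_nhds.2


/-! ## The canonical torsor is a torsor -/

/-- The sections that represent a part are four-torsion, hence constant in the trivialization, and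
one part determines the partition. -/
lemma LocallyConstantAt.eventually_map_eq {X : Family} {s : X.base}
    {e : ∀ u, X.Fiber u ≃+ X.Fiber s} (he : IsTrivialization s e)
    {t : ∀ u, DoublingPartition (X.Fiber u)} (ht : LocallyConstantAt t s) :
    ∀ᶠ u in 𝓝 s, (t u).map (e u) = t s := by
  obtain ⟨p, hp, h⟩ := ht
  have hp' : ∀ i, ∀ᶠ u in 𝓝 s, e u (p i u) = p i s := fun i =>
    he.eventually_eq (N := 4) (by norm_num)
      (Eventually.of_forall fun u => (addOrderOf_eq_four_iff.1 (p i u).2).1) (hp i)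
  filter_upwards [h, eventually_all.2 hp'] with u hu hpu
  refine DoublingPartition.ext_of_mem (P := Set.range fun i => SignClass.mk (p i s)) ?_
    h.self_of_nhds
  refine ⟨_, hu, ?_⟩
  change SignClass.map (e u) '' _ = _
  rw [← Set.range_comp]
  refine congrArg Set.range (funext fun i => ?_)
  exact congrArg SignClass.mk (Subtype.ext (hpu i))

/-- Three representatives of a part of `t₀`, transported to the other fibers by the trivialization,
are sections that are holomorphic at `s`. -/
lemma IsTrivialization.locallyConstantAt {X : Family} {s : X.base}
    {e : ∀ u, X.Fiber u ≃+ X.Fiber s} (he : IsTrivialization s e)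
    {t : ∀ u, DoublingPartition (X.Fiber u)} {t₀ : DoublingPartition (X.Fiber s)}
    (h : ∀ᶠ u in 𝓝 s, (t u).map (e u) = t₀) : LocallyConstantAt t s := by
  obtain ⟨P, hP⟩ := t₀.exists_mem
  obtain ⟨q, hq⟩ := IsHalf.exists_range (X.fullTwoTorsion s) (t₀.2.isHalf hP).1
  refine ⟨fun i u => ExactOrder.map (e u).symm (q i), fun i => he.holomorphicSectionAt (x := q i)
    (Eventually.of_forall fun u => (e u).apply_symm_apply _), ?_⟩
  filter_upwards [h] with u hu
  rw [← hu] at hP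
  obtain ⟨P', hP', rfl⟩ := hP
  suffices hs : Set.range (fun i => SignClass.mk (ExactOrder.map (e u).symm (q i))) = P' by
    rw [hs]; exact hP'
  apply (SignClass.map_bijective (e u)).1.image_injective
  rw [← Set.range_comp]
  refine Eq.trans ?_ hq
  refine congrArg Set.range (funext fun i => ?_)
  exact congrArg SignClass.mk (Subtype.ext ((e u).apply_symm_apply _))

lemma fiberEquiv_incl (X : Family) (U : Opens (Fin X.dim → ℂ)) (h : U ≤ X.base) (u : U) :
    Family.fiberEquiv (X.incl U h) u = AddEquiv.refl _ := by
  ext x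
  obtain ⟨z, rfl⟩ := QuotientAddGroup.mk_surjective x
  exact congrArg _ (one_mul z)

lemma TorsorSections.pull_incl (X : Family) (U : Opens (Fin X.dim → ℂ)) (h : U ≤ X.base)
    (t : ∀ s, DoublingPartition (X.Fiber s)) (u : U) :
    (t ((X.incl U h).toFun u)).map (Family.fiberEquiv (X.incl U h) u) = t ⟨u, h u.2⟩ := by
  rw [fiberEquiv_incl]
  exact Subtype.ext (image_image_eq_self SignClass.map_id _)

lemma ExactOrder.nonempty_four {A : Type} [AddCommGroup A] (h : FullTwoTorsion A) :
    Nonempty (ExactOrder A 4) := by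
  obtain ⟨a, -, ha, -, ha0, -⟩ := h.exists_basis
  obtain ⟨x, -⟩ := doubling_surjective h ⟨a, exactOrder_two_iff.2 ⟨ha, ha0⟩⟩
  exact ⟨x.out⟩

/-- Only germs at `s` matter, so the representatives over `U` may be continued by arbitrary points
of order four. -/
lemma LocallyConstantAt.of_restrict {X : Family} {U : Opens (Fin X.dim → ℂ)}
    (h : U ≤ X.base) {t : ∀ s, DoublingPartition (X.Fiber s)} {s : U}
    (ht : LocallyConstantAt (X := X.restrict U h) (fun u : U => t ⟨u, h u.2⟩) s) :
    LocallyConstantAt t ⟨s, h s.2⟩ := by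
  classical
  obtain ⟨p, hp, hpt⟩ := ht
  let p' : Fin 3 → ∀ u, ExactOrder (X.Fiber u) 4 := fun i u =>
    if hu : (u : Fin X.dim → ℂ) ∈ U then p i (⟨u, hu⟩ : U)
    else (ExactOrder.nonempty_four (X.fullTwoTorsion u)).some
  have hp' : ∀ i, ∀ u : U, p' i ⟨u, h u.2⟩ = p i u := fun i u => dif_pos u.2
  refine ⟨p', fun i => ?_, ?_⟩
  · refine HolomorphicSectionAt.of_restrict h (s := s)
      (σ := fun u => (p' i u : X.Fiber u)) ?_
    have e : (fun u : U => ((p' i ⟨u, h u.2⟩ : ExactOrder (X.Fiber ⟨u, h u.2⟩) 4) :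
        X.Fiber ⟨u, h u.2⟩)) = fun u => (p i u : (X.restrict U h).Fiber u) :=
      funext fun u => congrArg Subtype.val (hp' i u)
    exact (congrArg (fun τ => HolomorphicSectionAt (X := X.restrict U h) τ s) e).mpr (hp i)
  · apply eventually_of_restrict h s
      (p := fun u : X.base => Set.range (fun i => SignClass.mk (p' i u)) ∈ (t u).1)
    filter_upwards [hpt] with u hu
    have e : (fun i => SignClass.mk (p' i ⟨u, h u.2⟩)) = fun i => SignClass.mk (p i u) :=
      funext fun i => congrArg SignClass.mk (hp' i u)
    rw [e]
    exact hu

lemma DoublingPartition.map_map {A B D : Type} [AddCommGroup A] [AddCommGroup B] [AddCommGroup D]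
    (e : A ≃+ B) (e' : B ≃+ D) (t : DoublingPartition A) :
    (t.map e).map e' = t.map (e.trans e') :=
  Subtype.ext (image_image_eq (SignClass.map_map e e') _)

/-- The glued partition at `s` is read off from the member of the covering chosen for `s`.
Compatibility makes this independent of the choice, and local constancy can be checked on that
member. -/
theorem torsorSections_isSheaf : Presheaf.IsSheaf moduliTopology canonicalTorsor.carrier := by
  rw [isSheaf_iff_isSheaf_of_type]
  intro X R hR x hx
  choose U hU hsU hRU using hR
  let y : ∀ ⦃Y : Family⦄ (g : Y ⟶ X), R g → TorsorSections Y := fun Y g hg => x g hg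
  have hxy : ∀ ⦃Y Z W : Family⦄ (f : Y ⟶ X) (hf : R f) (f' : Z ⟶ X) (hf' : R f') (g : W ⟶ Y)
      (g' : W ⟶ Z), g ≫ f = g' ≫ f' →
        TorsorSections.pull g (y f hf) = TorsorSections.pull g' (y f' hf') :=
    fun Y Z W f hf f' hf' g g' e => hx g g' hf hf' e
  have hx' : ∀ ⦃Y : Family⦄ (g : Y ⟶ X) (hg : R g) (v : Y.base),
      (y g hg).1 v = ((y _ (hRU (g.toFun v))).1 (⟨g.toFun v, hsU _⟩ : U (g.toFun v))).map
        (Family.fiberEquiv g v) := by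
    intro Y g hg v
    have h1 := congrArg Subtype.val
      (hxy g hg _ (hRU (g.toFun v)) (Y.incl (Family.preimage g (U (g.toFun v)))
        (Family.preimage_le g _)) (Family.restrictHom g (U (g.toFun v)) (hU _))
        (Family.restrictHom_comp_incl g _ _).symm)
    have h2 := congrFun h1 (⟨v.1, v.2, hsU (g.toFun v)⟩ : Family.preimage g (U (g.toFun v)))
    exact (TorsorSections.pull_incl Y _ (Family.preimage_le g (U (g.toFun v))) (y g hg).1
      (⟨v.1, v.2, hsU (g.toFun v)⟩ : Family.preimage g (U (g.toFun v)))).symm.trans h2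
  let t : ∀ s, DoublingPartition (X.Fiber s) := fun s => (y _ (hRU s)).1 (⟨s, hsU s⟩ : U s)
  have key : ∀ ⦃Y : Family⦄ (g : Y ⟶ X) (hg : R g) (v : Y.base),
      (t (g.toFun v)).map (Family.fiberEquiv g v) = (y g hg).1 v :=
    fun Y g hg v => (hx' g hg v).symm
  have ht : ∀ s, LocallyConstantAt t s := by
    intro s
    have h1 := (y _ (hRU s)).2 (⟨s, hsU s⟩ : U s)
    refine LocallyConstantAt.of_restrict (hU s) (s := (⟨s, hsU s⟩ : U s)) ?_
    have e : (fun u : U s => t ⟨u, hU s u.2⟩) = (y _ (hRU s)).1 := funext fun u => by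
      rw [← key _ (hRU s) u]
      exact (TorsorSections.pull_incl X _ (hU s) t u).symm
    exact (congrArg (fun τ => LocallyConstantAt (X := X.restrict (U s) (hU s)) τ
      (⟨s, hsU s⟩ : U s)) e).mpr h1
  refine ⟨(⟨t, ht⟩ : TorsorSections X), fun Y g hg => Subtype.ext (funext (key g hg)),
    fun τ hτ => Subtype.ext ?_⟩
  funext s
  have := congrFun (congrArg Subtype.val (hτ _ (hRU s))) (⟨s, hsU s⟩ : U s)
  exact (TorsorSections.pull_incl X _ (hU s) (Subtype.val (p := fun t : ∀ s,
    DoublingPartition (X.Fiber s) => ∀ s, LocallyConstantAt t s) τ)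
    (⟨s, hsU s⟩ : U s)).symm.trans this

/-- On each fiber translation is simply transitive. In a trivialization both partitions are constant
near `s`; by uniqueness so is the translating point, which is therefore holomorphic. -/
theorem canonicalTorsor_isTorsor :
    canonicalTorsor.IsTorsor (A := torsionSheaf 2) where
  isSheaf := torsorSections_isSheaf
  existsUnique_act X t t' := by
    have main : ∀ (X : Family) (t t' : TorsorSections X), ∃! a : torsionSections 2 X,
        TorsorSections.act a t = t' := by
      intro X t t'
      choose a ha hat using fun s =>
        DoublingPartition.exists_translate (X.fullTwoTorsion s) (t.1 s) (t'.1 s)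
      have hol : ∀ s, HolomorphicSectionAt a s := by
        intro s
        obtain ⟨e, he⟩ := exists_trivialization s
        refine he.holomorphicSectionAt (x := a s) ?_
        filter_upwards [(t.2 s).eventually_map_eq he, (t'.2 s).eventually_map_eq he]
          with u hu hu'
        have h2 : 2 • e u (a u) = 0 := by rw [← map_nsmul, ha, map_zero]
        have h3 := DoublingPartition.map_translate (e u) (t.1 u) (ha u) h2
        rw [hat, hu, hu', ← hat s] at h3
        exact (DoublingPartition.translate_injective (X.fullTwoTorsion s) h3).symm
      refine ⟨⟨a, hol, funext ha⟩, Subtype.ext (funext hat), fun b hb => Subtype.ext ?_⟩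
      funext s
      have : (t.1 s).translate (b.1 s) (torsion_apply b s) = (t.1 s).translate (a s) (ha s) := by
        rw [hat, ← hb]; rfl
      exact DoublingPartition.translate_injective (X.fullTwoTorsion s) this
    exact main X.unop t t'
  locally_nonempty X := by
    let R : Sieve X :=
      { arrows := fun Y f => Nonempty (TorsorSections Y)
        downward_closed := fun {Y Z f} ⟨t⟩ g => ⟨TorsorSections.pull g t⟩ }
    refine ⟨R, fun s => ?_, fun Y f hf => hf⟩
    obtain ⟨e, he⟩ := exists_trivialization s
    obtain ⟨t₀⟩ := DoublingPartition.nonempty (X.fullTwoTorsion s)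
    let t : ∀ u, DoublingPartition (X.Fiber u) := fun u => t₀.map (e u).symm
    -- The trivialization at `s` yields local constancy at `s` only; this condition is open, so it
    -- holds on a neighbourhood.
    have ht : LocallyConstantAt t s := he.locallyConstantAt (t₀ := t₀) (by
      refine Eventually.of_forall fun u => ?_
      change (t₀.map (e u).symm).map (e u) = t₀
      rw [DoublingPartition.map_map]
      refine Subtype.ext (image_image_eq_self (fun x => ?_) _)
      rw [AddEquiv.symm_trans_self, SignClass.map_id])
    obtain ⟨V, hV, hVo, hsV⟩ := eventually_nhds_iff.1 ht.eventually
    let U : Opens (Fin X.dim → ℂ) := ⟨Subtype.val '' V, X.base.2.isOpenMap_subtype_val _ hVo⟩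
    have hU : U ≤ X.base := by
      rintro _ ⟨u, -, rfl⟩
      exact u.2
    refine ⟨U, hU, ⟨s, hsV, rfl⟩, ⟨⟨fun u : U => t ⟨u, hU u.2⟩, fun u : U => ?_⟩⟩⟩
    obtain ⟨w, hw, hwu⟩ := u.2
    have h1 := hV w hw
    have hw' : w = ⟨u, hU u.2⟩ := Subtype.ext hwu
    rw [hw'] at h1
    obtain ⟨p, hp, h⟩ := h1
    refine ⟨fun i (u : U) => p i ⟨u, hU u.2⟩, fun i => ?_,
      (continuous_inclusion hU).continuousAt.eventually h⟩
    obtain ⟨z, hz, hzp⟩ := hp i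
    exact ⟨fun u : U => z ⟨u, hU u.2⟩, hz.restrict hU,
      (continuous_inclusion hU).continuousAt.eventually hzp⟩


/-! ## The family over the upper half-plane -/

/-- The upper half-plane. -/
def upperBase : Opens (Fin 1 → ℂ) :=
  ⟨{z | 0 < (z 0).im}, isOpen_lt continuous_const (Complex.continuous_im.comp (continuous_apply 0))⟩

lemma linearIndependent_one_of_im_pos {τ : ℂ} (h : 0 < τ.im) :
    LinearIndependent ℝ ![(1 : ℂ), τ] := by
  rw [linearIndependent_pair_iff_im]
  simpa using h.ne'

lemma holomorphicAt_coord (s : upperBase) :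
    HolomorphicAt (fun u : upperBase => (u : Fin 1 → ℂ) 0) s :=
  ⟨fun u => u 0, (ContinuousLinearMap.proj (R := ℂ) (φ := fun _ : Fin 1 => ℂ) 0).analyticAt _,
    Eventually.of_forall fun _ => rfl⟩

/-- The family of elliptic curves `ℂ / (ℤ + ℤ τ)` over the upper half-plane. -/
def upperFamily : Family where
  dim := 1
  base := upperBase
  lattice := fun s : upperBase => AddSubgroup.closure {1, (s : Fin 1 → ℂ) 0}
  exists_periods := fun s : upperBase => ⟨fun _ => 1, fun u : upperBase => (u : Fin 1 → ℂ) 0,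
    holomorphicAt_const _ _, holomorphicAt_coord s,
    Eventually.of_forall fun u => ⟨linearIndependent_one_of_im_pos u.2, rfl⟩⟩

/-- The coordinate on the upper half-plane. -/
def upperCoord : upperFamily.base → ℂ := fun s : upperBase => (s : Fin 1 → ℂ) 0

lemma upperCoord_im_pos (s : upperFamily.base) : 0 < (upperCoord s).im := s.2

lemma holomorphicAt_upperCoord (s : upperFamily.base) : HolomorphicAt upperCoord s :=
  holomorphicAt_coord s

lemma upperFamily_lattice (s : upperFamily.base) :
    upperFamily.lattice s = AddSubgroup.closure {1, upperCoord s} := rfl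

lemma upperCoord_injective : Function.Injective upperCoord := by
  intro s t h
  apply Subtype.ext
  funext i
  fin_cases i
  exact h

lemma map_unitMul_closure (c : ℂˣ) (ω₁ ω₂ : ℂ) :
    (AddSubgroup.closure {ω₁, ω₂}).map (unitMul c : ℂ →+ ℂ) =
      AddSubgroup.closure {c * ω₁, c * ω₂} := by
  rw [AddMonoidHom.map_closure, Set.image_pair]
  rfl

/-- The morphism to the family over the upper half-plane given by an oriented basis
`c, c τ` of the lattices. -/
def homUpper (X : Family) (τ : X.base → ℂ) (c : X.base → ℂˣ) (him : ∀ s, 0 < (τ s).im)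
    (hτ : ∀ s, HolomorphicAt τ s) (hc : ∀ s, HolomorphicAt (fun u => (c u : ℂ)) s)
    (hl : ∀ s, AddSubgroup.closure {(c s : ℂ), c s * τ s} = X.lattice s) : X ⟶ upperFamily where
  toFun s := (⟨fun _ => τ s, him s⟩ : upperBase)
  factor := c
  holomorphic_toFun s := by
    obtain ⟨F, hF, h⟩ := hτ s
    refine ⟨fun u _ => F u, AnalyticAt.pi fun _ => hF, ?_⟩
    filter_upwards [h] with u hu
    funext _
    exact hu
  holomorphic_factor := hc
  map_lattice s := by
    change (AddSubgroup.closure {1, τ s}).map _ = _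
    rw [map_unitMul_closure, mul_one]
    exact hl s

lemma hom_upper_ext {X : Family} {g g' : X ⟶ upperFamily}
    (h : ∀ s, upperCoord (g.toFun s) = upperCoord (g'.toFun s))
    (h' : ∀ s, (g.factor s : ℂ) = g'.factor s) : g = g' :=
  Family.hom_ext (funext fun s => upperCoord_injective (h s)) (funext fun s => Units.ext (h' s))

lemma lattice_of_hom_upper {X : Family} (g : X ⟶ upperFamily) (s : X.base) :
    X.lattice s = AddSubgroup.closure
      {(g.factor s : ℂ), g.factor s * upperCoord (g.toFun s)} := by
  rw [← g.map_lattice s, upperFamily_lattice, map_unitMul_closure, mul_one]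

lemma holomorphicAt_coord_hom {X : Family} (g : X ⟶ upperFamily) (s : X.base) :
    HolomorphicAt (fun u => upperCoord (g.toFun u)) s :=
  HolomorphicAt.comp_hom g (holomorphicAt_upperCoord _)

lemma HolomorphicAt.div {n : ℕ} {S : Opens (Fin n → ℂ)} {f g : S → ℂ} {s : S}
    (hf : HolomorphicAt f s) (hg : HolomorphicAt g s) (h0 : g s ≠ 0) :
    HolomorphicAt (fun u => f u / g u) s := by
  obtain ⟨F, hF, h⟩ := hf
  obtain ⟨G, hG, h'⟩ := hg
  refine ⟨fun u => F u / G u, hF.div hG (by rwa [← h'.self_of_nhds]), ?_⟩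
  filter_upwards [h, h'] with u hu hu'
  rw [hu, hu']

lemma linearIndependent_smul_pair {c τ : ℂ} (hc : c ≠ 0) (h : 0 < τ.im) :
    LinearIndependent ℝ ![c, c * τ] := by
  rw [linearIndependent_pair_iff_im, ← mul_assoc, mul_comm (starRingEnd ℂ c), Complex.mul_conj,
    Complex.im_ofReal_mul]
  exact mul_ne_zero (by simpa [Complex.normSq_eq_zero] using hc) h.ne'

lemma linearIndependent_of_hom_upper {X : Family} (g : X ⟶ upperFamily) (s : X.base) :
    LinearIndependent ℝ ![(g.factor s : ℂ), g.factor s * upperCoord (g.toFun s)] :=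
  linearIndependent_smul_pair (g.factor s).ne_zero (upperCoord_im_pos _)

lemma exists_open_of_eventually {X : Family} {s : X.base} {p : X.base → Prop}
    (h : ∀ᶠ u in 𝓝 s, p u) : ∃ (U : Opens (Fin X.dim → ℂ)) (hU : U ≤ X.base),
      (s : Fin X.dim → ℂ) ∈ U ∧ ∀ u : U, p ⟨u, hU u.2⟩ := by
  obtain ⟨V, hV, hVo, hsV⟩ := eventually_nhds_iff.1 h
  refine ⟨⟨Subtype.val '' V, X.base.2.isOpenMap_subtype_val _ hVo⟩, ?_, ⟨s, hsV, rfl⟩, ?_⟩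
  · rintro _ ⟨u, -, rfl⟩
    exact u.2
  · rintro ⟨_, u, hu, rfl⟩
    exact hV u hu

/-- Every family is locally a pullback of the family over the upper half-plane. -/
lemma exists_local_hom_upper (X : Family) (s : X.base) :
    ∃ (U : Opens (Fin X.dim → ℂ)) (hU : U ≤ X.base), (s : Fin X.dim → ℂ) ∈ U ∧
      Nonempty (X.restrict U hU ⟶ upperFamily) := by
  -- The periods are exchanged if necessary, so that the quotient ω₂ / ω₁ lies in the upper
  -- half-plane.
  have key : ∃ ω₁ ω₂ : X.base → ℂ, HolomorphicAt ω₁ s ∧ HolomorphicAt ω₂ s ∧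
      0 < (starRingEnd ℂ (ω₁ s) * ω₂ s).im ∧
      ∀ᶠ u : X.base in 𝓝 s, X.lattice u = AddSubgroup.closure {ω₁ u, ω₂ u} := by
    obtain ⟨ω₁, ω₂, h₁, h₂, h₃⟩ := X.exists_periods s
    rcases (linearIndependent_pair_iff_im.1 h₃.self_of_nhds.1).lt_or_gt with h | h
    · refine ⟨ω₂, ω₁, h₂, h₁, ?_, h₃.mono fun u hu => by rw [hu.2, Set.pair_comm]⟩
      simp only [Complex.mul_im, Complex.conj_re, Complex.conj_im] at h ⊢
      linarith
    · exact ⟨ω₁, ω₂, h₁, h₂, h, h₃.mono fun u hu => hu.2⟩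
  obtain ⟨ω₁, ω₂, h₁, h₂, hpos, hl⟩ := key
  have hc : ContinuousAt (fun u => (starRingEnd ℂ (ω₁ u) * ω₂ u).im) s :=
    Complex.continuous_im.continuousAt.comp
      ((Complex.continuous_conj.continuousAt.comp h₁.continuousAt).mul h₂.continuousAt)
  obtain ⟨U, hU, hsU, hp⟩ := exists_open_of_eventually
    (((hl.and h₁.eventually).and h₂.eventually).and (hc.eventually (lt_mem_nhds hpos)))
  refine ⟨U, hU, hsU, ?_⟩
  have h0 : ∀ u : U, ω₁ ⟨u, hU u.2⟩ ≠ 0 := by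
    intro u e
    have := (hp u).2
    rw [e] at this
    simp at this
  exact ⟨homUpper (X.restrict U hU) (fun u : U => ω₂ ⟨u, hU u.2⟩ / ω₁ ⟨u, hU u.2⟩)
    (fun u : U => Units.mk0 (ω₁ ⟨u, hU u.2⟩) (h0 u))
    (fun u : U => by
      have h := (hp u).2
      have h0' := h0 u
      rw [show ω₂ ⟨u, hU u.2⟩ / ω₁ ⟨u, hU u.2⟩ = ((Complex.normSq (ω₁ ⟨u, hU u.2⟩))⁻¹ : ℝ) *
        (starRingEnd ℂ (ω₁ ⟨u, hU u.2⟩) * ω₂ ⟨u, hU u.2⟩) by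
          have hcj : starRingEnd ℂ (ω₁ ⟨u, hU u.2⟩) ≠ 0 := (map_ne_zero _).2 h0'
          rw [Complex.ofReal_inv, ← Complex.mul_conj]
          field_simp, Complex.im_ofReal_mul]
      exact mul_pos (inv_pos.2 (Complex.normSq_pos.2 h0')) h)
    (fun u : U => ((hp u).1.2.restrict hU).div ((hp u).1.1.2.restrict hU) (h0 u))
    (fun u : U => (hp u).1.1.2.restrict hU)
    (fun u : U => by
      rw [Units.val_mk0, mul_div_cancel₀ _ (h0 u)]
      exact (hp u).1.1.1.symm)⟩

lemma upper_cover (X : Family) : ∃ R ∈ moduliTopology X, ∀ ⦃Y : Family⦄ (f : Y ⟶ X), R f →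
    Nonempty (Y ⟶ upperFamily) := by
  let R : Sieve X :=
    { arrows := fun Y f => Nonempty (Y ⟶ upperFamily)
      downward_closed := fun {Y Z f} ⟨t⟩ g => ⟨g ≫ t⟩ }
  refine ⟨R, fun s => ?_, fun Y f hf => hf⟩
  obtain ⟨U, hU, hsU, h⟩ := exists_local_hom_upper X s
  exact ⟨U, hU, hsU, h⟩

/-! ### The action of the modular group -/

lemma modular_denom_ne_zero (γ : Matrix.SpecialLinearGroup (Fin 2) ℤ) {τ : ℂ} (h : 0 < τ.im) :
    (γ 1 0 * τ + γ 1 1 : ℂ) ≠ 0 := by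
  intro e
  have hdet := γ.det_coe
  rw [Matrix.det_fin_two] at hdet
  have him := congrArg Complex.im e
  simp only [Complex.add_im, Complex.mul_im, Complex.intCast_re, Complex.intCast_im, zero_mul,
    add_zero, Complex.zero_im] at him
  have hc : γ 1 0 = 0 := by
    exact_mod_cast (mul_eq_zero.1 him).resolve_right h.ne'
  rw [hc] at e hdet
  have hd : γ 1 1 = 0 := by
    have : ((γ 1 1 : ℤ) : ℂ) = 0 := by simpa using e
    exact_mod_cast this
  rw [hd] at hdet
  simp at hdet

lemma modular_im {a b c d : ℝ} {τ : ℂ} :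
    ((a * τ + b : ℂ) / (c * τ + d)).im =
      (a * d - b * c) * τ.im / Complex.normSq (c * τ + d) := by
  rw [Complex.div_im]
  simp only [Complex.add_im, Complex.add_re, Complex.mul_im, Complex.mul_re, Complex.ofReal_re,
    Complex.ofReal_im, zero_mul, add_zero, sub_zero]
  ring

/-- An integral matrix of determinant one has an integral inverse, so each pair consists of integral
combinations of the other. -/
lemma closure_eq_of_modular (γ : Matrix.SpecialLinearGroup (Fin 2) ℤ) (ω₁ ω₂ : ℂ) :
    AddSubgroup.closure {(γ 1 0 * ω₂ + γ 1 1 * ω₁ : ℂ), γ 0 0 * ω₂ + γ 0 1 * ω₁} =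
      AddSubgroup.closure {ω₁, ω₂} := by
  have hdet := γ.det_coe
  rw [Matrix.det_fin_two] at hdet
  have hdet' : (γ 0 0 * γ 1 1 - γ 0 1 * γ 1 0 : ℂ) = 1 := by exact_mod_cast hdet
  apply le_antisymm
  · rw [AddSubgroup.closure_le]
    rintro z (rfl | rfl)
    · exact mem_closure_periods.2 ⟨γ 1 1, γ 1 0, by ring⟩
    · exact mem_closure_periods.2 ⟨γ 0 1, γ 0 0, by ring⟩
  · rw [AddSubgroup.closure_le]
    rintro z (rfl | rfl)
    · refine mem_closure_periods.2 ⟨γ 0 0, -γ 1 0, ?_⟩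
      push_cast
      linear_combination -z * hdet'
    · refine mem_closure_periods.2 ⟨-γ 0 1, γ 1 1, ?_⟩
      push_cast
      linear_combination -z * hdet'

/-- The endomorphism of the family over the upper half-plane defined by an element of the modular
group. -/
noncomputable def modularHom (γ : Matrix.SpecialLinearGroup (Fin 2) ℤ) :
    upperFamily ⟶ upperFamily :=
  homUpper upperFamily
    (fun s => (γ 0 0 * upperCoord s + γ 0 1) / (γ 1 0 * upperCoord s + γ 1 1))
    (fun s => Units.mk0 _ (modular_denom_ne_zero γ (upperCoord_im_pos s)))
    (fun s => by
      have h0 := modular_denom_ne_zero γ (upperCoord_im_pos s)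
      have hdet := γ.det_coe
      rw [Matrix.det_fin_two] at hdet
      have hdet' : (γ 0 0 * γ 1 1 - γ 0 1 * γ 1 0 : ℝ) = 1 := by exact_mod_cast hdet
      have := modular_im (a := γ 0 0) (b := γ 0 1) (c := γ 1 0) (d := γ 1 1)
        (τ := upperCoord s)
      rw [hdet', one_mul] at this
      have e : ((γ 0 0 * upperCoord s + γ 0 1) / (γ 1 0 * upperCoord s + γ 1 1)).im =
        (upperCoord s).im / Complex.normSq (γ 1 0 * upperCoord s + γ 1 1) := by
          exact_mod_cast this
      rw [e]
      exact div_pos (upperCoord_im_pos s) (Complex.normSq_pos.2 h0))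
    (fun s => (((holomorphicAt_const _ s).mul (holomorphicAt_upperCoord s)).add
        (holomorphicAt_const _ s)).div
      (((holomorphicAt_const _ s).mul (holomorphicAt_upperCoord s)).add
        (holomorphicAt_const _ s)) (modular_denom_ne_zero γ (upperCoord_im_pos s)))
    (fun s => ((holomorphicAt_const _ s).mul (holomorphicAt_upperCoord s)).add
        (holomorphicAt_const _ s))
    (fun s => by
      have h0 := modular_denom_ne_zero γ (upperCoord_im_pos s)
      rw [Units.val_mk0, mul_div_cancel₀ _ h0, upperFamily_lattice,
        ← closure_eq_of_modular γ 1 (upperCoord s), mul_one, mul_one])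

lemma modularHom_coord (γ : Matrix.SpecialLinearGroup (Fin 2) ℤ) (s : upperFamily.base) :
    upperCoord ((modularHom γ).toFun s) =
      (γ 0 0 * upperCoord s + γ 0 1) / (γ 1 0 * upperCoord s + γ 1 1) := rfl

lemma modularHom_factor (γ : Matrix.SpecialLinearGroup (Fin 2) ℤ) (s : upperFamily.base) :
    ((modularHom γ).factor s : ℂ) = γ 1 0 * upperCoord s + γ 1 1 := rfl

lemma modularHom_one : modularHom 1 = 𝟙 upperFamily := by
  refine hom_upper_ext (fun s => ?_) fun s => ?_
  · rw [modularHom_coord]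
    simp
  · rw [modularHom_factor]
    simp

/-- On factors this is the cocycle relation of the automorphy factor cτ + d. Composition is in
diagrammatic order, so pullback of sections is a right action of SL₂(ℤ). -/
lemma modularHom_mul (γ δ : Matrix.SpecialLinearGroup (Fin 2) ℤ) :
    modularHom (γ * δ) = modularHom δ ≫ modularHom γ := by
  refine hom_upper_ext (fun s => ?_) fun s => ?_
  · have h1 := modular_denom_ne_zero δ (upperCoord_im_pos s)
    have h2 := modular_denom_ne_zero γ (upperCoord_im_pos ((modularHom δ).toFun s))
    have h3 := modular_denom_ne_zero (γ * δ) (upperCoord_im_pos s)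
    rw [Family.comp_toFun, modularHom_coord, modularHom_coord]
    rw [div_eq_div_iff h3 h2]
    rw [modularHom_coord] at h2 ⊢
    simp only [Matrix.SpecialLinearGroup.coe_mul, Matrix.mul_apply, Fin.sum_univ_two]
    push_cast
    field_simp
    ring
  · have h1 := modular_denom_ne_zero δ (upperCoord_im_pos s)
    rw [Family.comp_factor, Units.val_mul, modularHom_factor, modularHom_factor, modularHom_factor,
      modularHom_coord]
    simp only [Matrix.SpecialLinearGroup.coe_mul, Matrix.mul_apply, Fin.sum_univ_two]
    push_cast
    field_simp
    ring

/-- Two maps to the upper half-plane differ locally by elements of the modular group. -/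
lemma upper_hom_locally_modular (X : Family) (g g' : X ⟶ upperFamily) (s : X.base) :
    ∃ (U : Opens (Fin X.dim → ℂ)) (hU : U ≤ X.base), (s : Fin X.dim → ℂ) ∈ U ∧
      ∃ γ : Matrix.SpecialLinearGroup (Fin 2) ℤ,
        X.incl U hU ≫ g' = X.incl U hU ≫ g ≫ modularHom γ := by
  have hcont : ∀ g : X ⟶ upperFamily, ContinuousAt (fun u => (g.factor u : ℂ)) s ∧
      ContinuousAt (fun u => (g.factor u : ℂ) * upperCoord (g.toFun u)) s := fun g =>
    ⟨(g.holomorphic_factor s).continuousAt,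
      ((g.holomorphic_factor s).mul (holomorphicAt_coord_hom g s)).continuousAt⟩
  have hmem : ∀ (g g' : X ⟶ upperFamily) (u : X.base),
      (g'.factor u : ℂ) ∈ AddSubgroup.closure
          {(g.factor u : ℂ), g.factor u * upperCoord (g.toFun u)} ∧
        (g'.factor u : ℂ) * upperCoord (g'.toFun u) ∈ AddSubgroup.closure
          {(g.factor u : ℂ), g.factor u * upperCoord (g.toFun u)} := fun g g' u => by
    rw [← lattice_of_hom_upper, lattice_of_hom_upper g']
    exact ⟨AddSubgroup.subset_closure (Or.inl rfl), AddSubgroup.subset_closure (Or.inr rfl)⟩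
  obtain ⟨d, c, h1⟩ := eventually_eq_int_combination (hcont g).1 (hcont g).2 (hcont g').1
    (Eventually.of_forall (linearIndependent_of_hom_upper g))
    (Eventually.of_forall fun u => (hmem g g' u).1)
  obtain ⟨b, a, h2⟩ := eventually_eq_int_combination (hcont g).1 (hcont g).2 (hcont g').2
    (Eventually.of_forall (linearIndependent_of_hom_upper g))
    (Eventually.of_forall fun u => (hmem g g' u).2)
  have e1 := h1.self_of_nhds
  have e2 := h2.self_of_nhds
  have hdenom : ∀ u, (g'.factor u : ℂ) = d * (g.factor u : ℂ) +
      c * ((g.factor u : ℂ) * upperCoord (g.toFun u)) →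
      (g'.factor u : ℂ) = (g.factor u : ℂ) * (c * upperCoord (g.toFun u) + d) := fun u hu => by
    rw [hu]; ring
  have hquot : ∀ u, (g'.factor u : ℂ) = d * (g.factor u : ℂ) +
      c * ((g.factor u : ℂ) * upperCoord (g.toFun u)) →
      (g'.factor u : ℂ) * upperCoord (g'.toFun u) = b * (g.factor u : ℂ) +
      a * ((g.factor u : ℂ) * upperCoord (g.toFun u)) →
      upperCoord (g'.toFun u) =
        (a * upperCoord (g.toFun u) + b) / (c * upperCoord (g.toFun u) + d) := fun u hu hu' => by
    have hf := (g.factor u).ne_zero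
    have hf' := (g'.factor u).ne_zero
    rw [hdenom u hu] at hu' hf'
    rw [eq_div_iff (right_ne_zero_of_mul hf')]
    apply mul_left_cancel₀ hf
    linear_combination hu'
  -- Each of the two bases is an integral combination of the other, so the determinant is ±1; both
  -- bases are positively oriented, which excludes -1.
  have hdet : a * d - b * c = 1 := by
    obtain ⟨p, q, e3⟩ := mem_closure_periods.1 (hmem g' g s).1
    obtain ⟨r, t, e4⟩ := mem_closure_periods.1 (hmem g' g s).2
    rw [e2, e1] at e3 e4
    have li := linearIndependent_of_hom_upper g s
    have c1 := periodCoord_combination li (p * d + q * b) (p * c + q * a)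
    have c2 := periodCoord_combination (linearIndependent_pair_swap li)
      (p * c + q * a) (p * d + q * b)
    have c3 := periodCoord_combination li (r * d + t * b) (r * c + t * a)
    have c4 := periodCoord_combination (linearIndependent_pair_swap li)
      (r * c + t * a) (r * d + t * b)
    have f1 := periodCoord_combination li 1 0
    have f2 := periodCoord_combination (linearIndependent_pair_swap li) 0 1
    have f3 := periodCoord_combination li 0 1
    have f4 := periodCoord_combination (linearIndependent_pair_swap li) 1 0
    push_cast at c1 c2 c3 c4 f1 f2 f3 f4
    have k1 : (p * d + q * b : ℝ) = 1 := by
      rw [← c1, ← f1]; congr 1; linear_combination -e3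
    have k2 : (p * c + q * a : ℝ) = 0 := by
      rw [← c2, ← f2]; congr 1; linear_combination -e3
    have k3 : (r * d + t * b : ℝ) = 0 := by
      rw [← c3, ← f3]; congr 1; linear_combination -e4
    have k4 : (r * c + t * a : ℝ) = 1 := by
      rw [← c4, ← f4]; congr 1; linear_combination -e4
    have k1' : p * d + q * b = 1 := by exact_mod_cast k1
    have k2' : p * c + q * a = 0 := by exact_mod_cast k2
    have k3' : r * d + t * b = 0 := by exact_mod_cast k3
    have k4' : r * c + t * a = 1 := by exact_mod_cast k4
    have hprod : (p * t - q * r) * (a * d - b * c) = 1 := by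
      linear_combination (r * c + t * a) * k1' + k4' - (r * d + t * b) * k2'
    have him := modular_im (a := a) (b := b) (c := c) (d := d) (τ := upperCoord (g.toFun s))
    have hpos : (0 : ℝ) < a * d - b * c := by
      have h := upperCoord_im_pos (g'.toFun s)
      rw [hquot s e1 e2] at h
      have him' : ((a * upperCoord (g.toFun s) + b) / (c * upperCoord (g.toFun s) + d)).im =
        (a * d - b * c) * (upperCoord (g.toFun s)).im /
          Complex.normSq (c * upperCoord (g.toFun s) + d) := by exact_mod_cast him
      rw [him'] at h
      by_contra hneg
      exact absurd h (not_lt.2 (div_nonpos_of_nonpos_of_nonneg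
        (mul_nonpos_of_nonpos_of_nonneg (not_lt.1 hneg) (upperCoord_im_pos _).le)
        (Complex.normSq_nonneg _)))
    have hpos' : 0 < a * d - b * c := by exact_mod_cast hpos
    rcases Int.eq_one_or_neg_one_of_mul_eq_one' hprod with ⟨-, h⟩ | ⟨-, h⟩
    · exact h
    · omega
  obtain ⟨U, hU, hsU, hp⟩ := exists_open_of_eventually (h1.and h2)
  refine ⟨U, hU, hsU, ⟨!![a, b; c, d], by rw [Matrix.det_fin_two_of]; exact hdet⟩, ?_⟩
  refine hom_upper_ext (fun u => ?_) (fun u => ?_)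
  · exact hquot _ (hp u).1 (hp u).2
  · change ((1 * g'.factor _ : ℂˣ) : ℂ) = ((1 * (g.factor _ * (modularHom _).factor _) : ℂˣ) : ℂ)
    rw [one_mul, one_mul, Units.val_mul]
    exact hdenom _ (hp u).1

lemma upper_hom_cover (X : Family) (g g' : X ⟶ upperFamily) :
    ∃ R ∈ moduliTopology X, ∀ ⦃Y : Family⦄ (f : Y ⟶ X), R f →
      ∃ γ ∈ Set.range modularHom, f ≫ g' = f ≫ g ≫ γ := by
  let R : Sieve X :=
    { arrows := fun Y f => ∃ γ ∈ Set.range modularHom, f ≫ g' = f ≫ g ≫ γ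
      downward_closed := by
        rintro Y Z f ⟨γ, hγ, e⟩ k
        exact ⟨γ, hγ, by rw [Category.assoc, e, Category.assoc]⟩ }
  refine ⟨R, fun s => ?_, fun Y f hf => hf⟩
  obtain ⟨U, hU, hsU, γ, h⟩ := upper_hom_locally_modular X g g' s
  exact ⟨U, hU, hsU, modularHom γ, ⟨γ, rfl⟩, h⟩


/-! ## Torsion sections over the upper half-plane -/

/-- Both sections are constant in a trivialization at `s`. The set where they coincide is thus open
and closed. -/
lemma eventually_eq_iff_of_torsion {N : ℕ} (hN : N ≠ 0) {X : Family} {s : X.base}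
    {σ τ : ∀ u, X.Fiber u} (hσ : HolomorphicSectionAt σ s) (hτ : HolomorphicSectionAt τ s)
    (hσN : ∀ u, N • σ u = 0) (hτN : ∀ u, N • τ u = 0) :
    ∀ᶠ u in 𝓝 s, σ u = τ u ↔ σ s = τ s := by
  obtain ⟨e, he⟩ := exists_trivialization s
  filter_upwards [he.eventually_eq hN (Eventually.of_forall hσN) hσ,
    he.eventually_eq hN (Eventually.of_forall hτN) hτ] with u h1 h2
  rw [← h1, ← h2, (e u).injective.eq_iff]

/-- A locally constant predicate on a preconnected space is constant. -/
lemma iff_of_eventually_iff {Y : Type*} [TopologicalSpace Y] [PreconnectedSpace Y] {p : Y → Prop}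
    (h : ∀ s, ∀ᶠ u in 𝓝 s, p u ↔ p s) (s t : Y) : p s ↔ p t := by
  have : IsLocallyConstant p := (IsLocallyConstant.iff_eventually_eq p).2 fun s =>
    (h s).mono fun u hu => propext hu
  exact iff_of_eq (this.apply_eq_of_isPreconnected isPreconnected_univ trivial trivial)

lemma torsionSections_eq_of_apply_eq {N : ℕ} (hN : N ≠ 0) {X : Family} [PreconnectedSpace X.base]
    {σ τ : torsionSections N X} {s : X.base} (h : σ.1 s = τ.1 s) : σ = τ := by
  refine Subtype.ext (funext fun u => ?_)
  exact (iff_of_eventually_iff (p := fun u => σ.1 u = τ.1 u) (fun s =>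
    eventually_eq_iff_of_torsion hN (σ.2.1 s) (τ.2.1 s) (torsion_apply σ) (torsion_apply τ))
    s u).1 h

lemma convex_upperBase : Convex ℝ (upperBase : Set (Fin 1 → ℂ)) := by
  intro x hx y hy a b ha hb hab
  change 0 < ((a • x + b • y) 0).im
  have hx' : 0 < (x 0).im := hx
  have hy' : 0 < (y 0).im := hy
  simp only [Pi.add_apply, Pi.smul_apply, Complex.add_im, Complex.smul_im, smul_eq_mul]
  rcases ha.eq_or_lt with rfl | ha
  · have : b = 1 := by linarith
    subst this
    linarith
  · nlinarith [mul_pos ha hx', mul_nonneg hb hy'.le]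

/-- Convexity supplies both the connectedness used to compare torsion sections and the simple
connectedness used to split cocycles. -/
instance : ContractibleSpace upperFamily.base :=
  convex_upperBase.contractibleSpace ⟨fun _ => Complex.I, by
    change 0 < Complex.I.im
    simp⟩

instance : LocallyPathConnectedSpace upperFamily.base :=
  upperBase.2.locallyPathConnectedSpace

/-- The section `x + y τ` of the family over the upper half-plane. -/
noncomputable def upperSection (x y : ℝ) : ∀ s, upperFamily.Fiber s :=
  fun s => ((x + y * upperCoord s : ℂ) : upperFamily.Fiber s)

lemma holomorphicSectionAt_upperSection (x y : ℝ) (s : upperFamily.base) :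
    HolomorphicSectionAt (upperSection x y) s :=
  ⟨_, (holomorphicAt_const _ s).add ((holomorphicAt_const _ s).mul (holomorphicAt_upperCoord s)),
    Eventually.of_forall fun _ => rfl⟩

lemma upperSection_add (x y x' y' : ℝ) (s : upperFamily.base) :
    upperSection x y s + upperSection x' y' s = upperSection (x + x') (y + y') s := by
  refine congrArg (fun z : ℂ => (z : upperFamily.Fiber s)) ?_
  push_cast; ring

lemma upperSection_nsmul (N : ℕ) (x y : ℝ) (s : upperFamily.base) :
    N • upperSection x y s = upperSection (N * x) (N * y) s := by
  refine congrArg (fun z : ℂ => (z : upperFamily.Fiber s)) ?_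
  beta_reduce
  rw [nsmul_eq_mul]
  push_cast; ring

lemma upperSection_neg (x y : ℝ) (s : upperFamily.base) :
    -upperSection x y s = upperSection (-x) (-y) s := by
  refine congrArg (fun z : ℂ => (z : upperFamily.Fiber s)) ?_
  push_cast; ring

lemma upperSection_eq_zero_iff (x y : ℝ) (s : upperFamily.base) :
    upperSection x y s = 0 ↔ (∃ m : ℤ, x = m) ∧ ∃ n : ℤ, y = n := by
  refine (QuotientAddGroup.eq_zero_iff _).trans ?_
  rw [upperFamily_lattice, mem_closure_periods]
  have li := linearIndependent_one_of_im_pos (upperCoord_im_pos s)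
  constructor
  · rintro ⟨m, n, h⟩
    refine ⟨⟨m, ?_⟩, ⟨n, ?_⟩⟩
    · have h1 := periodCoord_combination li x y
      have h2 := periodCoord_combination li m n
      rw [← h1, ← h2]
      congr 1
      push_cast
      linear_combination h
    · have h1 := periodCoord_combination (linearIndependent_pair_swap li) y x
      have h2 := periodCoord_combination (linearIndependent_pair_swap li) n m
      rw [← h1, ← h2]
      congr 1
      push_cast
      linear_combination h
  · rintro ⟨⟨m, rfl⟩, ⟨n, rfl⟩⟩
    exact ⟨m, n, by push_cast; ring⟩

lemma upperSection_eq_iff (x y x' y' : ℝ) (s : upperFamily.base) :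
    upperSection x y s = upperSection x' y' s ↔
      (∃ m : ℤ, x - x' = m) ∧ ∃ n : ℤ, y - y' = n := by
  rw [← upperSection_eq_zero_iff (x - x') (y - y') s, ← sub_eq_zero, sub_eq_add_neg,
    upperSection_neg, upperSection_add, ← sub_eq_add_neg, ← sub_eq_add_neg]

lemma exists_upperSection (s : upperFamily.base) (x : upperFamily.Fiber s) :
    ∃ a b : ℝ, x = upperSection a b s := by
  obtain ⟨z, rfl⟩ := QuotientAddGroup.mk_surjective x
  obtain ⟨a, b, h⟩ := exists_real_combination
    (linearIndependent_one_of_im_pos (upperCoord_im_pos s)) z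
  exact ⟨a, b, congrArg _ (by rw [h, mul_one])⟩

/-- For γ with rows (a, b) and (c, d), (cτ + d)(x + y(aτ + b)/(cτ + d)) = (dx + by) + (cx + ay)τ:
real coordinates change by a constant integral matrix. -/
lemma pull_upperSection (γ : Matrix.SpecialLinearGroup (Fin 2) ℤ) (x y : ℝ)
    (s : upperFamily.base) :
    Family.fiberEquiv (modularHom γ) s (upperSection x y ((modularHom γ).toFun s)) =
      upperSection (γ 1 1 * x + γ 0 1 * y) (γ 1 0 * x + γ 0 0 * y) s := by
  refine congrArg (fun z : ℂ => (z : upperFamily.Fiber s)) ?_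
  have h0 := modular_denom_ne_zero γ (upperCoord_im_pos s)
  change ((modularHom γ).factor s : ℂ) * (x + y * upperCoord ((modularHom γ).toFun s)) = _
  rw [modularHom_factor, modularHom_coord]
  push_cast
  field_simp
  ring

/-- The two-torsion sections over the upper half-plane. -/
noncomputable def halfPeriod (m n : ℤ) : torsionSections 2 upperFamily :=
  ⟨upperSection (m / 2) (n / 2), holomorphicSectionAt_upperSection _ _, funext fun s => by
    refine (upperSection_nsmul 2 _ _ s).trans ((upperSection_eq_zero_iff _ _ s).2
      ⟨⟨m, ?_⟩, ⟨n, ?_⟩⟩) <;> push_cast <;> ring⟩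

lemma halfPeriod_apply (m n : ℤ) (s : upperFamily.base) :
    (halfPeriod m n).1 s = upperSection (m / 2) (n / 2) s := rfl

lemma exists_half {x : ℝ} {s : upperFamily.base} {y : ℝ}
    (h : 2 • upperSection x y s = 0) : ∃ m n : ℤ, x = m / 2 ∧ y = n / 2 := by
  rw [upperSection_nsmul, upperSection_eq_zero_iff] at h
  obtain ⟨⟨m, hm⟩, ⟨n, hn⟩⟩ := h
  push_cast at hm hn
  exact ⟨m, n, by linarith, by linarith⟩

lemma exists_halfPeriod_apply (s : upperFamily.base) {x : upperFamily.Fiber s} (h : 2 • x = 0) :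
    ∃ m n : ℤ, (halfPeriod m n).1 s = x := by
  obtain ⟨a, b, rfl⟩ := exists_upperSection s x
  obtain ⟨m, n, rfl, rfl⟩ := exists_half h
  exact ⟨m, n, rfl⟩

lemma exists_halfPeriod (σ : torsionSections 2 upperFamily) : ∃ m n : ℤ, σ = halfPeriod m n := by
  let s : upperFamily.base := Classical.arbitrary _
  obtain ⟨m, n, h⟩ := exists_halfPeriod_apply s (torsion_apply σ s)
  exact ⟨m, n, (torsionSections_eq_of_apply_eq two_ne_zero h).symm⟩

lemma halfPeriod_eq_iff {m n m' n' : ℤ} :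
    halfPeriod m n = halfPeriod m' n' ↔ 2 ∣ m - m' ∧ 2 ∣ n - n' := by
  let s : upperFamily.base := Classical.arbitrary _
  have h1 : halfPeriod m n = halfPeriod m' n' ↔ (halfPeriod m n).1 s = (halfPeriod m' n').1 s :=
    ⟨fun h => by rw [h], torsionSections_eq_of_apply_eq two_ne_zero⟩
  have h2 : ∀ a b : ℤ, (∃ k : ℤ, (a / 2 - b / 2 : ℝ) = k) ↔ 2 ∣ a - b := by
    intro a b
    refine exists_congr fun k => ?_
    constructor
    · intro h
      have : (a - b : ℝ) = 2 * k := by linarith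
      exact_mod_cast this
    · intro h
      have : (a - b : ℝ) = 2 * k := by exact_mod_cast h
      linarith
  rw [h1, halfPeriod_apply, halfPeriod_apply, upperSection_eq_iff, h2, h2]

lemma halfPeriod_add (m n m' n' : ℤ) :
    halfPeriod m n + halfPeriod m' n' = halfPeriod (m + m') (n + n') := by
  refine Subtype.ext (funext fun s => ?_)
  refine (upperSection_add _ _ _ _ s).trans ?_
  rw [halfPeriod_apply]
  congr 1 <;> push_cast <;> ring

lemma halfPeriod_pull (γ : Matrix.SpecialLinearGroup (Fin 2) ℤ) (m n : ℤ) :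
    (torsionSheaf 2).obj.map (modularHom γ).op (halfPeriod m n) =
      halfPeriod (γ 1 1 * m + γ 0 1 * n) (γ 1 0 * m + γ 0 0 * n) := by
  refine Subtype.ext (funext fun s => ?_)
  refine (pull_upperSection γ _ _ s).trans ?_
  rw [halfPeriod_apply]
  congr 1 <;> push_cast <;> ring

lemma halfPeriod_zero : halfPeriod 0 0 = 0 := by
  refine Subtype.ext (funext fun s => ?_)
  exact (upperSection_eq_zero_iff _ _ s).2 ⟨⟨0, by simp⟩, ⟨0, by simp⟩⟩

/-! ## The canonical torsor has no global section -/

/-- Two points of order four lie in the same part of a partition. -/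
def SamePart {A : Type} [AddCommGroup A] (t : DoublingPartition A) (p q : ExactOrder A 4) : Prop :=
  ∃ P ∈ t.1, SignClass.mk p ∈ P ∧ SignClass.mk q ∈ P

lemma samePart_map_iff {A B : Type} [AddCommGroup A] [AddCommGroup B] (e : A ≃+ B)
    (t : DoublingPartition A) (p q : ExactOrder A 4) :
    SamePart (t.map e) (ExactOrder.map e p) (ExactOrder.map e q) ↔ SamePart t p q := by
  have hmem : ∀ (x : ExactOrder A 4) (P : Set (SignClass A)),
      SignClass.mk (ExactOrder.map e x) ∈ SignClass.map e '' P ↔ SignClass.mk x ∈ P :=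
    fun x P => (SignClass.map_bijective e).1.mem_set_image (a := SignClass.mk x)
  constructor
  · rintro ⟨_, ⟨P, hP, rfl⟩, h1, h2⟩
    exact ⟨P, hP, (hmem p P).1 h1, (hmem q P).1 h2⟩
  · rintro ⟨P, hP, h1, h2⟩
    exact ⟨_, ⟨P, hP, rfl⟩, (hmem p P).2 h1, (hmem q P).2 h2⟩

/-- Of two distinct points over the same point of order two, exactly one lies in the same part as a
given point. -/
lemma samePart_iff_not {A : Type} [AddCommGroup A] (t : DoublingPartition A)
    (p : ExactOrder A 4) {q q' : ExactOrder A 4} (h : 2 • (q : A) = 2 • (q' : A))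
    (h1 : (q : A) ≠ q') (h2 : (q : A) ≠ -q') : SamePart t p q ↔ ¬SamePart t p q' := by
  obtain ⟨P₁, P₂, ht, hd, hu, -, -⟩ := t.2
  obtain ⟨P, hP, hpP⟩ : ∃ P ∈ t.1, SignClass.mk p ∈ P := by
    have : SignClass.mk p ∈ P₁ ∪ P₂ := by rw [hu]; trivial
    rcases this with h | h
    · exact ⟨P₁, by rw [ht]; exact Or.inl rfl, h⟩
    · exact ⟨P₂, by rw [ht]; exact Or.inr rfl, h⟩
  have key : ∀ x, SamePart t p x ↔ SignClass.mk x ∈ P := by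
    intro x
    refine ⟨?_, fun hx => ⟨P, hP, hpP, hx⟩⟩
    rintro ⟨Q, hQ, hpQ, hxQ⟩
    rw [(t.2.isHalf hP).2] at hQ
    rcases hQ with rfl | hQ
    · exact hxQ
    · rw [show Q = _ from hQ] at hpQ
      exact absurd hpP hpQ
  rw [key, key]
  refine t.2.mem_iff_notMem hP (Subtype.ext h) fun e => ?_
  rcases SignClass.mk_eq_iff.1 e with e | e
  · exact h1 e
  · exact h2 e

lemma samePart_eventually_iff {X : Family} {t : ∀ u, DoublingPartition (X.Fiber u)}
    {p q : ∀ u, ExactOrder (X.Fiber u) 4} {s : X.base} (ht : LocallyConstantAt t s)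
    (hp : HolomorphicSectionAt (fun u => (p u : X.Fiber u)) s)
    (hq : HolomorphicSectionAt (fun u => (q u : X.Fiber u)) s) :
    ∀ᶠ u in 𝓝 s, SamePart (t u) (p u) (q u) ↔ SamePart (t s) (p s) (q s) := by
  obtain ⟨e, he⟩ := exists_trivialization s
  have h4 : ∀ (p : ∀ u, ExactOrder (X.Fiber u) 4) u, 4 • (p u : X.Fiber u) = 0 := fun p u =>
    (addOrderOf_eq_four_iff.1 (p u).2).1
  filter_upwards [ht.eventually_map_eq he,
    he.eventually_eq (N := 4) (by norm_num) (Eventually.of_forall (h4 p)) hp,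
    he.eventually_eq (N := 4) (by norm_num) (Eventually.of_forall (h4 q)) hq] with u h1 h2 h3
  rw [← samePart_map_iff (e u), h1, show ExactOrder.map (e u) (p u) = p s from Subtype.ext h2,
    show ExactOrder.map (e u) (q u) = q s from Subtype.ext h3]

/-- The section `(m + n τ) / 4` of order four. -/
noncomputable def quarterPeriod (m n : ℤ) (h : ¬(2 ∣ m ∧ 2 ∣ n)) (s : upperFamily.base) :
    ExactOrder (upperFamily.Fiber s) 4 :=
  ⟨upperSection (m / 4) (n / 4) s, by
    rw [addOrderOf_eq_four_iff, upperSection_nsmul, upperSection_nsmul, Ne,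
      upperSection_eq_zero_iff, upperSection_eq_zero_iff]
    refine ⟨⟨⟨m, ?_⟩, ⟨n, ?_⟩⟩, ?_⟩
    · push_cast; ring
    · push_cast; ring
    · rintro ⟨⟨k, hk⟩, ⟨l, hl⟩⟩
      refine h ⟨⟨k, ?_⟩, ⟨l, ?_⟩⟩
      · have : (m : ℝ) = 2 * k := by push_cast at hk; linarith
        exact_mod_cast this
      · have : (n : ℝ) = 2 * l := by push_cast at hl; linarith
        exact_mod_cast this⟩

/-- The obstruction is visible on the stabiliser of the cusp: a partition invariant under τ ↦ τ + 1
cannot separate τ/4 from (2 + τ)/4, which have the same double. -/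
lemma canonicalTorsor_no_section :
    ¬∃ t : ∀ X : Family, canonicalTorsor.carrier.obj (op X),
      ∀ ⦃X Y : Family⦄ (f : Y ⟶ X), canonicalTorsor.carrier.map f.op (t X) = t Y := by
  rintro ⟨t', ht'⟩
  let t : TorsorSections upperFamily := t' upperFamily
  have ht : TorsorSections.pull (modularHom ModularGroup.T) t = t :=
    ht' (modularHom ModularGroup.T)
  have hT : ∀ s, (t.1 ((modularHom ModularGroup.T).toFun s)).map
      (Family.fiberEquiv (modularHom ModularGroup.T) s) = t.1 s := fun s =>
    congrFun (congrArg Subtype.val ht) s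
  have h10 : ¬((2 : ℤ) ∣ 1 ∧ (2 : ℤ) ∣ 0) := by decide
  have h01 : ¬((2 : ℤ) ∣ 0 ∧ (2 : ℤ) ∣ 1) := by decide
  have h11 : ¬((2 : ℤ) ∣ 1 ∧ (2 : ℤ) ∣ 1) := by decide
  have h21 : ¬((2 : ℤ) ∣ 2 ∧ (2 : ℤ) ∣ 1) := by decide
  have hhol : ∀ m n h s, HolomorphicSectionAt
      (fun u => (quarterPeriod m n h u : upperFamily.Fiber u)) s := fun m n h s =>
    holomorphicSectionAt_upperSection _ _ s
  have hpull : ∀ m n h h' s, ExactOrder.map (Family.fiberEquiv (modularHom ModularGroup.T) s)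
      (quarterPeriod m n h ((modularHom ModularGroup.T).toFun s)) =
        quarterPeriod (m + n) n h' s := by
    intro m n h h' s
    apply Subtype.ext
    refine (pull_upperSection ModularGroup.T _ _ s).trans ?_
    change upperSection _ _ s = upperSection _ _ s
    congr 1
    · simp [ModularGroup.T]
      ring
    · simp [ModularGroup.T]
  -- Lying in the same part as 1/4 is a locally constant condition, so it may be tested at τ + 1
  -- instead of τ. Invariance of the partition then turns (m + nτ)/4 into (m + n + nτ)/4, while 1/4
  -- stays fixed.
  have hstep : ∀ m n h h' s, SamePart (t.1 s) (quarterPeriod 1 0 h10 s) (quarterPeriod m n h s) ↔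
      SamePart (t.1 s) (quarterPeriod 1 0 h10 s) (quarterPeriod (m + n) n h' s) := by
    intro m n h h' s
    rw [iff_of_eventually_iff (p := fun s => SamePart (t.1 s) (quarterPeriod 1 0 h10 s)
      (quarterPeriod m n h s)) (fun s => samePart_eventually_iff (t.2 s) (hhol 1 0 h10 s)
        (hhol m n h s)) s ((modularHom ModularGroup.T).toFun s),
      ← samePart_map_iff (Family.fiberEquiv (modularHom ModularGroup.T) s), hT,
      hpull 1 0 h10 h10 s, hpull m n h h' s]
    rfl
  let s : upperFamily.base := Classical.arbitrary _
  have h1 := hstep 0 1 h01 h11 s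
  have h2 := hstep 1 1 h11 h21 s
  -- The points τ/4 and (2 + τ)/4 have difference -1/2 and sum (1 + τ)/2. Neither lies in the
  -- lattice, so their classes are distinct, although their doubles agree.
  have h3 := samePart_iff_not (t.1 s) (quarterPeriod 1 0 h10 s)
    (q := quarterPeriod 0 1 h01 s) (q' := quarterPeriod 2 1 h21 s)
    (by
      change 2 • upperSection _ _ s = 2 • upperSection _ _ s
      rw [upperSection_nsmul, upperSection_nsmul, upperSection_eq_iff]
      exact ⟨⟨-1, by push_cast; norm_num⟩, ⟨0, by push_cast; norm_num⟩⟩)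
    (by
      change upperSection _ _ s ≠ upperSection _ _ s
      rw [Ne, upperSection_eq_iff]
      rintro ⟨⟨k, hk⟩, -⟩
      have : (-1 : ℝ) = 2 * k := by push_cast at hk; linarith
      have : (-1 : ℤ) = 2 * k := by exact_mod_cast this
      omega)
    (by
      change upperSection _ _ s ≠ -upperSection _ _ s
      rw [upperSection_neg, Ne, upperSection_eq_iff]
      rintro ⟨⟨k, hk⟩, -⟩
      have : (1 : ℝ) = 2 * k := by push_cast at hk; linarith
      have : (1 : ℤ) = 2 * k := by exact_mod_cast this
      omega)
  exact iff_not_self ((h1.trans h2).symm.trans h3)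


/-! ## Gluing along open coverings -/

/-- The inclusion of the restrictions of a family to two open subsets of the base. -/
def Family.resHom (X : Family) {U W : Opens (Fin X.dim → ℂ)} (hU : U ≤ X.base) (h : W ≤ U) :
    X.restrict W (h.trans hU) ⟶ X.restrict U hU :=
  (X.restrict U hU).incl W h

lemma Family.resHom_comp_incl (X : Family) {U W : Opens (Fin X.dim → ℂ)} (hU : U ≤ X.base)
    (h : W ≤ U) : X.resHom hU h ≫ X.incl U hU = X.incl W (h.trans hU) :=
  Family.hom_ext rfl (funext fun _ => mul_one (1 : ℂˣ))

lemma Family.resHom_comp_resHom (X : Family) {U W V : Opens (Fin X.dim → ℂ)} (hU : U ≤ X.base)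
    (h : W ≤ U) (h' : V ≤ W) :
    X.resHom (h.trans hU) h' ≫ X.resHom hU h = X.resHom hU (h'.trans h) :=
  Family.hom_ext rfl (funext fun _ => mul_one (1 : ℂˣ))

lemma Family.hom_restrict_ext {X Y : Family} {U : Opens (Fin X.dim → ℂ)} {hU : U ≤ X.base}
    {f g : Y ⟶ X.restrict U hU} (h : f ≫ X.incl U hU = g ≫ X.incl U hU) : f = g := by
  refine Family.hom_ext (funext fun y => Subtype.ext ?_) (funext fun y => ?_)
  · have := congrArg (fun k : Y ⟶ X => (k.toFun y).1) h
    exact this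
  · have := congrArg (fun k : Y ⟶ X => k.factor y) h
    exact mul_right_cancel (b := (1 : ℂˣ)) this

lemma Family.exists_local_factor {X Y : Family} {U V : Opens (Fin X.dim → ℂ)} {hU : U ≤ X.base}
    (f : Y ⟶ X.restrict U hU) (h : V ≤ U) (y : Y.base) (hy : (f.toFun y).1 ∈ V) :
    ∃ (N : Opens (Fin Y.dim → ℂ)) (hN : N ≤ Y.base), (y : Fin Y.dim → ℂ) ∈ N ∧
      ∃ m : Y.restrict N hN ⟶ X.restrict V (h.trans hU),
        Y.incl N hN ≫ f = m ≫ X.resHom hU h :=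
  ⟨Family.preimage f V, Family.preimage_le f V, ⟨y.2, hy⟩, Family.restrictHom f V h,
    (Family.restrictHom_comp_incl f V h).symm⟩

/-- A sheaf on the site of families has a section as soon as it has sections over the members of
an open covering of the base that agree near every point. -/
lemma exists_section_of_locally_eq {F : Familyᵒᵖ ⥤ Type} (hF : Presheaf.IsSheaf moduliTopology F)
    {X : Family} (W : X.base → Opens (Fin X.dim → ℂ)) (hW : ∀ s, W s ≤ X.base)
    (hs : ∀ s, (s : Fin X.dim → ℂ) ∈ W s) (q : ∀ s, F.obj (op (X.restrict (W s) (hW s))))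
    (hq : ∀ s t, ∀ x ∈ W s, x ∈ W t → ∃ (V : Opens (Fin X.dim → ℂ)) (h : V ≤ W s) (h' : V ≤ W t),
      x ∈ V ∧ F.map (X.resHom (hW s) h).op (q s) = F.map (X.resHom (hW t) h').op (q t)) :
    Nonempty (F.obj (op X)) := by
  -- The pullbacks of `q s` and `q t` to a family over both members are compared near each point,
  -- where the hypothesis on overlaps applies.
  have key : ∀ (Y : Family) (s t : X.base) (f : Y ⟶ X.restrict (W s) (hW s))
      (g : Y ⟶ X.restrict (W t) (hW t)), f ≫ X.incl _ (hW s) = g ≫ X.incl _ (hW t) →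
      F.map f.op (q s) = F.map g.op (q t) := by
    intro Y s t f g e
    let R : Sieve Y :=
      { arrows := fun Z k => F.map k.op (F.map f.op (q s)) = F.map k.op (F.map g.op (q t))
        downward_closed := fun {Z Z' k} h l => by
          rw [types_map_comp, h, ← types_map_comp] }
    refine sheaf_separated hF (R := R) (fun y => ?_) fun Z k hk => hk
    have hy : (f.toFun y).1 = (g.toFun y).1 := congrArg (fun k : Y ⟶ X => (k.toFun y).1) e
    have hyt : (f.toFun y).1 ∈ W t := by
      rw [hy]
      exact (g.toFun y).2
    obtain ⟨V, h, h', hxV, eV⟩ := hq s t (f.toFun y).1 (f.toFun y).2 hyt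
    obtain ⟨N, hN, hyN, m, e1⟩ := Family.exists_local_factor f h y hxV
    have e2 : Y.incl N hN ≫ g = m ≫ X.resHom (hW t) h' := by
      apply Family.hom_restrict_ext
      rw [Category.assoc, ← e, ← Category.assoc, e1, Category.assoc, Category.assoc,
        X.resHom_comp_incl, X.resHom_comp_incl]
    refine ⟨N, hN, hyN, ?_⟩
    change F.map _ (F.map _ _) = F.map _ (F.map _ _)
    rw [← types_map_comp, ← types_map_comp, e1, e2, types_map_comp, eV, ← types_map_comp]
  let R : Sieve X :=
    { arrows := fun Y f => ∃ s, ∃ f' : Y ⟶ X.restrict (W s) (hW s), f' ≫ X.incl _ (hW s) = f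
      downward_closed := by
        rintro Y Z _ ⟨s, f', rfl⟩ k
        exact ⟨s, k ≫ f', Category.assoc _ _ _⟩ }
  have hR : R ∈ moduliTopology X := fun s =>
    ⟨W s, hW s, hs s, s, 𝟙 _, Category.id_comp _⟩
  obtain ⟨a, -⟩ := sheaf_glue hF hR (fun Y f hf => F.map hf.choose_spec.choose.op (q hf.choose))
    (fun Y Z f hf g => by
      rw [← types_map_comp]
      apply key
      rw [Category.assoc, hf.choose_spec.choose_spec,
        (R.downward_closed hf g).choose_spec.choose_spec])
  exact ⟨a⟩

/-! ## Cocycles on simply connected spaces -/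

/-- Locally constant one-cocycles on a simply connected space are coboundaries. -/
lemma exists_coboundary {B A : Type*} [TopologicalSpace B] [SimplyConnectedSpace B]
    [LocallyPathConnectedSpace B] [AddCommGroup A] (U : B → Set B) (hU : ∀ i, IsOpen (U i))
    (hmem : ∀ i, i ∈ U i) (c : B → B → B → A)
    (hc : ∀ i j, ∀ x ∈ U i, x ∈ U j → ∀ᶠ y in 𝓝 x, c i j y = c i j x)
    (hcoc : ∀ i j k, ∀ x ∈ U i, x ∈ U j → x ∈ U k → c i j x + c j k x = c i k x) :
    ∃ v : B → B → A, (∀ i, ∀ x ∈ U i, ∀ᶠ y in 𝓝 x, v i y = v i x) ∧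
      ∀ i j, ∀ x ∈ U i, x ∈ U j → v i x + c i j x = v j x := by
  let τ : TopologicalSpace A := ⊥
  have : DiscreteTopology A := ⟨rfl⟩
  -- The cocycle glues the products U i × A, with `A` discrete, to a covering of `B`. As `B` is
  -- simply connected, its identity lifts to a global section of the covering, and the coordinates
  -- of this section in the charts are the cochain `v`.
  let Z : FiberBundleCore B B A :=
    { baseSet := U
      isOpen_baseSet := hU
      indexAt := id
      mem_baseSet_at := hmem
      coordChange := fun i j x w => w + c i j x
      coordChange_self := fun i x hx w => by
        have := hcoc i i i x hx hx hx
        rw [add_eq_left] at this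
        rw [this, add_zero]
      continuousOn_coordChange := fun i j => by
        rintro ⟨x, w⟩ ⟨⟨hi, hj⟩, -⟩
        apply ContinuousAt.continuousWithinAt
        refine continuousAt_snd.add (ContinuousAt.comp (f := Prod.fst) (g := c i j) ?_
          continuousAt_fst)
        exact continuousAt_const.congr ((hc i j x hi hj).mono fun y hy => hy.symm)
      coordChange_comp := by
        rintro i j k x ⟨⟨hi, hj⟩, hk⟩ w
        rw [add_assoc, hcoc i j k x hi hj hk] }
  have cov : IsCoveringMap (Bundle.TotalSpace.proj : Z.TotalSpace → B) :=
    FiberBundle.isCoveringMap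
  let b : B := Classical.arbitrary B
  obtain ⟨f, ⟨-, hf⟩, -⟩ := cov.existsUnique_continuousMap_lifts (ContinuousMap.id B) b
    (⟨b, (0 : A)⟩ : Z.TotalSpace) rfl
  have hf' : ∀ x, (f x).proj = x := fun x => congrFun hf x
  let g : B → A := fun x => (f x).2
  have hv : ∀ i x, (Z.localTriv i (f x)).2 = g x + c x i x := by
    intro i x
    rw [Z.localTriv_apply]
    change g x + c (f x).1 i (f x).1 = _
    rw [hf' x]
  refine ⟨fun i x => (Z.localTriv i (f x)).2, fun i x hx => ?_, fun i j x hi hj => ?_⟩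
  · have hx' : f x ∈ (Z.localTriv i).source := by
      rw [Z.mem_localTriv_source]
      change (f x).proj ∈ U i
      rwa [hf']
    have : ContinuousAt (fun y => (Z.localTriv i (f y)).2) x :=
      continuousAt_snd.comp (((Z.localTriv i).continuousAt hx').comp f.continuous.continuousAt)
    exact (this.eventually (mem_nhds_discrete.2 rfl)).mono fun _ h => h.symm
  · change (Z.localTriv i (f x)).2 + _ = (Z.localTriv j (f x)).2
    rw [hv, hv, add_assoc, hcoc x i j x (hmem x) hi hj]


/-! ## Torsors over the upper half-plane -/

section Germ

variable {A : Sheaf moduliTopology AddCommGrpCat.{0}} {P : PresheafWithAction A.obj} {X : Family}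
  {U U' U'' : Opens (Fin X.dim → ℂ)} {hU : U ≤ X.base} {hU' : U' ≤ X.base} {hU'' : U'' ≤ X.base}

/-- Near the point `x`, the section `p` is the translate of the section `p'` by `v`. -/
def GermEq (p : P.carrier.obj (op (X.restrict U hU))) (p' : P.carrier.obj (op (X.restrict U' hU')))
    (v : A.obj.obj (op X)) (x : Fin X.dim → ℂ) : Prop :=
  ∃ (W : Opens (Fin X.dim → ℂ)) (h : W ≤ U) (h' : W ≤ U'), x ∈ W ∧
    P.carrier.map (X.resHom hU h).op p =
      P.act _ (A.obj.map (X.incl W (h.trans hU)).op v)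
        (P.carrier.map (X.resHom hU' h').op p')

variable {p : P.carrier.obj (op (X.restrict U hU))} {p' : P.carrier.obj (op (X.restrict U' hU'))}
  {p'' : P.carrier.obj (op (X.restrict U'' hU''))} {v v' : A.obj.obj (op X)}
  {x : Fin X.dim → ℂ}

lemma GermEq.eventually {x : X.base} (h : GermEq p p' v x) :
    ∀ᶠ y : X.base in 𝓝 x, GermEq p p' v y := by
  obtain ⟨W, h, h', hx, e⟩ := h
  filter_upwards [(W.2.preimage continuous_subtype_val).mem_nhds hx] with y hy
  exact ⟨W, h, h', hy, e⟩

lemma restrict_translate {V W : Opens (Fin X.dim → ℂ)} (hV : V ≤ W) (hW : W ≤ U) (hW' : W ≤ U')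
    (e : P.carrier.map (X.resHom hU hW).op p =
      P.act _ (A.obj.map (X.incl W (hW.trans hU)).op v)
        (P.carrier.map (X.resHom hU' hW').op p')) :
    P.carrier.map (X.resHom hU (hV.trans hW)).op p =
      P.act _ (A.obj.map (X.incl V ((hV.trans hW).trans hU)).op v)
        (P.carrier.map (X.resHom hU' (hV.trans hW')).op p') := by
  have := congrArg (P.carrier.map (X.resHom (hW.trans hU) hV).op) e
  rwa [P.map_act, ← types_map_comp, ← presheaf_map_comp, ← types_map_comp,
    X.resHom_comp_resHom, X.resHom_comp_incl, X.resHom_comp_resHom hU' hW' hV] at this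

lemma GermEq.trans (h : GermEq p p' v x) (h' : GermEq p' p'' v' x) :
    GermEq p p'' (v + v') x := by
  obtain ⟨W, h₁, h₂, hx, e⟩ := h
  obtain ⟨W', h₁', h₂', hx', e'⟩ := h'
  have e := restrict_translate (inf_le_left : W ⊓ W' ≤ W) h₁ h₂ e
  have e' := restrict_translate (inf_le_right : W ⊓ W' ≤ W') h₁' h₂' e'
  refine ⟨W ⊓ W', inf_le_left.trans h₁, inf_le_right.trans h₂', ⟨hx, hx'⟩, ?_⟩
  rw [e, e', ← P.add_act, ← map_add]

lemma GermEq.symm (h : GermEq p p' v x) : GermEq p' p (-v) x := by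
  obtain ⟨W, h₁, h₂, hx, e⟩ := h
  refine ⟨W, h₂, h₁, hx, ?_⟩
  rw [e, ← P.add_act, ← map_add, neg_add_cancel, map_zero, P.zero_act]

lemma germEq_translate {W : Opens (Fin X.dim → ℂ)} (hW : W ≤ U) (hx : x ∈ W) :
    GermEq (P.act _ (A.obj.map (X.incl W (hW.trans hU)).op v)
      (P.carrier.map (X.resHom hU hW).op p)) p v x :=
  ⟨W, le_rfl, hW, hx, types_map_id _⟩

lemma torsion_map_incl_apply {N : ℕ} {W : Opens (Fin X.dim → ℂ)} (hW : W ≤ X.base)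
    (v : torsionSections N X) (u : W) :
    ((torsionSheaf N).obj.map (X.incl W hW).op v :
      torsionSections N (X.restrict W hW)).1 u = v.1 ⟨u, hW u.2⟩ :=
  pullSection_incl X W hW v.1 u

/-- The action is simply transitive, so `v` and `v'` agree near `x`; over a connected base, torsion
sections that agree at one point are equal. -/
lemma GermEq.unique {P : PresheafWithAction (torsionSheaf 2).obj} (hP : P.IsTorsor)
    [PreconnectedSpace X.base] {p : P.carrier.obj (op (X.restrict U hU))}
    {p' : P.carrier.obj (op (X.restrict U' hU'))} {v v' : (torsionSheaf 2).obj.obj (op X)}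
    {x : Fin X.dim → ℂ} (h : GermEq p p' v x) (h' : GermEq p p' v' x) : v = v' := by
  obtain ⟨W, h₁, h₂, hx, e⟩ := h
  obtain ⟨W', h₁', h₂', hx', e'⟩ := h'
  have e := restrict_translate (inf_le_left : W ⊓ W' ≤ W) h₁ h₂ e
  have e' := restrict_translate (inf_le_right : W ⊓ W' ≤ W') h₁' h₂' e'
  have hv := hP.act_injective (e.symm.trans e')
  have := congrFun (congrArg Subtype.val hv) (⟨x, hx, hx'⟩ : (W ⊓ W' : Opens (Fin X.dim → ℂ)))
  have h1 := torsion_map_incl_apply ((inf_le_left.trans h₁).trans hU) v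
    (⟨x, hx, hx'⟩ : (W ⊓ W' : Opens (Fin X.dim → ℂ)))
  have h2 := torsion_map_incl_apply ((inf_le_left.trans h₁).trans hU) v'
    (⟨x, hx, hx'⟩ : (W ⊓ W' : Opens (Fin X.dim → ℂ)))
  exact torsionSections_eq_of_apply_eq two_ne_zero (h1.symm.trans (this.trans h2))

lemma torsion_eq_near {N : ℕ} (hN : N ≠ 0) {W : Opens (Fin X.dim → ℂ)} (hW : W ≤ X.base)
    (a : torsionSections N (X.restrict W hW)) (v : torsionSections N X) (u : W)
    (h : a.1 u = v.1 ⟨u, hW u.2⟩) : ∃ (V : Opens (Fin X.dim → ℂ)) (hV : V ≤ W), u.1 ∈ V ∧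
      (torsionSheaf N).obj.map (X.resHom hW hV).op a =
        (torsionSheaf N).obj.map (X.incl V (hV.trans hW)).op v := by
  suffices H : ∃ (V : Opens (Fin X.dim → ℂ)) (hV : V ≤ W), u.1 ∈ V ∧
      ∀ y : V, a.1 (⟨y.1, hV y.2⟩ : W) = v.1 ⟨y.1, hW (hV y.2)⟩ by
    obtain ⟨V, hV, huV, h⟩ := H
    refine ⟨V, hV, huV, Subtype.ext (funext fun y : V => ?_)⟩
    have h1 := torsion_map_incl_apply (X := X.restrict W hW) hV a y
    have h2 := torsion_map_incl_apply (hV.trans hW) v y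
    exact h1.trans ((h y).trans h2.symm)
  let b : torsionSections N (X.restrict W hW) := (torsionSheaf N).obj.map (X.incl W hW).op v
  have hb : ∀ u : W, b.1 u = v.1 ⟨u, hW u.2⟩ := torsion_map_incl_apply hW v
  obtain ⟨V, hV, huV, hp⟩ := exists_open_of_eventually (X := X.restrict W hW)
    (eventually_eq_iff_of_torsion hN (a.2.1 u) (b.2.1 u) (torsion_apply a) (torsion_apply b))
  exact ⟨V, hV, huV, fun y => ((hp y).2 (h.trans (hb u).symm)).trans (hb _)⟩

end Germ

variable {P : PresheafWithAction (torsionSheaf 2).obj}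

/-- The two sections differ near `x` by a two-torsion section. Its value at `x` is that of a
half-period, which exists over the whole upper half-plane and agrees with it near `x`. Transition
cocycles thus take values in a constant group. -/
lemma exists_germEq (hP : P.IsTorsor (A := torsionSheaf 2))
    {U U' : Opens (Fin upperFamily.dim → ℂ)} {hU : U ≤ upperFamily.base}
    {hU' : U' ≤ upperFamily.base} (p : P.carrier.obj (op (upperFamily.restrict U hU)))
    (p' : P.carrier.obj (op (upperFamily.restrict U' hU'))) {x : Fin upperFamily.dim → ℂ}
    (hx : x ∈ U) (hx' : x ∈ U') : ∃ v : (torsionSheaf 2).obj.obj (op upperFamily), GermEq p p' v x := by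
  have h : U ⊓ U' ≤ U := inf_le_left
  have h' : U ⊓ U' ≤ U' := inf_le_right
  obtain ⟨a, ha, -⟩ := hP.existsUnique_act _ (P.carrier.map (upperFamily.resHom hU' h').op p')
    (P.carrier.map (upperFamily.resHom hU h).op p)
  let u : (U ⊓ U' : Opens (Fin upperFamily.dim → ℂ)) := ⟨x, hx, hx'⟩
  have ha2 := torsion_apply (show torsionSections 2 (upperFamily.restrict _ (h.trans hU)) from a) u
  obtain ⟨m, n, hmn⟩ := exists_halfPeriod_apply ⟨x, hU hx⟩ ha2
  obtain ⟨V, hV, hxV, e⟩ := torsion_eq_near two_ne_zero (h.trans hU) a (halfPeriod m n) u hmn.symm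
  refine ⟨halfPeriod m n, V, hV.trans h, hV.trans h', hxV, ?_⟩
  have := congrArg (P.carrier.map (upperFamily.resHom (h.trans hU) hV).op) ha
  rw [P.map_act, ← types_map_comp, ← types_map_comp] at this
  rw [upperFamily.resHom_comp_resHom hU h hV, upperFamily.resHom_comp_resHom hU' h' hV] at this
  exact this.symm.trans (congrArg (fun b => P.act _ b _) e)

/-- Every `𝓔[2]`-torsor has a section over the upper half-plane. -/
theorem exists_upper_section (hP : P.IsTorsor (A := torsionSheaf 2)) :
    Nonempty (P.carrier.obj (op upperFamily)) := by
  obtain ⟨R, hR, hne⟩ := hP.locally_nonempty upperFamily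
  choose U hU hs hRU using hR
  let p : ∀ s, P.carrier.obj (op (upperFamily.restrict (U s) (hU s))) := fun s =>
    (hne _ (hRU s)).some
  -- The transition cocycle of the local sections; the value 0 away from the overlaps is a
  -- convention.
  have hex : ∀ (i j x : upperFamily.base), ∃ v : (torsionSheaf 2).obj.obj (op upperFamily),
      ∀ (_ : x.1 ∈ U i) (_ : x.1 ∈ U j), GermEq (p i) (p j) v x.1 := by
    intro i j x
    by_cases hi : x.1 ∈ U i
    · by_cases hj : x.1 ∈ U j
      · obtain ⟨v, hv⟩ := exists_germEq hP (p i) (p j) hi hj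
        exact ⟨v, fun _ _ => hv⟩
      · exact ⟨0, fun _ h => absurd h hj⟩
    · exact ⟨0, fun h => absurd h hi⟩
  choose c hc using hex
  have hopen : ∀ i, ∀ x : upperFamily.base, x.1 ∈ U i →
      ∀ᶠ y : upperFamily.base in 𝓝 x, y.1 ∈ U i := fun i x hx =>
    ((U i).2.preimage continuous_subtype_val).mem_nhds hx
  obtain ⟨v, hv, hvc⟩ := exists_coboundary (B := upperFamily.base) (fun i => {x | x.1 ∈ U i})
    (fun i => (U i).2.preimage continuous_subtype_val) hs c
    (fun i j x hi hj => by
      filter_upwards [(hc i j x hi hj).eventually, hopen i x hi, hopen j x hj] with y hy hyi hyj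
      exact (hc i j y hyi hyj).unique hP hy)
    (fun i j k x hi hj hk =>
      ((hc i j x hi hj).trans (hc j k x hj hk)).unique hP (hc i k x hi hk))
  -- The cochain `v s` is only locally constant on `U s`; after shrinking to `W s` it is the single
  -- torsion section `v s s`, by which `p s` can be translated.
  have hW : ∀ s, ∃ (W : Opens (Fin upperFamily.dim → ℂ)) (hW : W ≤ U s), s.1 ∈ W ∧
      ∀ u : W, v s ⟨u.1, hU s (hW u.2)⟩ = v s s := by
    intro s
    obtain ⟨W, hWb, hsW, h⟩ := exists_open_of_eventually ((hv s s (hs s)).and (hopen s s (hs s)))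
    exact ⟨W, fun x hx => (h ⟨x, hx⟩).2, hsW, fun u => (h u).1⟩
  choose W hWU hsW hWv using hW
  refine exists_section_of_locally_eq hP.isSheaf W (fun s => (hWU s).trans (hU s)) hsW
    (fun s => P.act _ ((torsionSheaf 2).obj.map (upperFamily.incl (W s) _).op (v s s))
      (P.carrier.map (upperFamily.resHom (hU s) (hWU s)).op (p s))) ?_
  intro s t x hxs hxt
  -- The two corrected sections differ near `x` by v_s + c_st - v_t, which vanishes by the
  -- coboundary relation.
  have h := ((germEq_translate (v := v s s) (p := p s) (hWU s) hxs).trans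
    (hc s t ⟨x, hU s (hWU s hxs)⟩ (hWU s hxs) (hWU t hxt))).trans
    (germEq_translate (v := v t t) (p := p t) (hWU t) hxt).symm
  have h0 : v s s + c s t ⟨x, hU s (hWU s hxs)⟩ + -v t t = 0 := by
    rw [← hWv s ⟨x, hxs⟩, ← hWv t ⟨x, hxt⟩, hvc s t _ (hWU s hxs) (hWU t hxt), add_neg_cancel]
  rw [h0] at h
  obtain ⟨V, h₁, h₂, hxV, e⟩ := h
  refine ⟨V, h₁, h₂, hxV, ?_⟩
  rwa [map_zero, P.zero_act] at e


/-! ## The action of the modular group on sections over the upper half-plane -/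

section UpperSections

variable (P : PresheafWithAction (torsionSheaf 2).obj)

/-- The sections over the upper half-plane. -/
abbrev UpperSections : Type := P.carrier.obj (op upperFamily)

variable {P}

/-- Pullback of sections over the upper half-plane along an element of the modular group. -/
noncomputable def modularMap (γ : Matrix.SpecialLinearGroup (Fin 2) ℤ) (p : UpperSections P) :
    UpperSections P :=
  P.carrier.map (modularHom γ).op p

/-- Translation of sections over the upper half-plane by the half-period `m / 2 + n τ / 2`. -/
noncomputable def halfAct (m n : ℤ) (p : UpperSections P) : UpperSections P :=
  P.act (op upperFamily) (halfPeriod m n) p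

lemma modularMap_one (p : UpperSections P) : modularMap 1 p = p := by
  rw [modularMap, modularHom_one]
  exact types_map_id p

lemma modularMap_mul (γ δ : Matrix.SpecialLinearGroup (Fin 2) ℤ) (p : UpperSections P) :
    modularMap (γ * δ) p = modularMap δ (modularMap γ p) := by
  rw [modularMap, modularHom_mul]
  exact types_map_comp _ _ p

lemma halfAct_zero (p : UpperSections P) : halfAct 0 0 p = p := by
  rw [halfAct, halfPeriod_zero]
  exact P.zero_act _ p

lemma halfAct_halfAct (m n m' n' : ℤ) (p : UpperSections P) :
    halfAct m n (halfAct m' n' p) = halfAct (m + m') (n + n') p := by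
  rw [halfAct, halfAct, halfAct, ← halfPeriod_add]
  exact (P.add_act _ _ _ p).symm

lemma halfAct_congr {m n m' n' : ℤ} (h : 2 ∣ m - m') (h' : 2 ∣ n - n') (p : UpperSections P) :
    halfAct m n p = halfAct m' n' p := by
  rw [halfAct, halfPeriod_eq_iff.2 ⟨h, h'⟩, halfAct]

lemma halfAct_eq_iff (hP : P.IsTorsor (A := torsionSheaf 2)) {m n m' n' : ℤ}
    {p : UpperSections P} :
    halfAct m n p = halfAct m' n' p ↔ 2 ∣ m - m' ∧ 2 ∣ n - n' :=
  ⟨fun h => halfPeriod_eq_iff.1 (hP.act_injective h), fun h => halfAct_congr h.1 h.2 p⟩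

lemma exists_halfAct (hP : P.IsTorsor (A := torsionSheaf 2)) (p p' : UpperSections P) :
    ∃ m n, p' = halfAct m n p := by
  obtain ⟨a, ha, -⟩ := hP.existsUnique_act _ p p'
  obtain ⟨m, n, rfl⟩ := exists_halfPeriod a
  exact ⟨m, n, ha.symm⟩

lemma modularMap_halfAct (γ : Matrix.SpecialLinearGroup (Fin 2) ℤ) (m n : ℤ)
    (p : UpperSections P) : modularMap γ (halfAct m n p) =
      halfAct (γ 1 1 * m + γ 0 1 * n) (γ 1 0 * m + γ 0 0 * n) (modularMap γ p) := by
  refine (P.map_act _ _ _).trans ?_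
  exact congrArg (fun v => P.act _ v _) (halfPeriod_pull γ m n)

lemma modularMap_S_halfAct (m n : ℤ) (p : UpperSections P) :
    modularMap ModularGroup.S (halfAct m n p) = halfAct (-n) m (modularMap ModularGroup.S p) := by
  rw [modularMap_halfAct]
  simp [ModularGroup.S]

lemma modularMap_ST_halfAct (m n : ℤ) (p : UpperSections P) :
    modularMap (ModularGroup.S * ModularGroup.T) (halfAct m n p) =
      halfAct (m - n) m (modularMap (ModularGroup.S * ModularGroup.T) p) := by
  rw [modularMap_halfAct]
  congr 1 <;> rw [Matrix.SpecialLinearGroup.coe_mul] <;>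
    simp [ModularGroup.S, ModularGroup.T, Matrix.mul_apply, sub_eq_add_neg]

/-- Both sides are -1. Apart from the generators, this is the only relation in SL₂(ℤ) that the
classification needs. -/
lemma modular_S_sq_eq : ModularGroup.S * ModularGroup.S =
    (ModularGroup.S * ModularGroup.T) * (ModularGroup.S * ModularGroup.T) *
      (ModularGroup.S * ModularGroup.T) := by
  decide

/-- The normal form of the cocycle of an `𝓔[2]`-torsor. -/
lemma exists_normal_section (hP : P.IsTorsor (A := torsionSheaf 2)) :
    ∃ p : UpperSections P, modularMap (ModularGroup.S * ModularGroup.T) p = p ∧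
      (modularMap ModularGroup.S p = halfAct 0 0 p ∨
        modularMap ModularGroup.S p = halfAct 1 1 p) := by
  obtain ⟨q⟩ := exists_upper_section hP
  obtain ⟨m, n, hq⟩ := exists_halfAct hP q (modularMap (ModularGroup.S * ModularGroup.T) q)
  -- On coordinates ST acts by R(m, n) = (m - n, m), and 1 - R has determinant one. The vector w =
  -- (m - n, m) is the solution of w = Rw + (m, n), so translation by it gives an ST-invariant
  -- section.
  obtain ⟨p, hp⟩ : ∃ p, p = halfAct (m - n) m q := ⟨_, rfl⟩
  have hR : modularMap (ModularGroup.S * ModularGroup.T) p = p := by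
    rw [hp, modularMap_ST_halfAct, hq, halfAct_halfAct]
    congr 1 <;> ring
  refine ⟨p, hR, ?_⟩
  obtain ⟨a, b, hS⟩ := exists_halfAct hP p (modularMap ModularGroup.S p)
  -- Applying S twice to `p` translates it by v + Sv for v = (a, b), whereas S² = (ST)³ fixes `p`.
  -- Hence `a` and `b` have the same parity.
  have h : halfAct (-b + a) (a + b) p = halfAct 0 0 p := by
    rw [← halfAct_halfAct, ← hS, ← modularMap_S_halfAct, ← hS, ← modularMap_mul, modular_S_sq_eq,
      modularMap_mul _ (ModularGroup.S * ModularGroup.T),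
      modularMap_mul (ModularGroup.S * ModularGroup.T) (ModularGroup.S * ModularGroup.T), hR, hR,
      hR, halfAct_zero]
  have h' := ((halfAct_eq_iff hP).1 h).1
  rw [hS]
  rcases Int.even_or_odd' a with ⟨k, hk | hk⟩
  · exact Or.inl (halfAct_congr (by omega) (by omega) p)
  · exact Or.inr (halfAct_congr (by omega) (by omega) p)

variable {T : PresheafWithAction (torsionSheaf 2).obj}

/-- The cocycle of a torsor is determined by its values on generators of the modular group. -/
lemma exists_modularMap_eq (t : UpperSections T) (p : UpperSections P)
    (hRt : modularMap (ModularGroup.S * ModularGroup.T) t = t)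
    (hRp : modularMap (ModularGroup.S * ModularGroup.T) p = p) {a b : ℤ}
    (hSt : modularMap ModularGroup.S t = halfAct a b t)
    (hSp : modularMap ModularGroup.S p = halfAct a b p)
    (γ : Matrix.SpecialLinearGroup (Fin 2) ℤ) :
    ∃ m n, modularMap γ t = halfAct m n t ∧ modularMap γ p = halfAct m n p := by
  have inv : ∀ {Q : PresheafWithAction (torsionSheaf 2).obj} {q : UpperSections Q}
      {γ : Matrix.SpecialLinearGroup (Fin 2) ℤ} {m n : ℤ}, modularMap γ q = halfAct m n q →
      modularMap γ⁻¹ q = halfAct (-(γ⁻¹ 1 1 * m + γ⁻¹ 0 1 * n))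
        (-(γ⁻¹ 1 0 * m + γ⁻¹ 0 0 * n)) q := by
    intro Q q γ m n h
    have h1 := congrArg (modularMap γ⁻¹) h
    rw [← modularMap_mul, mul_inv_cancel, modularMap_one, modularMap_halfAct] at h1
    conv_rhs => rw [h1, halfAct_halfAct]
    rw [neg_add_cancel, neg_add_cancel, halfAct_zero]
  -- The elements with equal cocycle values form a subgroup, because the values on products and
  -- inverses follow from the action on half-periods, which is the same for both torsors.
  let K : Subgroup (Matrix.SpecialLinearGroup (Fin 2) ℤ) :=
    { carrier := {γ | ∃ m n, modularMap γ t = halfAct m n t ∧ modularMap γ p = halfAct m n p}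
      one_mem' := ⟨0, 0, by rw [modularMap_one, halfAct_zero], by
        rw [modularMap_one, halfAct_zero]⟩
      mul_mem' := by
        rintro γ δ ⟨m, n, h1, h2⟩ ⟨m', n', h1', h2'⟩
        refine ⟨δ 1 1 * m + δ 0 1 * n + m', δ 1 0 * m + δ 0 0 * n + n', ?_, ?_⟩
        · rw [modularMap_mul, h1, modularMap_halfAct, h1', halfAct_halfAct]
        · rw [modularMap_mul, h2, modularMap_halfAct, h2', halfAct_halfAct]
      inv_mem' := by
        rintro γ ⟨m, n, h1, h2⟩
        exact ⟨_, _, inv h1, inv h2⟩ }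
  have hS : ModularGroup.S ∈ K := ⟨a, b, hSt, hSp⟩
  have hR : ModularGroup.S * ModularGroup.T ∈ K :=
    ⟨0, 0, by rw [hRt, halfAct_zero], by rw [hRp, halfAct_zero]⟩
  have hT : ModularGroup.T ∈ K := by
    have := K.mul_mem (K.inv_mem hS) hR
    rwa [inv_mul_cancel_left] at this
  have htop : (⊤ : Subgroup (Matrix.SpecialLinearGroup (Fin 2) ℤ)) ≤ K := by
    rw [← SpecialLinearGroup.SL2Z_generators, Subgroup.closure_le]
    rintro _ (rfl | rfl)
    · exact hS
    · exact hT
  exact htop (Subgroup.mem_top γ)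

lemma exists_equivariant_of_modularMap_eq (hT : T.IsTorsor (A := torsionSheaf 2))
    (hP : P.IsTorsor (A := torsionSheaf 2)) (t : UpperSections T) (p : UpperSections P)
    (hRt : modularMap (ModularGroup.S * ModularGroup.T) t = t)
    (hRp : modularMap (ModularGroup.S * ModularGroup.T) p = p) {a b : ℤ}
    (hSt : modularMap ModularGroup.S t = halfAct a b t)
    (hSp : modularMap ModularGroup.S p = halfAct a b p) :
    ∃ θ : T.carrier ⟶ P.carrier,
      ∀ X a t, θ.app X (T.act X a t) = P.act X a (θ.app X t) := by
  refine PresheafWithAction.exists_equivariant_of_cocycle_eq hT hP (Set.range modularHom) upper_cover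
    upper_hom_cover t p ?_
  rintro _ ⟨γ, rfl⟩ v hv
  obtain ⟨m, n, h1, h2⟩ := exists_modularMap_eq t p hRt hRp hSt hSp γ
  rw [hT.act_injective (hv.symm.trans h1)]
  exact h2

end UpperSections

/-! ### Classification of 𝓔[2]-torsors and computation of H¹ -/

/-- A sheaf of abelian groups acting on itself. -/
def selfTorsor (A : Sheaf moduliTopology AddCommGrpCat.{0}) : PresheafWithAction A.obj where
  carrier := A.obj ⋙ forget AddCommGrpCat.{0}
  act X a b := (a + b : A.obj.obj X)
  zero_act X b := zero_add (b : A.obj.obj X)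
  add_act X a a' b := add_assoc a a' (b : A.obj.obj X)
  map_act f a b := map_add (A.obj.map f).hom a b

lemma selfTorsor_isTorsor (A : Sheaf moduliTopology AddCommGrpCat.{0}) :
    (selfTorsor A).IsTorsor where
  isSheaf := isSheaf_forget A
  existsUnique_act X (t t' : A.obj.obj X) :=
    ⟨t' - t, sub_add_cancel t' t, fun _ h => eq_sub_of_add_eq h⟩
  locally_nonempty X := ⟨⊤, moduliTopology.top_mem X, fun _ _ _ => ⟨(0 : A.obj.obj _)⟩⟩

/-- A torsor whose cocycle is trivial has a global section. -/
lemma exists_section_of_modularMap_eq {P : PresheafWithAction (torsionSheaf 2).obj}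
    (hP : P.IsTorsor (A := torsionSheaf 2)) (p : UpperSections P)
    (hR : modularMap (ModularGroup.S * ModularGroup.T) p = p)
    (hS : modularMap ModularGroup.S p = p) :
    ∃ t : ∀ X : Family, P.carrier.obj (op X),
      ∀ ⦃X Y : Family⦄ (f : Y ⟶ X), P.carrier.map f.op (t X) = t Y := by
  -- The zero sections of the trivial torsor have the same trivial cocycle as `p`; their images
  -- under the resulting equivariant map form a global section.
  let z : ∀ X : Family, (selfTorsor (torsionSheaf 2)).carrier.obj (op X) :=
    fun X => (0 : (torsionSheaf 2).obj.obj (op X))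
  have hz : ∀ ⦃X Y : Family⦄ (f : Y ⟶ X), (selfTorsor (torsionSheaf 2)).carrier.map f.op (z X) =
      z Y := fun X Y f => map_zero ((torsionSheaf 2).obj.map f.op).hom
  obtain ⟨θ, -⟩ := exists_equivariant_of_modularMap_eq (selfTorsor_isTorsor _) hP
    (z upperFamily) p (hz _) hR (a := 0) (b := 0) ((hz _).trans (halfAct_zero _).symm)
    (hS.trans (halfAct_zero _).symm)
  refine ⟨fun X => θ.app (op X) (z X), fun X Y f => ?_⟩
  rw [← NatTrans.naturality_apply, hz]

/-- An `𝓔[2]`-torsor without global sections is isomorphic to the canonical torsor. -/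
theorem exists_equivariant_of_no_section {P : PresheafWithAction (torsionSheaf 2).obj}
    (hP : P.IsTorsor (A := torsionSheaf 2))
    (h : ¬∃ t : ∀ X : Family, P.carrier.obj (op X),
      ∀ ⦃X Y : Family⦄ (f : Y ⟶ X), P.carrier.map f.op (t X) = t Y) :
    ∃ θ : canonicalTorsor.carrier ⟶ P.carrier,
      ∀ X a t, θ.app X (canonicalTorsor.act X a t) = P.act X a (θ.app X t) := by
  -- Without a global section, the trivial normal form is excluded, so both torsors have the same
  -- cocycle, with value (1, 1) at S.
  have key : ∀ {Q : PresheafWithAction (torsionSheaf 2).obj}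
      (_ : Q.IsTorsor (A := torsionSheaf 2)), (¬∃ t : ∀ X : Family, Q.carrier.obj (op X),
      ∀ ⦃X Y : Family⦄ (f : Y ⟶ X), Q.carrier.map f.op (t X) = t Y) → ∃ q : UpperSections Q,
      modularMap (ModularGroup.S * ModularGroup.T) q = q ∧
        modularMap ModularGroup.S q = halfAct 1 1 q := by
    intro Q hQ hno
    obtain ⟨q, hR, hS | hS⟩ := exists_normal_section hQ
    · exact absurd (exists_section_of_modularMap_eq hQ q hR (hS.trans (halfAct_zero q))) hno
    · exact ⟨q, hR, hS⟩
  obtain ⟨t, hRt, hSt⟩ := key canonicalTorsor_isTorsor canonicalTorsor_no_section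
  obtain ⟨p, hRp, hSp⟩ := key hP h
  exact exists_equivariant_of_modularMap_eq canonicalTorsor_isTorsor hP t p hRt hRp hSt hSp

/-- The class zero would give a global section. A nonzero class comes from a nonsplit extension,
whose torsor has no global section and is thus isomorphic to the canonical one. -/
theorem canonicalTorsor_hasClass_iff (c : (torsionSheaf 2).H 1) :
    canonicalTorsor.HasClass c ↔ c ≠ 0 := by
  constructor
  · rintro h rfl
    exact canonicalTorsor_no_section h.exists_section_of_eq_zero
  · intro hc
    obtain ⟨B, i, p, w, h, rfl⟩ := PresheafWithAction.exists_extension c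
    obtain ⟨θ, hθ⟩ := exists_equivariant_of_no_section
      (PresheafWithAction.ofExtension_isTorsor w h)
      (fun ⟨t, ht⟩ => hc (PresheafWithAction.extClass_eq_zero_of_section w h t ht))
    exact PresheafWithAction.hasClass_of_equivariant canonicalTorsor_isTorsor w h θ hθ

/-- A group with a unique nonzero element is cyclic of order two. -/
lemma nonempty_addEquiv_zmod_two {A : Type*} [AddCommGroup A] {a : A} (ha : a ≠ 0)
    (h : ∀ b : A, b ≠ 0 → b = a) : Nonempty (A ≃+ ZMod 2) := by
  have hcard : Nat.card A = 2 := by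
    rw [Nat.card_eq_two_iff]
    refine ⟨0, a, ha.symm, Set.eq_univ_of_forall fun b => ?_⟩
    by_cases hb : b = 0
    · exact Or.inl hb
    · exact Or.inr (h b hb)
  have : Fact (Nat.Prime 2) := ⟨Nat.prime_two⟩
  have := isAddCyclic_of_prime_card (p := 2) hcard
  exact ⟨(zmodAddCyclicAddEquiv ‹_›).symm.trans (ZMod.ringEquivCongr hcard).toAddEquiv⟩

end EllipticModuli

theorem mainTheorem8 :
    EllipticModuli.canonicalTorsor.IsTorsor ∧
      Nonempty ((EllipticModuli.torsionSheaf 2).H 1 ≃+ ZMod 2) ∧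
        ∀ c : (EllipticModuli.torsionSheaf 2).H 1,
          EllipticModuli.canonicalTorsor.HasClass c ↔ c ≠ 0 := by
  -- Existence of a class of T provides a nonzero element; any other nonzero element is also a class
  -- of T, hence equal to it by uniqueness.
  obtain ⟨c, hc⟩ := EllipticModuli.PresheafWithAction.IsTorsor.exists_hasClass
    EllipticModuli.canonicalTorsor_isTorsor
  refine ⟨EllipticModuli.canonicalTorsor_isTorsor, EllipticModuli.nonempty_addEquiv_zmod_two
    ((EllipticModuli.canonicalTorsor_hasClass_iff c).1 hc) fun b hb => ?_,
    EllipticModuli.canonicalTorsor_hasClass_iff⟩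
  exact EllipticModuli.canonicalTorsor_isTorsor.hasClass_unique
    ((EllipticModuli.canonicalTorsor_hasClass_iff b).2 hb) hc
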